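/- Let $\mathbb{H}^3=\{(z,t): z\in\mathbb{C},\ t>0\}$ be hyperbolic $3$-space with metric $ds^2=(|dz|^2+dt^2)/t^2$ and hyperbolic distance $\rho$, and identify its group of orientation-preserving isometries with $\mathrm{PSL}(2,\mathbb{C})$. A Kleinian group is a discrete subgroup of $\mathrm{PSL}(2,\mathbb{C})$ that is not virtually abelian. A $(2,2,2)$-Kleinian group is a Kleinian group $\Gamma=\langle f_1,f_2,f_3\rangle$ given by three generators of order two (half-turns) whose axes all lie in one hyperbolic plane; its Margulis constant, with respect to these generators, is $$m_\Gamma=\inf_{x\in\mathbb{H}^3}\ \max_{i=1,2,3}\rho(f_i(x),x).$$ **Theorem.** Let $\Gamma=\langle f_1,f_2,f_3\rangle$ be a $(2,2,2)$-Kleinian group. Then $$m_\Gamma\ \ge\ B:=2\tanh^{-1}\sqrt{\frac{\cos^2(\pi/3)+\cos^2(\pi/7)-1}{2(1+\cos(\pi/3))(1+\cos(\pi/7))}},\qquad 0.2088\le B<0.2089 .$$ The bound is sharp: there is a $(2,2,2)$-Kleinian group with $m_\Gamma=B$. It is uniquely achieved by the reflection group of the $(2,3,7)$ triangle: three elements $f_1,f_2,f_3$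 of order two in $\mathrm{PSL}(2,\mathbb{C})$ generate a $(2,2,2)$-Kleinian group with $m_\Gamma=B$ if and only if their axes are the three side lines of a hyperbolic triangle with angles $\pi/2,\pi/3,\pi/7$; and any two such triples of generators are conjugate in $\mathrm{PSL}(2,\mathbb{C})$, up to reordering. -/

import Mathlib

open scoped MatrixGroups

namespace HypThree

/-- Hyperbolic `3`-space, the upper half-space model: points `(z, t)` with `z ∈ ℂ`, `t > 0`. -/
@[ext]
structure H3 where
  z : ℂ
  t : ℝ
  t_pos : 0 < t

/-- The hyperbolic distance of the metric `(dx² + dy² + dt²) / t²`: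
`cosh ρ(p, q) = 1 + (|z - w|² + (t - s)²) / (2 t s)` for `p = (z, t)`, `q = (w, s)`. -/
noncomputable def hdist (p q : H3) : ℝ :=
  Real.arcosh (1 + (‖p.z - q.z‖ ^ 2 + (p.t - q.t) ^ 2) / (2 * p.t * q.t))

/-! ### The Poincaré extension: the action of `SL(2, ℂ)` and of `PSL(2, ℂ)` -/

/-- The common denominator `|c z + d|² + |c|² t²` of the Poincaré extension. -/
noncomputable def den (A : SL(2, ℂ)) (p : H3) : ℝ :=
  ‖A 1 0 * p.z + A 1 1‖ ^ 2 + ‖A 1 0‖ ^ 2 * p.t ^ 2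

/-- The numerator `(a z + b) conj(c z + d) + a conj(c) t²` of the Poincaré extension. -/
noncomputable def num (A : SL(2, ℂ)) (p : H3) : ℂ :=
  (A 0 0 * p.z + A 0 1) * (starRingEnd ℂ) (A 1 0 * p.z + A 1 1)
    + A 0 0 * (starRingEnd ℂ) (A 1 0) * (p.t : ℂ) ^ 2

theorem den_pos (A : SL(2, ℂ)) (p : H3) : 0 < den A p := by
  have ht := p.t_pos
  unfold den
  by_cases hc : A 1 0 = 0
  · have hdet := A.det_coe
    rw [Matrix.det_fin_two, hc] at hdet
    have hd : A 1 1 ≠ 0 := by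
      intro h
      rw [h] at hdet
      simp at hdet
    have : 0 < ‖A 1 1‖ := norm_pos_iff.mpr hd
    simp only [hc, zero_mul, zero_add, norm_zero]
    positivity
  · have : 0 < ‖A 1 0‖ := norm_pos_iff.mpr hc
    positivity

/-- The Poincaré extension to `H3` of the Möbius transformation `(a z + b) / (c z + d)`. -/
noncomputable instance : SMul SL(2, ℂ) H3 where
  smul A p := ⟨num A p / (den A p : ℂ), p.t / den A p, div_pos p.t_pos (den_pos A p)⟩

theorem smul_z (A : SL(2, ℂ)) (p : H3) : (A • p).z = num A p / (den A p : ℂ) := rfl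

theorem smul_t (A : SL(2, ℂ)) (p : H3) : (A • p).t = p.t / den A p := rfl

theorem den_coe (A : SL(2, ℂ)) (p : H3) : (den A p : ℂ) =
    (A 1 0 * p.z + A 1 1) * (starRingEnd ℂ) (A 1 0 * p.z + A 1 1)
      + A 1 0 * (starRingEnd ℂ) (A 1 0) * (p.t : ℂ) ^ 2 := by
  unfold den
  push_cast
  rw [Complex.mul_conj', Complex.mul_conj']

theorem conj_den (A : SL(2, ℂ)) (p : H3) : (starRingEnd ℂ) (den A p : ℂ) = den A p :=
  Complex.conj_ofReal _

theorem den_mul (A B : SL(2, ℂ)) (p : H3) : den (A * B) p = den A (B • p) * den B p := by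
  have hB : (den B p : ℂ) ≠ 0 := by exact_mod_cast (den_pos B p).ne'
  have h1 := den_coe (A * B) p
  have h2 := den_coe A (B • p)
  have h3 := den_coe B p
  have hn : num B p = (B 0 0 * p.z + B 0 1) * (starRingEnd ℂ) (B 1 0 * p.z + B 1 1)
    + B 0 0 * (starRingEnd ℂ) (B 1 0) * (p.t : ℂ) ^ 2 := rfl
  have hdet : B 0 0 * B 1 1 - B 0 1 * B 1 0 = 1 := by
    have := B.det_coe; rwa [Matrix.det_fin_two] at this
  have hdet' := congrArg (starRingEnd ℂ) hdet
  have key : ((den (A * B) p : ℝ) : ℂ) = (den A (B • p) * den B p : ℝ) := by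
    push_cast
    rw [h1, h2, smul_z, smul_t]
    push_cast
    simp only [map_add, map_mul, map_div₀, conj_den, Matrix.SpecialLinearGroup.coe_mul,
      Matrix.mul_apply, Fin.sum_univ_two, map_sub, map_one] at hdet' ⊢
    field_simp
    rw [h3, hn]
    simp only [map_add, map_mul, map_pow, Complex.conj_conj, Complex.conj_ofReal]
    generalize (starRingEnd ℂ) (B 0 0) = a' at *
    generalize (starRingEnd ℂ) (B 0 1) = b' at *
    generalize (starRingEnd ℂ) (B 1 0) = c' at *
    generalize (starRingEnd ℂ) (B 1 1) = d' at *
    generalize (starRingEnd ℂ) (A 1 0) = e' at *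
    generalize (starRingEnd ℂ) (A 1 1) = g' at *
    generalize (starRingEnd ℂ) p.z = w at *
    generalize (p.t : ℂ) = t at *
    generalize B 0 0 = a at *
    generalize B 0 1 = b at *
    generalize B 1 0 = c at *
    generalize B 1 1 = d at *
    generalize A 1 0 = e at *
    generalize A 1 1 = g at *
    generalize p.z = z at *
    have hprod : (a * d - b * c) * (a' * d' - b' * c') = 1 := by rw [hdet, hdet', one_mul]
    linear_combination (e * e' * t ^ 2) * hprod
  exact_mod_cast key

theorem num_mul (A B : SL(2, ℂ)) (p : H3) :
    num (A * B) p = num A (B • p) * (den B p : ℂ) := by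
  have hB : (den B p : ℂ) ≠ 0 := by exact_mod_cast (den_pos B p).ne'
  have h3 := den_coe B p
  have hn : num B p = (B 0 0 * p.z + B 0 1) * (starRingEnd ℂ) (B 1 0 * p.z + B 1 1)
    + B 0 0 * (starRingEnd ℂ) (B 1 0) * (p.t : ℂ) ^ 2 := rfl
  have hdet : B 0 0 * B 1 1 - B 0 1 * B 1 0 = 1 := by
    have := B.det_coe; rwa [Matrix.det_fin_two] at this
  have hdet' := congrArg (starRingEnd ℂ) hdet
  rw [num, num, smul_z, smul_t]
  push_cast
  simp only [map_add, map_mul, map_div₀, conj_den, Matrix.SpecialLinearGroup.coe_mul,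
    Matrix.mul_apply, Fin.sum_univ_two, map_sub, map_one] at hdet' ⊢
  field_simp
  rw [h3, hn]
  simp only [map_add, map_mul, map_pow, Complex.conj_conj, Complex.conj_ofReal]
  generalize (starRingEnd ℂ) (B 0 0) = a' at *
  generalize (starRingEnd ℂ) (B 0 1) = b' at *
  generalize (starRingEnd ℂ) (B 1 0) = c' at *
  generalize (starRingEnd ℂ) (B 1 1) = d' at *
  generalize (starRingEnd ℂ) (A 1 0) = e' at *
  generalize (starRingEnd ℂ) (A 1 1) = g' at *
  generalize (starRingEnd ℂ) p.z = w at *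
  generalize (p.t : ℂ) = t at *
  generalize B 0 0 = a at *
  generalize B 0 1 = b at *
  generalize B 1 0 = c at *
  generalize B 1 1 = d at *
  generalize A 0 0 = e at *
  generalize A 0 1 = g at *
  generalize p.z = z at *
  have hprod : (a * d - b * c) * (a' * d' - b' * c') = 1 := by rw [hdet, hdet', one_mul]
  linear_combination (e * e' * t ^ 2) * hprod

noncomputable instance : MulAction SL(2, ℂ) H3 where
  one_smul p := by
    have h : den 1 p = 1 := by simp [den]
    ext
    · rw [smul_z, h]; simp [num]
    · rw [smul_t, h, div_one]
  mul_smul A B p := by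
    have hB : (den B p : ℂ) ≠ 0 := by exact_mod_cast (den_pos B p).ne'
    ext
    · rw [smul_z, smul_z A, num_mul, den_mul]
      push_cast
      rw [mul_div_mul_right _ _ hB]
    · rw [smul_t, smul_t A, den_mul, smul_t B, div_div, mul_comm]

theorem center_smul (A : SL(2, ℂ)) (hA : A ∈ Subgroup.center SL(2, ℂ)) (p : H3) :
    A • p = p := by
  obtain ⟨r, hr, h⟩ := Matrix.SpecialLinearGroup.mem_center_iff.mp hA
  have e00 : A 0 0 = r := by rw [← h]; simp
  have e01 : A 0 1 = 0 := by rw [← h]; simp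
  have e10 : A 1 0 = 0 := by rw [← h]; simp
  have e11 : A 1 1 = r := by rw [← h]; simp
  have hr2 : r ^ 2 = 1 := by simpa using hr
  have hn : ‖r‖ ^ 2 = 1 := by rw [← norm_pow, hr2, norm_one]
  have hd : den A p = 1 := by simp [den, e10, e11, hn]
  have hc : r * (starRingEnd ℂ) r = 1 := by
    rw [Complex.mul_conj', ← Complex.ofReal_pow, hn, Complex.ofReal_one]
  ext
  · rw [smul_z, hd]
    simp only [num, e00, e01, e10, e11, map_zero, zero_mul, zero_add, add_zero, mul_zero,
      Complex.ofReal_one, div_one]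
    linear_combination p.z * hc
  · rw [smul_t, hd, div_one]

/-- The action of `PSL(2, ℂ)`, the group of orientation-preserving isometries, on `H3`. -/
noncomputable instance : MulAction PSL(2, ℂ) H3 :=
  MulAction.compHom H3 (QuotientGroup.lift (Subgroup.center SL(2, ℂ))
    (MulAction.toPermHom SL(2, ℂ) H3) (fun A hA => Equiv.ext fun p => center_smul A hA p))

/-! ### Planes, axes, angles -/

/-- Totally geodesic planes: vertical Euclidean half-planes, and hemispheres centred on `ℂ`. -/
def IsPlane (P : Set H3) : Prop :=
  (∃ (u : ℂ) (k : ℝ), u ≠ 0 ∧ P = {p | ((starRingEnd ℂ) u * p.z).re = k}) ∨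
  (∃ (c : ℂ) (r : ℝ), 0 < r ∧ P = {p | ‖p.z - c‖ ^ 2 + p.t ^ 2 = r ^ 2})

/-- The axis of an elliptic element: the hyperbolic line of its fixed points in `H3`. -/
def axis (g : PSL(2, ℂ)) : Set H3 := MulAction.fixedBy H3 g

/-- The initial direction at `p = (z, t)` of the geodesic from `p` to `q = (w, s)`, as a Euclidean
vector in `ℂ × ℝ = ℝ³`: it is minus the gradient at `p` of the distance to `q`, up to a positive
factor. It is zero if and only if `p = q`. -/
noncomputable def direction (p q : H3) : EuclideanSpace ℝ (Fin 3) :=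
  !₂[2 * p.t * (q.z - p.z).re, 2 * p.t * (q.z - p.z).im, ‖q.z - p.z‖ ^ 2 + q.t ^ 2 - p.t ^ 2]

/-- The hyperbolic angle at `p` between the geodesics from `p` to `q` and from `p` to `r`. The
upper half-space metric is conformal, so it is the Euclidean angle of the initial directions. -/
noncomputable def hangle (q p r : H3) : ℝ :=
  InnerProductGeometry.angle (direction p q) (direction p r)

/-! ### Kleinian groups and the Margulis constant -/

/-- A group is virtually abelian if it has an abelian subgroup of finite index. -/
def IsVirtuallyAbelian (G : Type*) [Group G] : Prop :=
  ∃ A : Subgroup G, A.FiniteIndex ∧ IsMulCommutative A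

/-- Kleinian groups: discrete subgroups of `PSL(2, ℂ)` that are not virtually abelian. -/
def IsKleinian (Γ : Subgroup PSL(2, ℂ)) : Prop :=
  DiscreteTopology Γ ∧ ¬ IsVirtuallyAbelian Γ

/-- The family `f` of generators makes `⟨f 0, f 1, f 2⟩` a `(2,2,2)`-Kleinian group: each `f i` has
order two (so it is a half-turn), the axes lie in one plane, and the generated group is
Kleinian. -/
def Is222Kleinian (f : Fin 3 → PSL(2, ℂ)) : Prop :=
  (∀ i, orderOf (f i) = 2) ∧ (∃ P, IsPlane P ∧ ∀ i, axis (f i) ⊆ P) ∧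
    IsKleinian (Subgroup.closure (Set.range f))

/-- The Margulis constant `inf_x max_i ρ(f i x, x)` of the group generated by the finite
family `f`. -/
noncomputable def margulisConstant {ι : Type*} [Finite ι] (f : ι → PSL(2, ℂ)) : ℝ :=
  ⨅ x : H3, ⨆ i, hdist (f i • x) x

/-- The axes of the `f i`, in some order, are the three side lines of a hyperbolic triangle with
interior angles `π/2`, `π/3`, `π/7`; the vertex `V i` is opposite to the side on the axis
of `f (σ i)`. -/
def AxesBound237Triangle (f : Fin 3 → PSL(2, ℂ)) : Prop :=
  ∃ (V : Fin 3 → H3) (σ : Equiv.Perm (Fin 3)), Function.Injective V ∧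
    (∀ i j, i ≠ j → V j ∈ axis (f (σ i))) ∧
    hangle (V 1) (V 0) (V 2) = Real.pi / 2 ∧
    hangle (V 2) (V 1) (V 0) = Real.pi / 3 ∧
    hangle (V 0) (V 2) (V 1) = Real.pi / 7

/-- The explicit lower bound. -/
noncomputable def bound237 : ℝ :=
  2 * Real.artanh (√((Real.cos (Real.pi / 3) ^ 2 + Real.cos (Real.pi / 7) ^ 2 - 1) /
    (2 * (1 + Real.cos (Real.pi / 3)) * (1 + Real.cos (Real.pi / 7)))))

end HypThree

namespace HypThree

open scoped MatrixGroups ComplexConjugate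

/-! ### The Lorentz form and root systems -/

/-- The Lorentz form of signature `(2, 1)`. -/
def lform (v w : Fin 3 → ℝ) : ℝ := v 0 * w 0 + v 1 * w 1 - v 2 * w 2

theorem lform_comm (v w : Fin 3 → ℝ) : lform v w = lform w v := by
  unfold lform; ring

theorem lform_comb_left (p q : ℝ) (v w x : Fin 3 → ℝ) :
    lform (p • v + q • w) x = p * lform v x + q * lform w x := by
  simp [lform]; ring

theorem lform_comb_right (p q : ℝ) (v w x : Fin 3 → ℝ) :
    lform x (p • v + q • w) = p * lform x v + q * lform x w := by
  simp [lform]; ring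

/-- A set of unit spacelike vectors, closed under the reflections it defines, with finitely many
members of bounded height. -/
structure IsRootSet (S : Set (Fin 3 → ℝ)) : Prop where
  unit : ∀ v ∈ S, lform v v = 1
  refl : ∀ v ∈ S, ∀ w ∈ S, w - (2 * lform v w) • v ∈ S
  fin : ∀ s : ℝ, {v ∈ S | |v 2| ≤ s}.Finite

theorem IsRootSet.neg {S : Set (Fin 3 → ℝ)} (hS : IsRootSet S) {v : Fin 3 → ℝ} (hv : v ∈ S) :
    -v ∈ S := by
  have h := hS.refl v hv v hv
  rw [hS.unit v hv] at h
  convert h using 1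
  ext i; simp; ring

/-- Cauchy–Schwarz inequality for two unit spacelike vectors. -/
theorem lform_cauchy {v w : Fin 3 → ℝ} (hv : lform v v = 1) (hw : lform w w = 1) :
    (lform v w + v 2 * w 2) ^ 2 ≤ (1 + v 2 ^ 2) * (1 + w 2 ^ 2) := by
  have h1 : 1 + v 2 ^ 2 = v 0 ^ 2 + v 1 ^ 2 := by unfold lform at hv; linarith
  have h2 : 1 + w 2 ^ 2 = w 0 ^ 2 + w 1 ^ 2 := by unfold lform at hw; linarith
  rw [h1, h2]
  have h3 : lform v w + v 2 * w 2 = v 0 * w 0 + v 1 * w 1 := by unfold lform; ring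
  rw [h3]
  nlinarith [sq_nonneg (v 0 * w 1 - v 1 * w 0)]

theorem eq_of_lform_eq_one {v w : Fin 3 → ℝ} (hv : lform v v = 1) (hw : lform w w = 1)
    (hvw : lform v w = 1) (h2 : v 2 = w 2) : v = w := by
  have h : (v 0 - w 0) ^ 2 + (v 1 - w 1) ^ 2 = 0 := by
    unfold lform at *
    rw [h2] at hv hvw
    linarith
  have h0 : v 0 - w 0 = 0 := by nlinarith [sq_nonneg (v 0 - w 0), sq_nonneg (v 1 - w 1)]
  have h1 : v 1 - w 1 = 0 := by nlinarith [sq_nonneg (v 0 - w 0), sq_nonneg (v 1 - w 1)]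
  funext i
  fin_cases i
  · simpa using sub_eq_zero.mp h0
  · simpa using sub_eq_zero.mp h1
  · simpa using h2

theorem IsRootSet.rotate {S : Set (Fin 3 → ℝ)} (hS : IsRootSet S) {v w : Fin 3 → ℝ}
    (hv : v ∈ S) (hw : w ∈ S) {θ : ℝ} (hθ : lform v w = -Real.cos θ) (hs : Real.sin θ ≠ 0)
    (k : ℕ) :
    ((Real.sin ((k + 1) * θ) / Real.sin θ) • v + (Real.sin (k * θ) / Real.sin θ) • w) ∈ S ∧
    ((Real.sin (k * θ) / Real.sin θ) • v + (Real.sin ((k + 1) * θ) / Real.sin θ) • w) ∈ S := by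
  induction k with
  | zero => simp [hs, hv, hw]
  | succ k ih =>
    have hrec : Real.sin ((k + 1 + 1) * θ) =
        2 * Real.cos θ * Real.sin ((k + 1) * θ) - Real.sin (k * θ) := by
      have h1 : ((k : ℝ) + 1 + 1) * θ = (k + 1) * θ + θ := by ring
      have h2 : (k : ℝ) * θ = (k + 1) * θ - θ := by ring
      rw [h1, h2, Real.sin_add, Real.sin_sub]; ring
    have hv1 := hS.unit v hv
    have hw1 := hS.unit w hw
    have hwv : lform w v = -Real.cos θ := by rw [lform_comm, hθ]
    push_cast
    constructor
    · have h := hS.refl v hv _ ih.2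
      rw [lform_comb_right, hv1, hθ] at h
      convert h using 1
      rw [hrec]
      funext i
      simp only [Pi.add_apply, Pi.smul_apply, Pi.sub_apply, smul_eq_mul]
      ring
    · have h := hS.refl w hw _ ih.1
      rw [lform_comb_right, hw1, hwv] at h
      convert h using 1
      rw [hrec]
      funext i
      simp only [Pi.add_apply, Pi.smul_apply, Pi.sub_apply, smul_eq_mul]
      ring

/-- `v` can be replaced, modulo multiples of `w`, by a lower root not orthogonal to `w`. -/
def Descends (S : Set (Fin 3 → ℝ)) (v w : Fin 3 → ℝ) : Prop :=
  ∃ p q : ℝ, p ≠ 0 ∧ p • v + q • w ∈ S ∧ lform (p • v + q • w) w ≠ 0 ∧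
    |(p • v + q • w) 2| < |v 2|

theorem descends_of_neg {S : Set (Fin 3 → ℝ)} (hS : IsRootSet S) {v w : Fin 3 → ℝ}
    (hv : v ∈ S) (hw : w ∈ S) (hv2 : 0 < v 2) (hw2 : 0 < w 2) (ha : 0 < lform v w)
    (h : lform v w * w 2 < v 2) : Descends S v w := by
  refine ⟨1, -(2 * lform v w), one_ne_zero, ?_, ?_, ?_⟩
  · have := hS.refl w hw v hv
    convert this using 1
    rw [lform_comm w v]
    funext i; simp; ring
  · rw [lform_comb_left, hS.unit w hw]
    intro h0; linarith
  · rw [abs_of_pos hv2, abs_lt]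
    have : 0 < lform v w * w 2 := mul_pos ha hw2
    simp only [Pi.add_apply, Pi.smul_apply, smul_eq_mul]
    constructor <;> nlinarith

theorem descends_or_of_lform_pos {S : Set (Fin 3 → ℝ)} (hS : IsRootSet S) {v w : Fin 3 → ℝ}
    (hv : v ∈ S) (hw : w ∈ S) (hne : v ≠ w) (hv2 : 0 < v 2) (hw2 : 0 < w 2)
    (ha : 0 < lform v w) : Descends S v w ∨ Descends S w v := by
  by_contra hcon
  rw [not_or] at hcon
  have h1 : v 2 ≤ lform v w * w 2 := by
    by_contra h; exact hcon.1 (descends_of_neg hS hv hw hv2 hw2 ha (not_le.mp h))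
  have h2 : w 2 ≤ lform v w * v 2 := by
    by_contra h
    rw [lform_comm] at h ha
    exact hcon.2 (descends_of_neg hS hw hv hw2 hv2 ha (not_le.mp h))
  have hc := lform_cauchy (hS.unit v hv) (hS.unit w hw)
  set a := lform v w with ha_def
  have hle : a ≤ 1 := by nlinarith
  have hvw : v 2 = w 2 := by nlinarith
  have hge : 1 ≤ a := by nlinarith
  exact hne (eq_of_lform_eq_one (hS.unit v hv) (hS.unit w hw) (le_antisymm hle hge) hvw)

theorem descends_or_of_comb {S : Set (Fin 3 → ℝ)} (hS : IsRootSet S) {v w : Fin 3 → ℝ}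
    (hv : v ∈ S) (hw : w ∈ S) (hv2 : 0 < v 2) (hw2 : 0 < w 2)
    (ha : lform v w < 0) {p q : ℝ} (hp : 0 < p) (hq : 0 < q) (h : p • v + (-q) • w ∈ S) :
    Descends S v w ∨ Descends S w v := by
  have hu := hS.unit _ h
  rw [lform_comb_left, lform_comb_right, lform_comb_right, hS.unit v hv, hS.unit w hw,
    lform_comm w v] at hu
  have hpq : 0 < p * q * -lform v w := by
    have : 0 < -lform v w := by linarith
    positivity
  have hp1 : p < 1 := by nlinarith
  have hq1 : q < 1 := by nlinarith
  have e : (p • v + (-q) • w) 2 = p * v 2 - q * w 2 := by simp; ring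
  rcases le_or_gt 0 (p * v 2 - q * w 2) with h0 | h0
  · left
    refine ⟨p, -q, hp.ne', h, ?_, ?_⟩
    · rw [lform_comb_left, hS.unit w hw]
      have := mul_pos hp (neg_pos.mpr ha)
      intro h0; linarith
    · rw [e, abs_of_nonneg h0, abs_of_pos hv2]
      nlinarith [mul_pos hq hw2, mul_pos (sub_pos.mpr hp1) hv2]
  · right
    refine ⟨-q, p, by simpa using hq.ne', by rwa [add_comm], ?_, ?_⟩
    · rw [lform_comb_left, hS.unit v hv, lform_comm w v]
      have := mul_pos hq (neg_pos.mpr ha)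
      intro h0; linarith
    · rw [add_comm, e, abs_of_neg h0, abs_of_pos hw2]
      nlinarith [mul_pos hp hv2, mul_pos (sub_pos.mpr hq1) hw2]

/-- Angles of a reduced pair of mirrors. -/
def IsReducedValue (x : ℝ) : Prop := 1 ≤ x ∨ ∃ n : ℕ, 2 ≤ n ∧ x = Real.cos (Real.pi / n)

theorem reduced_or_descends {S : Set (Fin 3 → ℝ)} (hS : IsRootSet S) {v w : Fin 3 → ℝ}
    (hv : v ∈ S) (hw : w ∈ S) (hne : v ≠ w) (hv2 : 0 < v 2) (hw2 : 0 < w 2) :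
    IsReducedValue (-lform v w) ∨ Descends S v w ∨ Descends S w v := by
  rcases lt_trichotomy (lform v w) 0 with ha | ha | ha
  · by_cases h1 : 1 ≤ -lform v w
    · exact Or.inl (Or.inl h1)
    rw [not_le] at h1
    obtain ⟨θ, hθ0, hθ1, hcos⟩ : ∃ θ, 0 < θ ∧ θ < Real.pi / 2 ∧ Real.cos θ = -lform v w := by
      refine ⟨Real.arccos (-lform v w), Real.arccos_pos.mpr h1, ?_, Real.cos_arccos (by linarith)
        h1.le⟩
      exact Real.arccos_lt_pi_div_two.mpr (by linarith)
    have hpi := Real.pi_pos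
    have hsin : 0 < Real.sin θ := Real.sin_pos_of_pos_of_lt_pi hθ0 (by linarith)
    set n := ⌊Real.pi / θ⌋₊ with hn
    have hn1 : (n : ℝ) * θ ≤ Real.pi := by
      have := Nat.floor_le (div_pos hpi hθ0).le
      rwa [← hn, le_div_iff₀ hθ0] at this
    have hn2 : Real.pi < (n + 1) * θ := by
      have := Nat.lt_floor_add_one (Real.pi / θ)
      rwa [← hn, div_lt_iff₀ hθ0] at this
    have hn3 : 2 ≤ n := by
      rw [hn]; apply Nat.le_floor
      rw [le_div_iff₀ hθ0]; push_cast; linarith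
    rcases eq_or_lt_of_le hn1 with heq | hlt
    · left; right
      refine ⟨n, hn3, ?_⟩
      have hn0 : (n : ℝ) ≠ 0 := by
        have : n ≠ 0 := by omega
        exact_mod_cast this
      rw [← hcos, ← heq, mul_div_cancel_left₀ _ hn0]
    · right
      have hr := (hS.rotate hv hw (θ := θ) (by rw [hcos]; ring) hsin.ne' n).2
      have hn0 : (0 : ℝ) < n := by
        have : 0 < n := by omega
        exact_mod_cast this
      have hs1 : 0 < Real.sin (n * θ) := Real.sin_pos_of_pos_of_lt_pi (by positivity) hlt
      have hs2 : Real.sin ((n + 1) * θ) < 0 := by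
        have := Real.sin_pos_of_pos_of_lt_pi (x := (n + 1) * θ - Real.pi) (by linarith)
          (by nlinarith)
        rw [Real.sin_sub_pi] at this
        linarith
      refine descends_or_of_comb hS hv hw hv2 hw2 ha (div_pos hs1 hsin)
        (q := -(Real.sin ((n + 1) * θ) / Real.sin θ)) ?_ (by rwa [neg_neg])
      rw [← neg_div]; exact div_pos (by linarith) hsin
  · left; right
    exact ⟨2, le_rfl, by simp [ha]⟩
  · right
    exact descends_or_of_lform_pos hS hv hw hne hv2 hw2 ha

/-! ### Reduced triples of small height -/

theorem reduced_cases {x : ℝ} (hx : IsReducedValue x) :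
    x = 0 ∨ x = 1 / 2 ∨ x = √2 / 2 ∨ Real.cos (Real.pi / 5) ≤ x := by
  rcases hx with h | ⟨n, hn, rfl⟩
  · right; right; right; exact (Real.cos_le_one _).trans h
  · rcases Nat.lt_or_ge n 5 with h5 | h5
    · interval_cases n
      · left; simp
      · right; left; simp
      · right; right; left; simp
    · right; right; right
      have : (5 : ℝ) ≤ n := by exact_mod_cast h5
      have hpi := Real.pi_pos
      refine Real.cos_le_cos_of_nonneg_of_le_pi (by positivity) (by linarith) ?_
      gcongr

theorem reduced_cases_upper {x : ℝ} (hx : IsReducedValue x) :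
    x ^ 2 ≤ 3 / 4 ∨ x = Real.cos (Real.pi / 7) ∨ Real.cos (Real.pi / 8) ≤ x := by
  rcases hx with h | ⟨n, hn, rfl⟩
  · right; right; exact (Real.cos_le_one _).trans h
  · have hpi := Real.pi_pos
    have h2 : (2 : ℝ) ≤ n := by exact_mod_cast hn
    rcases Nat.lt_or_ge n 7 with h7 | h7
    · left
      have h6 : (n : ℝ) ≤ 6 := by
        have : n ≤ 6 := by omega
        exact_mod_cast this
      have h0 : 0 ≤ Real.cos (Real.pi / n) := by
        apply Real.cos_nonneg_of_neg_pi_div_two_le_of_le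
        · have : 0 ≤ Real.pi / n := by positivity
          linarith
        · gcongr
      have h1 : Real.cos (Real.pi / n) ≤ Real.cos (Real.pi / 6) := by
        refine Real.cos_le_cos_of_nonneg_of_le_pi (by positivity) ?_ (by gcongr)
        rw [div_le_iff₀ (by linarith)]; nlinarith
      rw [Real.cos_pi_div_six] at h1
      have h3 : (√3) ^ 2 = 3 := Real.sq_sqrt (by norm_num)
      nlinarith
    · rcases Nat.eq_or_lt_of_le h7 with rfl | h8
      · right; left; norm_num
      · right; right
        have : (8 : ℝ) ≤ n := by exact_mod_cast h8
        refine Real.cos_le_cos_of_nonneg_of_le_pi (by positivity) (by linarith) ?_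
        gcongr

/-- The (negative of the) Gram determinant of a point and three mirrors. -/
def gramE (a b c x y z : ℝ) : ℝ :=
  (1 - c ^ 2) * x ^ 2 + (1 - b ^ 2) * y ^ 2 + (1 - a ^ 2) * z ^ 2 + 2 * (a + b * c) * x * y
    + 2 * (b + a * c) * x * z + 2 * (c + a * b) * y * z
    - (a ^ 2 + b ^ 2 + c ^ 2 + 2 * a * b * c - 1)

theorem gramE_swap_right (a b c x y z : ℝ) : gramE a b c x y z = gramE a c b y x z := by
  unfold gramE; ring

theorem gramE_swap_outer (a b c x y z : ℝ) : gramE a b c x y z = gramE c b a z y x := by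
  unfold gramE; ring

theorem gramE_antitone {a b c d x y z : ℝ} (ha : 0 ≤ a) (ha' : a ≤ 1.1) (hb : 0 ≤ b)
    (hb' : b ≤ 1.1) (hd : 0 ≤ d) (hdc : d ≤ c) (hc : 1 / 2 ≤ c) (hx : 0 ≤ x) (hx' : x ≤ 0.12)
    (hy : 0 ≤ y) (hy' : y ≤ 0.12) (hz : 0 ≤ z) (hz' : z ≤ 0.12) :
    gramE a b c x y z ≤ gramE a b d x y z := by
  have e : gramE a b d x y z - gramE a b c x y z =
      (c - d) * ((1 + x ^ 2) * (c + d) - 2 * (b * (x * y) + a * (x * z) + y * z - a * b)) := by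
    unfold gramE; ring
  have h1 : x * y ≤ 0.12 * 0.12 := by gcongr
  have h2 : x * z ≤ 0.12 * 0.12 := by gcongr
  have h3 : y * z ≤ 0.12 * 0.12 := by gcongr
  have h4 : b * (x * y) ≤ 1.1 * (0.12 * 0.12) := by gcongr
  have h5 : a * (x * z) ≤ 1.1 * (0.12 * 0.12) := by gcongr
  have h6 : 0 ≤ a * b := mul_nonneg ha hb
  have h7 : 0 ≤ x ^ 2 * (c + d) := by positivity
  have : 0 ≤ (c - d) *
      ((1 + x ^ 2) * (c + d) - 2 * (b * (x * y) + a * (x * z) + y * z - a * b)) := by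
    apply mul_nonneg (by linarith)
    nlinarith
  linarith

theorem gramE_le {a b c x y z s : ℝ} (ha : 0 ≤ a) (ha' : a ≤ 1) (hb : 0 ≤ b) (hb' : b ≤ 1)
    (hc : 0 ≤ c) (hc' : c ≤ 1) (hx : 0 ≤ x) (hx' : x ≤ s) (hy : 0 ≤ y) (hy' : y ≤ s)
    (hz : 0 ≤ z) (hz' : z ≤ s) : gramE a b c x y z ≤ gramE a b c s s s := by
  have hs : 0 ≤ s := hx.trans hx'
  have h1 : 0 ≤ 1 - a ^ 2 := by nlinarith
  have h2 : 0 ≤ 1 - b ^ 2 := by nlinarith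
  have h3 : 0 ≤ 1 - c ^ 2 := by nlinarith
  unfold gramE
  gcongr

theorem cos_pi_div_five_bounds : 0.809 ≤ Real.cos (Real.pi / 5) ∧
    Real.cos (Real.pi / 5) ≤ 0.81 := by
  rw [Real.cos_pi_div_five]
  have h : (√5) ^ 2 = 5 := Real.sq_sqrt (by norm_num)
  have h0 : 0 ≤ √5 := Real.sqrt_nonneg _
  constructor <;> nlinarith

theorem sqrt_two_div_two_bounds : 0.707 ≤ √2 / 2 ∧ √2 / 2 ≤ 0.7072 := by
  have h : (√2) ^ 2 = 2 := Real.sq_sqrt (by norm_num)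
  have h0 : 0 ≤ √2 := Real.sqrt_nonneg _
  constructor <;> nlinarith

theorem cos_pi_div_eight_bounds : 0.9238 ≤ Real.cos (Real.pi / 8) ∧
    Real.cos (Real.pi / 8) ≤ 0.924 := by
  rw [Real.cos_pi_div_eight]
  have h0 := sqrt_two_div_two_bounds
  have h : (√(2 + √2)) ^ 2 = 2 + √2 := Real.sq_sqrt (by positivity)
  have h1 : 0 ≤ √(2 + √2) := Real.sqrt_nonneg _
  constructor <;> nlinarith

theorem reduced_sorted {a b c x y z : ℝ} (ha : IsReducedValue a) (hb : IsReducedValue b)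
    (hc : IsReducedValue c) (hab : a ≤ b) (hbc : b ≤ c) (hc' : c ≤ 1.1)
    (hx : 0 ≤ x) (hx' : x ≤ 0.12) (hy : 0 ≤ y) (hy' : y ≤ 0.12) (hz : 0 ≤ z) (hz' : z ≤ 0.12)
    (hE : gramE a b c x y z = 0) (hD : 0 < a ^ 2 + b ^ 2 + c ^ 2 + 2 * a * b * c - 1)
    (h0 : ¬ (a = 0 ∧ b = 0)) : a = 0 ∧ b = 1 / 2 ∧ c = Real.cos (Real.pi / 7) := by
  have h2 := sqrt_two_div_two_bounds
  have h5 := cos_pi_div_five_bounds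
  have h8 := cos_pi_div_eight_bounds
  have hsq2 : (√2 / 2) ^ 2 = 1 / 2 := by
    rw [div_pow, Real.sq_sqrt (by norm_num)]; norm_num
  have big : √2 / 2 ≤ b → Real.cos (Real.pi / 5) ≤ c → 0 ≤ a → False := by
    intro hb1 hc1 ha0
    have e1 := gramE_antitone (c := c) (d := Real.cos (Real.pi / 5)) (a := a) (b := b) ha0
      (by linarith) (by linarith) (by linarith) (by linarith) hc1 (by linarith) hx hx' hy hy' hz hz'
    have e2 := gramE_antitone (c := b) (d := √2 / 2) (a := a) (b := Real.cos (Real.pi / 5)) ha0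
      (by linarith) (by linarith) (by linarith) (by linarith) hb1 (by linarith) hy hy' hx hx' hz hz'
    rw [gramE_swap_right a _ b, gramE_swap_right a _ (√2 / 2)] at e2
    have e3 : gramE a (√2 / 2) (Real.cos (Real.pi / 5)) x y z ≤
        gramE 0 (√2 / 2) (Real.cos (Real.pi / 5)) x y z := by
      rcases eq_or_lt_of_le ha0 with h | h
      · rw [← h]
      · have ha1 : 1 / 2 ≤ a := by
          rcases reduced_cases ha with h' | h' | h' | h' <;> linarith
        rw [gramE_swap_outer a, gramE_swap_outer 0]
        exact gramE_antitone (by linarith) (by linarith) (by linarith) (by linarith) le_rfl ha0 ha1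
          hz hz' hy hy' hx hx'
    have e4 := gramE_le (a := 0) (b := √2 / 2) (c := Real.cos (Real.pi / 5)) le_rfl zero_le_one
      (by linarith) (by linarith) (by linarith) (by linarith) hx hx' hy hy' hz hz'
    have e5 : gramE 0 (√2 / 2) (Real.cos (Real.pi / 5)) 0.12 0.12 0.12 < 0 := by
      unfold gramE
      nlinarith
    linarith
  rcases reduced_cases ha with ha1 | ha1 | ha1 | ha1
  · rcases reduced_cases hb with hb1 | hb1 | hb1 | hb1
    · exact absurd ⟨ha1, hb1⟩ h0
    · rcases reduced_cases_upper hc with hc1 | hc1 | hc1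
      · rw [ha1, hb1] at hD; linarith
      · exact ⟨ha1, hb1, hc1⟩
      · exfalso
        subst ha1 hb1
        have e1 := gramE_antitone (c := c) (d := Real.cos (Real.pi / 8)) (a := 0) (b := 1 / 2)
          le_rfl (by linarith) (by linarith) (by linarith) (by linarith) hc1 (by linarith)
          hx hx' hy hy' hz hz'
        have e4 := gramE_le (a := 0) (b := 1 / 2) (c := Real.cos (Real.pi / 8)) le_rfl zero_le_one
          (by linarith) (by linarith) (by linarith) (by linarith) hx hx' hy hy' hz hz'
        have e5 : gramE 0 (1 / 2) (Real.cos (Real.pi / 8)) 0.12 0.12 0.12 < 0 := by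
          unfold gramE
          nlinarith
        linarith
    · exfalso
      refine big hb1.ge ?_ ha1.ge
      rcases reduced_cases hc with hc1 | hc1 | hc1 | hc1
      · linarith
      · linarith
      · rw [ha1, hb1, hc1, hsq2] at hD; norm_num at hD
      · exact hc1
    · exact (big (by linarith) (by linarith) ha1.ge).elim
  · have hc2 : √2 / 2 ≤ c := by
      rcases reduced_cases hc with hc1 | hc1 | hc1 | hc1
      · linarith
      · have hb1 : b = 1 / 2 := by linarith
        rw [ha1, hb1, hc1] at hD; norm_num at hD
      · linarith
      · linarith
    have e1 := gramE_antitone (c := c) (d := √2 / 2) (a := a) (b := b) (by linarith)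
      (by linarith) (by linarith) (by linarith) (by linarith) hc2 (by linarith) hx hx' hy hy' hz hz'
    have e2 := gramE_antitone (c := b) (d := 1 / 2) (a := a) (b := √2 / 2) (by linarith)
      (by linarith) (by linarith) (by linarith) (by linarith) (by linarith) (by linarith)
      hy hy' hx hx' hz hz'
    rw [gramE_swap_right a _ b, gramE_swap_right a _ (1 / 2)] at e2
    have e4 := gramE_le (a := a) (b := 1 / 2) (c := √2 / 2) (by linarith) (by linarith)
      (by linarith) (by linarith) (by linarith) (by linarith) hx hx' hy hy' hz hz'
    have e5 : gramE a (1 / 2) (√2 / 2) 0.12 0.12 0.12 < 0 := by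
      rw [ha1]
      unfold gramE
      nlinarith
    linarith
  · rcases reduced_cases hc with hc1 | hc1 | hc1 | hc1
    · linarith
    · linarith
    · have hb1 : b = √2 / 2 := by linarith
      exfalso
      have e4 := gramE_le (a := a) (b := b) (c := c) (by linarith) (by linarith)
        (by linarith) (by linarith) (by linarith) (by linarith) hx hx' hy hy' hz hz'
      have e5 : gramE a b c 0.12 0.12 0.12 < 0 := by
        have : gramE a b c 0.12 0.12 0.12 = 0.12 ^ 2 * (9 / 2 + 6 * (√2 / 2)) - 1 / 2 - √2 / 2 := by
          rw [ha1, hb1, hc1]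
          unfold gramE
          linear_combination (3 * 0.12 ^ 2 - 3 - 2 * (√2 / 2)) * hsq2
        rw [this]
        linarith
      linarith
    · exact (big (by linarith) hc1 (by linarith)).elim
  · exact (big (by linarith) (by linarith) (by linarith)).elim

/-! ### Good triples of mirrors and descent -/

/-- Three linearly independent vectors, none of which is orthogonal to the other two. -/
def IsGood (T : Fin 3 → Fin 3 → ℝ) : Prop :=
  (Matrix.of T).det ≠ 0 ∧ ∀ i, ∃ j, j ≠ i ∧ lform (T i) (T j) ≠ 0

theorem IsGood.update {T : Fin 3 → Fin 3 → ℝ} (hT : IsGood T) {i j : Fin 3} (hij : i ≠ j)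
    {p q : ℝ} (hp : p ≠ 0) (h : lform (p • T i + q • T j) (T j) ≠ 0) :
    IsGood (Function.update T i (p • T i + q • T j)) := by
  constructor
  · have e : Matrix.of (Function.update T i (p • T i + q • T j)) =
        (Matrix.of T).updateRow i (p • (Matrix.of T) i + q • (Matrix.of T) j) := rfl
    rw [e, Matrix.det_updateRow_add, Matrix.det_updateRow_smul, Matrix.det_updateRow_smul,
      Matrix.updateRow_eq_self, Matrix.det_updateRow_eq_zero hij.symm, mul_zero, add_zero]
    exact mul_ne_zero hp hT.1
  · intro k
    by_cases hki : k = i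
    · subst hki
      refine ⟨j, hij.symm, ?_⟩
      rwa [Function.update_self, Function.update_of_ne hij.symm]
    by_cases hkj : k = j
    · subst hkj
      refine ⟨i, hij, ?_⟩
      rwa [Function.update_self, Function.update_of_ne hij.symm, lform_comm]
    rw [Function.update_of_ne hki]
    by_contra hcon
    push Not at hcon
    have h1 := hcon i (Ne.symm hki)
    have h2 := hcon j (Ne.symm hkj)
    rw [Function.update_self, lform_comb_right] at h1
    rw [Function.update_of_ne hij.symm] at h2
    rw [h2, mul_zero, add_zero] at h1
    have h3 := (mul_eq_zero.mp h1).resolve_left hp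
    obtain ⟨l, hlk, hl⟩ := hT.2 k
    have : l = i ∨ l = j := by omega
    rcases this with rfl | rfl
    · exact hl h3
    · exact hl h2

theorem IsGood.smul {T : Fin 3 → Fin 3 → ℝ} (hT : IsGood T) {e : Fin 3 → ℝ}
    (he : ∀ i, e i ≠ 0) : IsGood (fun i => e i • T i) := by
  constructor
  · have : Matrix.of (fun i => e i • T i) = Matrix.of fun i j => e i * (Matrix.of T) i j := rfl
    rw [this, Matrix.det_mul_column]
    exact mul_ne_zero (Finset.prod_ne_zero_iff.mpr fun i _ => he i) hT.1
  · intro i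
    obtain ⟨j, hji, h⟩ := hT.2 i
    refine ⟨j, hji, ?_⟩
    have : lform (e i • T i) (e j • T j) = e i * e j * lform (T i) (T j) := by
      simp [lform]; ring
    rw [this]
    exact mul_ne_zero (mul_ne_zero (he i) (he j)) h

theorem IsGood.perm {T : Fin 3 → Fin 3 → ℝ} (hT : IsGood T) (τ : Equiv.Perm (Fin 3)) :
    IsGood (T ∘ τ) := by
  constructor
  · have : Matrix.of (T ∘ τ) = (Matrix.of T).submatrix τ id := rfl
    rw [this, Matrix.det_permute]
    refine mul_ne_zero ?_ hT.1
    exact_mod_cast (Equiv.Perm.sign τ).ne_zero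
  · intro i
    obtain ⟨j, hji, h⟩ := hT.2 (τ i)
    refine ⟨τ.symm j, ?_, by simpa using h⟩
    rintro rfl; simp at hji

theorem IsGood.injective {T : Fin 3 → Fin 3 → ℝ} (hT : IsGood T) {i j : Fin 3} (hij : i ≠ j) :
    T i ≠ T j := fun h => hT.1 (Matrix.det_zero_of_row_eq hij h)

/-- Up to reordering, the Gram matrix of the `(2,3,7)` triangle. -/
def Is237 (T : Fin 3 → Fin 3 → ℝ) : Prop :=
  ∃ σ : Equiv.Perm (Fin 3), lform (T (σ 1)) (T (σ 2)) = 0 ∧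
    lform (T (σ 0)) (T (σ 2)) = -(1 / 2) ∧
    lform (T (σ 0)) (T (σ 1)) = -Real.cos (Real.pi / 7)

theorem gramE_eq_zero {T : Fin 3 → Fin 3 → ℝ} (hT : ∀ i, lform (T i) (T i) = 1) :
    gramE (-lform (T 0) (T 1)) (-lform (T 0) (T 2)) (-lform (T 1) (T 2))
      (T 0 2) (T 1 2) (T 2 2) = 0 := by
  have key : ∀ v w x : Fin 3 → ℝ,
      (lform v v * lform w w * lform x x - lform v v * lform w x ^ 2 - lform w w * lform v x ^ 2
        - lform x x * lform v w ^ 2 + 2 * lform v w * lform v x * lform w x)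
      + (lform w w * lform x x - lform w x ^ 2) * v 2 ^ 2
      + (lform v v * lform x x - lform v x ^ 2) * w 2 ^ 2
      + (lform v v * lform w w - lform v w ^ 2) * x 2 ^ 2
      + 2 * (-lform v w * lform x x + lform v x * lform w x) * v 2 * w 2
      + 2 * (-lform v x * lform w w + lform v w * lform w x) * v 2 * x 2
      + 2 * (-lform w x * lform v v + lform v w * lform v x) * w 2 * x 2 = 0 := by
    intro v w x
    unfold lform; ring
  have h := key (T 0) (T 1) (T 2)
  rw [hT 0, hT 1, hT 2] at h
  unfold gramE
  linarith

theorem IsGood.discr_pos {T : Fin 3 → Fin 3 → ℝ} (hg : IsGood T)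
    (hT : ∀ i, lform (T i) (T i) = 1) :
    0 < (-lform (T 0) (T 1)) ^ 2 + (-lform (T 0) (T 2)) ^ 2 + (-lform (T 1) (T 2)) ^ 2
      + 2 * (-lform (T 0) (T 1)) * (-lform (T 0) (T 2)) * (-lform (T 1) (T 2)) - 1 := by
  have key : ∀ v w x : Fin 3 → ℝ,
      (lform v v * lform w w * lform x x - lform v v * lform w x ^ 2 - lform w w * lform v x ^ 2
        - lform x x * lform v w ^ 2 + 2 * lform v w * lform v x * lform w x) =
      -(v 0 * w 1 * x 2 - v 0 * w 2 * x 1 - v 1 * w 0 * x 2 + v 1 * w 2 * x 0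
        + v 2 * w 0 * x 1 - v 2 * w 1 * x 0) ^ 2 := by
    intro v w x
    unfold lform; ring
  have h := key (T 0) (T 1) (T 2)
  rw [hT 0, hT 1, hT 2] at h
  have hd := hg.1
  rw [Matrix.det_fin_three] at hd
  simp only [Matrix.of_apply] at hd
  have := sq_pos_of_ne_zero hd
  linarith

theorem is237_of_not_descends {S : Set (Fin 3 → ℝ)} (hS : IsRootSet S)
    {T : Fin 3 → Fin 3 → ℝ} (hg : IsGood T) (hTS : ∀ i, T i ∈ S) (hpos : ∀ i, 0 < T i 2)
    (hle : ∀ i, T i 2 ≤ 0.12) (hnd : ∀ i j, i ≠ j → ¬ Descends S (T i) (T j)) : Is237 T := by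
  have hunit : ∀ i, lform (T i) (T i) = 1 := fun i => hS.unit _ (hTS i)
  have hred : ∀ i j, i ≠ j → IsReducedValue (-lform (T i) (T j)) := fun i j hij =>
    (reduced_or_descends hS (hTS i) (hTS j) (hg.injective hij) (hpos i) (hpos j)).resolve_right
      (not_or.mpr ⟨hnd i j hij, hnd j i hij.symm⟩)
  have hub : ∀ i j, -lform (T i) (T j) ≤ 1.1 := by
    intro i j
    have hc := lform_cauchy (hunit i) (hunit j)
    have h1 := hpos i
    have h2 := hpos j
    have h3 := hle i
    have h4 := hle j
    have h5 : T i 2 * T j 2 ≤ 0.12 * 0.12 := by gcongr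
    have h6 : T i 2 ^ 2 ≤ 0.12 ^ 2 := by gcongr
    have h7 : T j 2 ^ 2 ≤ 0.12 ^ 2 := by gcongr
    have h8 : (1 + T i 2 ^ 2) * (1 + T j 2 ^ 2) ≤ (1 + 0.12 ^ 2) * (1 + 0.12 ^ 2) := by gcongr
    have h9 : |lform (T i) (T j) + T i 2 * T j 2| ≤ 1 + 0.12 ^ 2 :=
      abs_le_of_sq_le_sq (by linarith) (by norm_num)
    have := (abs_le.mp h9).1
    linarith
  obtain ⟨τ, hτ1, hτ2⟩ : ∃ τ : Equiv.Perm (Fin 3),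
      -lform (T (τ 0)) (T (τ 1)) ≤ -lform (T (τ 0)) (T (τ 2)) ∧
      -lform (T (τ 0)) (T (τ 2)) ≤ -lform (T (τ 1)) (T (τ 2)) := by
    set h : Fin 3 → ℝ := fun k => -lform (T (k + 1)) (T (k + 2)) with hh
    have hidx : ∀ i j k : Fin 3, i ≠ j → i ≠ k → j ≠ k →
        -lform (T i) (T j) = h k := by
      intro i j k hij hik hjk
      have : (i = k + 1 ∧ j = k + 2) ∨ (i = k + 2 ∧ j = k + 1) := by
        revert i j k; decide
      rcases this with ⟨rfl, rfl⟩ | ⟨rfl, rfl⟩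
      · rfl
      · rw [lform_comm]
    have hm := Tuple.monotone_sort h
    set ρ := Tuple.sort h
    have hne : ∀ i j : Fin 3, i ≠ j → ρ i ≠ ρ j := fun i j hij => ρ.injective.ne hij
    refine ⟨Fin.revPerm.trans ρ, ?_, ?_⟩
    · have e0 : (Fin.revPerm.trans ρ) 0 = ρ 2 := rfl
      have e1 : (Fin.revPerm.trans ρ) 1 = ρ 1 := rfl
      have e2 : (Fin.revPerm.trans ρ) 2 = ρ 0 := rfl
      rw [e0, e1, e2, hidx (ρ 2) (ρ 1) (ρ 0) (hne _ _ (by decide)) (hne _ _ (by decide))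
        (hne _ _ (by decide)), hidx (ρ 2) (ρ 0) (ρ 1) (hne _ _ (by decide)) (hne _ _ (by decide))
        (hne _ _ (by decide))]
      exact hm (by decide : (0 : Fin 3) ≤ 1)
    · have e0 : (Fin.revPerm.trans ρ) 0 = ρ 2 := rfl
      have e1 : (Fin.revPerm.trans ρ) 1 = ρ 1 := rfl
      have e2 : (Fin.revPerm.trans ρ) 2 = ρ 0 := rfl
      rw [e0, e1, e2, hidx (ρ 1) (ρ 0) (ρ 2) (hne _ _ (by decide)) (hne _ _ (by decide))
        (hne _ _ (by decide)), hidx (ρ 2) (ρ 0) (ρ 1) (hne _ _ (by decide)) (hne _ _ (by decide))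
        (hne _ _ (by decide))]
      exact hm (by decide : (1 : Fin 3) ≤ 2)
  have hne : ∀ i j : Fin 3, i ≠ j → τ i ≠ τ j := fun i j hij => τ.injective.ne hij
  have hgτ := hg.perm τ
  have hE := gramE_eq_zero (T := T ∘ τ) (fun i => hunit _)
  have hD := hgτ.discr_pos (fun i => hunit _)
  simp only [Function.comp_apply] at hE hD
  obtain ⟨h1, h2, h3⟩ := reduced_sorted (hred _ _ (hne 0 1 (by decide)))
    (hred _ _ (hne 0 2 (by decide))) (hred _ _ (hne 1 2 (by decide))) hτ1 hτ2 (hub _ _)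
    (hpos _).le (hle _) (hpos _).le (hle _) (hpos _).le (hle _) hE hD (by
      rintro ⟨h1, h2⟩
      obtain ⟨j, hj, h⟩ := hgτ.2 0
      simp only [Function.comp_apply] at h
      fin_cases j
      · exact hj rfl
      · exact h (neg_eq_zero.mp h1)
      · exact h (neg_eq_zero.mp h2))
  refine ⟨(Equiv.swap 0 2).trans τ, ?_, ?_, ?_⟩
  · change lform (T (τ 1)) (T (τ 0)) = 0
    rw [lform_comm]; linarith
  · change lform (T (τ 2)) (T (τ 0)) = _
    rw [lform_comm]; linarith
  · change lform (T (τ 2)) (T (τ 1)) = _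
    rw [lform_comm]; linarith

theorem exists_is237_of_generic {S : Set (Fin 3 → ℝ)} (hS : IsRootSet S)
    (hgen : ∀ v ∈ S, v 2 ≠ 0) {T : Fin 3 → Fin 3 → ℝ} (hg : IsGood T) (hTS : ∀ i, T i ∈ S)
    {s : ℝ} (hs : s ≤ 0.12) (hle : ∀ i, |T i 2| ≤ s) :
    ∃ T' : Fin 3 → Fin 3 → ℝ, Is237 T' ∧ (∀ i, T' i ∈ S) ∧ (∀ i, 0 < T' i 2 ∧ T' i 2 ≤ s) ∧
      ∑ i, T' i 2 ≤ ∑ i, |T i 2| := by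
  set C : Set (Fin 3 → Fin 3 → ℝ) :=
    {T | (∀ i, T i ∈ S ∧ 0 < T i 2 ∧ T i 2 ≤ s) ∧ IsGood T} with hC
  have hfin : C.Finite := by
    refine (Set.Finite.pi (fun _ : Fin 3 => hS.fin s)).subset ?_
    intro T hT i _
    exact ⟨(hT.1 i).1, by rw [abs_of_pos (hT.1 i).2.1]; exact (hT.1 i).2.2⟩
  have hflip : ∀ v ∈ S, ∃ e : ℝ, e ≠ 0 ∧ e • v ∈ S ∧ (e • v) 2 = |v 2| := by
    intro v hv
    rcases lt_or_gt_of_ne (hgen v hv) with h | h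
    · exact ⟨-1, by norm_num, by simpa using hS.neg hv, by simp [abs_of_neg h]⟩
    · exact ⟨1, one_ne_zero, by simpa using hv, by simp [abs_of_pos h]⟩
  choose! e he0 heS he2 using hflip
  have hT0 : (fun i => e (T i) • T i) ∈ C := by
    refine ⟨fun i => ⟨heS _ (hTS i), ?_, ?_⟩, hg.smul fun i => he0 _ (hTS i)⟩
    · exact (abs_pos.mpr (hgen _ (hTS i))).trans_eq (he2 _ (hTS i)).symm
    · exact (he2 _ (hTS i)).trans_le (hle i)
  obtain ⟨T', hT', hmin⟩ := Set.exists_min_image C (fun T => ∑ i, T i 2) hfin ⟨_, hT0⟩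
  refine ⟨T', ?_, fun i => (hT'.1 i).1, fun i => (hT'.1 i).2, ?_⟩
  · refine is237_of_not_descends hS hT'.2 (fun i => (hT'.1 i).1) (fun i => (hT'.1 i).2.1)
      (fun i => (hT'.1 i).2.2.trans hs) ?_
    rintro i j hij ⟨p, q, hp, hmem, hlf, hlt⟩
    rw [abs_of_pos (hT'.1 i).2.1] at hlt
    set w := p • T' i + q • T' j with hw
    have hew : e w • w = (e w * p) • T' i + (e w * q) • T' j := by
      rw [hw, smul_add, smul_smul, smul_smul]
    have hnew : Function.update T' i (e w • w) ∈ C := by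
      constructor
      · intro k
        by_cases hk : k = i
        · subst hk
          rw [Function.update_self]
          refine ⟨heS _ hmem, ?_, ?_⟩
          · rw [he2 _ hmem]; exact abs_pos.mpr (hgen _ hmem)
          · rw [he2 _ hmem]; exact hlt.le.trans (hT'.1 k).2.2
        · rw [Function.update_of_ne hk]; exact hT'.1 k
      · rw [hew]
        refine hT'.2.update hij (mul_ne_zero (he0 _ hmem) hp) ?_
        rw [← hew]
        have : lform (e w • w) (T' j) = e w * lform w (T' j) := by simp [lform]; ring
        rw [this]
        exact mul_ne_zero (he0 _ hmem) hlf
    have h1 := hmin _ hnew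
    have h2 : ∑ k, Function.update T' i (e w • w) k 2 < ∑ k, T' k 2 := by
      refine Finset.sum_lt_sum (fun k _ => ?_) ⟨i, Finset.mem_univ _, ?_⟩
      · by_cases hk : k = i
        · subst hk; rw [Function.update_self, he2 _ hmem]; exact hlt.le
        · rw [Function.update_of_ne hk]
      · rw [Function.update_self, he2 _ hmem]; exact hlt
    exact absurd h1 (not_le.mpr h2)
  · refine (hmin _ hT0).trans (le_of_eq ?_)
    exact Finset.sum_congr rfl fun i _ => he2 _ (hTS i)

theorem cos_pi_div_seven_gt : 0.8 < Real.cos (Real.pi / 7) := by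
  have hpi := Real.pi_pos
  have h := Real.cos_le_cos_of_nonneg_of_le_pi (x := Real.pi / 7) (y := Real.pi / 6)
    (by positivity) (by linarith) (by linarith)
  rw [Real.cos_pi_div_six] at h
  have h3 : (√3) ^ 2 = 3 := Real.sq_sqrt (by norm_num)
  have h0 : 0 ≤ √3 := Real.sqrt_nonneg _
  nlinarith

theorem cos_pi_div_seven_cubic : 8 * Real.cos (Real.pi / 7) ^ 3 - 4 * Real.cos (Real.pi / 7) ^ 2
    - 4 * Real.cos (Real.pi / 7) + 1 = 0 := by
  have h : Real.cos (2 * (2 * (Real.pi / 7))) = -Real.cos (3 * (Real.pi / 7)) := by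
    rw [← Real.cos_pi_sub]; congr 1; ring
  rw [Real.cos_two_mul, Real.cos_two_mul, Real.cos_three_mul] at h
  have hk := cos_pi_div_seven_gt
  have : (Real.cos (Real.pi / 7) + 1) * (8 * Real.cos (Real.pi / 7) ^ 3
    - 4 * Real.cos (Real.pi / 7) ^ 2 - 4 * Real.cos (Real.pi / 7) + 1) = 0 := by
    linear_combination h
  exact (mul_eq_zero.mp this).resolve_left (by linarith)

theorem cos_pi_div_seven_bounds : 0.900968 ≤ Real.cos (Real.pi / 7) ∧
    Real.cos (Real.pi / 7) ≤ 0.90097 := by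
  have h := cos_pi_div_seven_cubic
  have hk := cos_pi_div_seven_gt
  constructor <;> nlinarith

/-- The denominator of `sinh²` of the inradius of the `(2,3,7)` triangle. -/
noncomputable def rad237 : ℝ := 15 / 4 + 3 * Real.cos (Real.pi / 7) - Real.cos (Real.pi / 7) ^ 2

/-- `sinh` of the inradius of the `(2,3,7)` triangle. -/
noncomputable def sinh237 : ℝ := √((Real.cos (Real.pi / 7) ^ 2 - 3 / 4) / rad237)

theorem rad237_pos : 0 < rad237 := by
  have := cos_pi_div_seven_bounds
  unfold rad237; nlinarith

theorem sinh237_sq : sinh237 ^ 2 * rad237 = Real.cos (Real.pi / 7) ^ 2 - 3 / 4 := by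
  have h := cos_pi_div_seven_bounds
  have hr := rad237_pos
  rw [sinh237, Real.sq_sqrt (div_nonneg (by nlinarith) hr.le), div_mul_cancel₀ _ hr.ne']

theorem sinh237_pos : 0 < sinh237 := by
  have h := cos_pi_div_seven_bounds
  exact Real.sqrt_pos.mpr (div_pos (by nlinarith) rad237_pos)

theorem sinh237_lt : sinh237 < 0.12 := by
  have h := cos_pi_div_seven_bounds
  have hr := rad237_pos
  have h1 := sinh237_sq
  have h2 := sinh237_pos
  by_contra hcon
  have h3 : 0.12 ^ 2 ≤ sinh237 ^ 2 := by gcongr; exact not_lt.mp hcon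
  have h4 : 0.12 ^ 2 * rad237 ≤ sinh237 ^ 2 * rad237 := by gcongr
  rw [h1] at h4
  unfold rad237 at h4
  nlinarith

theorem Is237.sum_bound {T : Fin 3 → Fin 3 → ℝ} (h : Is237 T)
    (hunit : ∀ i, lform (T i) (T i) = 1) {s : ℝ} (hT : ∀ i, 0 < T i 2 ∧ T i 2 ≤ s) :
    s * (3 * s - ∑ i, T i 2) ≤ (s ^ 2 - sinh237 ^ 2) * rad237 := by
  obtain ⟨σ, h12, h02, h01⟩ := h
  have hE := gramE_eq_zero (T := T ∘ σ) (fun i => hunit _)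
  simp only [Function.comp_apply] at hE
  rw [h12, h02, h01] at hE
  have hsum : ∑ i, T i 2 = T (σ 0) 2 + T (σ 1) 2 + T (σ 2) 2 := by
    rw [← Equiv.sum_comp σ (fun i => T i 2), Fin.sum_univ_three]
  rw [hsum, sub_mul, sinh237_sq]
  obtain ⟨x0, x1⟩ := hT (σ 0)
  obtain ⟨y0, y1⟩ := hT (σ 1)
  obtain ⟨z0, z1⟩ := hT (σ 2)
  have hk := cos_pi_div_seven_bounds
  set x := T (σ 0) 2
  set y := T (σ 1) 2
  set z := T (σ 2) 2
  set k := Real.cos (Real.pi / 7)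
  unfold gramE at hE
  have hs : 0 < s := x0.trans_le x1
  -- the form is at most `s` times its row sums
  have r1 : 0 ≤ x * (1 * (s - x) + k * (s - y) + 1 / 2 * (s - z)) := by
    have := sub_nonneg.mpr x1; have := sub_nonneg.mpr y1; have := sub_nonneg.mpr z1
    have : 0 ≤ k := by linarith
    positivity
  have r2 : 0 ≤ y * (k * (s - x) + 3 / 4 * (s - y) + k / 2 * (s - z)) := by
    have := sub_nonneg.mpr x1; have := sub_nonneg.mpr y1; have := sub_nonneg.mpr z1
    have : 0 ≤ k := by linarith
    positivity
  have r3 : 0 ≤ z * (1 / 2 * (s - x) + k / 2 * (s - y) + (1 - k ^ 2) * (s - z)) := by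
    have := sub_nonneg.mpr x1; have := sub_nonneg.mpr y1; have := sub_nonneg.mpr z1
    have : 0 ≤ k := by linarith
    have : 0 ≤ 1 - k ^ 2 := by nlinarith
    positivity
  have q1 : 0 ≤ s * ((s - x) * (1 / 2 + k)) :=
    mul_nonneg hs.le (mul_nonneg (by linarith) (by linarith))
  have q2 : 0 ≤ s * ((s - y) * (3 / 2 * k - 1 / 4)) :=
    mul_nonneg hs.le (mul_nonneg (by linarith) (by linarith))
  have q3 : 0 ≤ s * ((s - z) * (1 / 2 + k / 2 - k ^ 2)) :=
    mul_nonneg hs.le (mul_nonneg (by linarith) (by nlinarith))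
  unfold rad237
  change _ ≤ s ^ 2 * (15 / 4 + 3 * k - k ^ 2) - (k ^ 2 - 3 / 4)
  nlinarith

/-! ### Change of base point -/

/-- The Lorentz isometry which moves the point `x + s i` of the upper half-plane to `i`. -/
noncomputable def rebase (x s : ℝ) : (Fin 3 → ℝ) →ₗ[ℝ] (Fin 3 → ℝ) where
  toFun v := ![v 0 - (v 1 - v 2) * x,
    (v 1 + v 2 + 2 * v 0 * x - (v 1 - v 2) * x ^ 2 + (v 1 - v 2) * s ^ 2) / (2 * s),
    (v 1 + v 2 + 2 * v 0 * x - (v 1 - v 2) * x ^ 2 - (v 1 - v 2) * s ^ 2) / (2 * s)]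
  map_add' v w := by
    ext i; fin_cases i <;> simp <;> ring
  map_smul' r v := by
    ext i; fin_cases i <;> simp <;> ring

/-- `sinh` of the signed distance from `x + s i` to the mirror `v`. -/
noncomputable def height (x s : ℝ) (v : Fin 3 → ℝ) : ℝ :=
  (v 1 + v 2 + 2 * v 0 * x - (v 1 - v 2) * x ^ 2 - (v 1 - v 2) * s ^ 2) / (2 * s)

theorem rebase_two (x s : ℝ) (v : Fin 3 → ℝ) : rebase x s v 2 = height x s v := rfl

theorem lform_rebase (x : ℝ) {s : ℝ} (hs : s ≠ 0) (v w : Fin 3 → ℝ) :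
    lform (rebase x s v) (rebase x s w) = lform v w := by
  simp only [lform, rebase, LinearMap.coe_mk, AddHom.coe_mk, Matrix.cons_val_zero,
    Matrix.cons_val_one, Matrix.cons_val]
  field_simp
  ring

theorem rebase_ker (x : ℝ) {s : ℝ} (hs : s ≠ 0) : (rebase x s).ker = ⊥ := by
  rw [LinearMap.ker_eq_bot']
  intro v hv
  have h : ∀ w, lform v w = 0 := by
    intro w; rw [← lform_rebase x hs, hv]; simp [lform]
  have h0 := h ![1, 0, 0]
  have h1 := h ![0, 1, 0]
  have h2 := h ![0, 0, 1]
  simp [lform] at h0 h1 h2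
  ext i; fin_cases i <;> simpa

theorem IsGood.rebase {T : Fin 3 → Fin 3 → ℝ} (hT : IsGood T) (x : ℝ) {s : ℝ} (hs : s ≠ 0) :
    IsGood (fun i => HypThree.rebase x s (T i)) := by
  constructor
  · have hd := hT.1
    rw [Matrix.det_fin_three] at hd ⊢
    simp only [Matrix.of_apply] at hd ⊢
    convert hd using 1
    simp only [HypThree.rebase, LinearMap.coe_mk, AddHom.coe_mk, Matrix.cons_val_zero,
      Matrix.cons_val_one, Matrix.cons_val]
    field_simp
    ring
  · intro i
    obtain ⟨j, hji, h⟩ := hT.2 i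
    exact ⟨j, hji, by rwa [lform_rebase x hs]⟩

/-- A set of unit spacelike vectors, closed under reflections, with finitely many members in any
bounded region. -/
structure IsMirrorSet (S : Set (Fin 3 → ℝ)) : Prop where
  unit : ∀ v ∈ S, lform v v = 1
  refl : ∀ v ∈ S, ∀ w ∈ S, w - (2 * lform v w) • v ∈ S
  fin : ∀ r : ℝ, {v ∈ S | ‖v‖ ≤ r}.Finite

theorem IsMirrorSet.isRootSet {S : Set (Fin 3 → ℝ)} (hS : IsMirrorSet S) (x : ℝ) {s : ℝ}
    (hs : s ≠ 0) : IsRootSet (rebase x s '' S) where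
  unit := by
    rintro _ ⟨v, hv, rfl⟩
    rw [lform_rebase x hs, hS.unit v hv]
  refl := by
    rintro _ ⟨v, hv, rfl⟩ _ ⟨w, hw, rfl⟩
    refine ⟨_, hS.refl v hv w hw, ?_⟩
    rw [lform_rebase x hs, map_sub, map_smul]
  fin r := by
    obtain ⟨K, -, hK⟩ := (rebase x s).exists_antilipschitzWith (rebase_ker x hs)
    refine ((hS.fin (K * (2 + |r|))).image (rebase x s)).subset ?_
    rintro _ ⟨⟨v, hv, rfl⟩, hr⟩
    refine ⟨v, ⟨hv, ?_⟩, rfl⟩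
    have h1 := hK.le_mul_dist v 0
    rw [map_zero, dist_zero_right, dist_zero_right] at h1
    refine h1.trans ?_
    gcongr
    have hu := hS.unit v hv
    rw [← lform_rebase x hs] at hu
    set w := rebase x s v
    unfold lform at hu
    have hr' := hr.trans (le_abs_self r)
    have h2 := abs_nonneg r
    have h3 : w 2 ^ 2 ≤ |r| ^ 2 := by rw [← sq_abs (w 2)]; gcongr
    rw [pi_norm_le_iff_of_nonneg (by positivity)]
    intro i
    rw [Real.norm_eq_abs]
    fin_cases i
    · change |w 0| ≤ _
      exact abs_le_of_sq_le_sq (by nlinarith [sq_nonneg (w 1)]) (by positivity)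
    · change |w 1| ≤ _
      exact abs_le_of_sq_le_sq (by nlinarith [sq_nonneg (w 0)]) (by positivity)
    · exact hr'.trans (by simp)

theorem IsMirrorSet.countable {S : Set (Fin 3 → ℝ)} (hS : IsMirrorSet S) : S.Countable := by
  have : S ⊆ ⋃ n : ℕ, {v ∈ S | ‖v‖ ≤ n} := by
    intro v hv
    obtain ⟨n, hn⟩ := exists_nat_ge ‖v‖
    exact Set.mem_iUnion.mpr ⟨n, hv, hn⟩
  exact (Set.countable_iUnion fun n : ℕ => (hS.fin n).countable).mono this

theorem IsMirrorSet.exists_generic {S : Set (Fin 3 → ℝ)} (hS : IsMirrorSet S) {x₀ s₀ ε : ℝ}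
    (hs₀ : 0 < s₀) (hε : 0 < ε) :
    ∃ x s, 0 < s ∧ |x - x₀| < ε ∧ |s - s₀| < ε ∧ ∀ v ∈ S, height x s v ≠ 0 := by
  have h1 := (hS.countable.image fun v => -(v 1 + v 2) / (2 * v 0)).dense_compl ℝ
  obtain ⟨x, hx, hxS⟩ := h1.inter_open_nonempty (Metric.ball x₀ ε) Metric.isOpen_ball
    ⟨x₀, Metric.mem_ball_self hε⟩
  have h2 := (hS.countable.image fun v =>
    √((v 1 + v 2 + 2 * v 0 * x - (v 1 - v 2) * x ^ 2) / (v 1 - v 2))).dense_compl ℝ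
  obtain ⟨s, ⟨hs, hspos⟩, hsS⟩ := h2.inter_open_nonempty (Metric.ball s₀ ε ∩ Set.Ioi 0)
    (Metric.isOpen_ball.inter isOpen_Ioi) ⟨s₀, Metric.mem_ball_self hε, hs₀⟩
  rw [Set.mem_Ioi] at hspos
  refine ⟨x, s, hspos, by simpa [Real.dist_eq] using hx, by simpa [Real.dist_eq] using hs, ?_⟩
  intro v hv h0
  rw [height, div_eq_zero_iff] at h0
  have h0 := h0.resolve_right (by positivity)
  by_cases hc : v 1 - v 2 = 0
  · apply hxS
    refine ⟨v, hv, ?_⟩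
    have hu := hS.unit v hv
    have hv0 : v 0 ≠ 0 := by
      intro h
      unfold lform at hu
      rw [h, show v 1 = v 2 by linarith] at hu
      norm_num at hu
    rw [hc] at h0
    change -(v 1 + v 2) / (2 * v 0) = x
    field_simp
    linarith
  · apply hsS
    refine ⟨v, hv, ?_⟩
    change √((v 1 + v 2 + 2 * v 0 * x - (v 1 - v 2) * x ^ 2) / (v 1 - v 2)) = s
    have : (v 1 + v 2 + 2 * v 0 * x - (v 1 - v 2) * x ^ 2) / (v 1 - v 2) = s ^ 2 := by
      rw [div_eq_iff hc]; linarith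
    rw [this, Real.sqrt_sq hspos.le]

theorem continuousAt_height (v : Fin 3 → ℝ) {p : ℝ × ℝ} (hp : 0 < p.2) :
    ContinuousAt (fun p : ℝ × ℝ => height p.1 p.2 v) p := by
  unfold height
  refine ContinuousAt.div (by fun_prop) (by fun_prop) (by positivity)

theorem IsMirrorSet.sum_bound {S : Set (Fin 3 → ℝ)} (hS : IsMirrorSet S)
    {T : Fin 3 → Fin 3 → ℝ} (hg : IsGood T) (hTS : ∀ i, T i ∈ S) {x₀ s₀ r : ℝ} (hs₀ : 0 < s₀)
    (hr : r < 0.12) (hT : ∀ i, |height x₀ s₀ (T i)| ≤ r) :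
    r * (3 * r - ∑ i, |height x₀ s₀ (T i)|) ≤ (r ^ 2 - sinh237 ^ 2) * rad237 := by
  by_contra hcon
  rw [not_le] at hcon
  -- move to a slightly larger radius and a generic nearby point
  obtain ⟨r', hr', hr'1, hr'2⟩ : ∃ r', r < r' ∧ r' < 0.12 ∧
      (r' ^ 2 - sinh237 ^ 2) * rad237 < r' * (3 * r' - ∑ i, |height x₀ s₀ (T i)|) := by
    have hc : ContinuousAt (fun r' => r' * (3 * r' - ∑ i, |height x₀ s₀ (T i)|) -
        (r' ^ 2 - sinh237 ^ 2) * rad237) r := by fun_prop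
    have h1 := hc.eventually (lt_mem_nhds (sub_pos.mpr hcon))
    have h2 := (h1.and (gt_mem_nhds hr)).filter_mono (nhdsWithin_le_nhds (s := Set.Ioi r))
    obtain ⟨r', ⟨h3, h4⟩, h5⟩ := (h2.and self_mem_nhdsWithin).exists
    exact ⟨r', h5, h4, sub_pos.mp h3⟩
  have e1 : ∀ᶠ p : ℝ × ℝ in nhds (x₀, s₀), ∀ i, |height p.1 p.2 (T i)| < r' := by
    rw [Filter.eventually_all]
    intro i
    exact ((continuousAt_height (T i) (p := (x₀, s₀)) hs₀).abs).eventually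
      (gt_mem_nhds ((hT i).trans_lt hr'))
  have e2 : ∀ᶠ p : ℝ × ℝ in nhds (x₀, s₀), (r' ^ 2 - sinh237 ^ 2) * rad237 <
      r' * (3 * r' - ∑ i, |height p.1 p.2 (T i)|) := by
    have hc : ContinuousAt (fun p : ℝ × ℝ => r' * (3 * r' - ∑ i, |height p.1 p.2 (T i)|))
        (x₀, s₀) := by
      refine continuousAt_const.mul (continuousAt_const.sub ?_)
      exact tendsto_finsetSum _ fun i _ =>
        (continuousAt_height (T i) (p := (x₀, s₀)) hs₀).abs
    exact hc.eventually (lt_mem_nhds hr'2)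
  obtain ⟨ε, hε, hball⟩ := Metric.eventually_nhds_iff.mp (e1.and e2)
  obtain ⟨x, s, hs, hx1, hs1, hgen⟩ := hS.exists_generic (x₀ := x₀) hs₀ hε
  obtain ⟨h1, h2⟩ := hball (y := (x, s)) (by
    rw [Prod.dist_eq, max_lt_iff, Real.dist_eq, Real.dist_eq]; exact ⟨hx1, hs1⟩)
  obtain ⟨T', hT', hT'S, hT'0, hsum⟩ := exists_is237_of_generic (hS.isRootSet x hs.ne')
    (by rintro _ ⟨v, hv, rfl⟩; exact hgen v hv) (hg.rebase x hs.ne')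
    (fun i => ⟨_, hTS i, rfl⟩) hr'1.le (fun i => (h1 i).le)
  have hb := hT'.sum_bound (fun i => (hS.isRootSet x hs.ne').unit _ (hT'S i)) hT'0
  simp only [rebase_two] at hsum
  have hr0 : 0 < r' := (abs_nonneg _).trans_lt (h1 0)
  have h3 : r' * (3 * r' - ∑ i, |height x s (T i)|) ≤ r' * (3 * r' - ∑ i, T' i 2) := by gcongr
  simp only at h2
  linarith

theorem IsMirrorSet.abs_height_eq {S : Set (Fin 3 → ℝ)} (hS : IsMirrorSet S)
    {T : Fin 3 → Fin 3 → ℝ} (hg : IsGood T) (hTS : ∀ i, T i ∈ S) {x s : ℝ} (hs : 0 < s)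
    (hT : ∀ i, |height x s (T i)| ≤ sinh237) (i : Fin 3) : |height x s (T i)| = sinh237 := by
  have hb := hS.sum_bound hg hTS hs sinh237_lt hT
  rw [sub_self, zero_mul] at hb
  have h0 := sinh237_pos
  have h1 : 3 * sinh237 ≤ ∑ i, |height x s (T i)| := by
    by_contra h
    have := mul_pos h0 (sub_pos.mpr (not_le.mp h))
    linarith
  rw [Fin.sum_univ_three] at h1
  have := hT 0
  have := hT 1
  have := hT 2
  fin_cases i
  · change |height x s (T 0)| = _; linarith
  · change |height x s (T 1)| = _; linarith
  · change |height x s (T 2)| = _; linarith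

/-- Equality in the bound forces the `(2,3,7)` triangle, up to the signs of the normals. -/
theorem IsMirrorSet.exists_is237 {S : Set (Fin 3 → ℝ)} (hS : IsMirrorSet S)
    {T : Fin 3 → Fin 3 → ℝ} (hg : IsGood T) (hTS : ∀ i, T i ∈ S) {x s : ℝ} (hs : 0 < s)
    (hT : ∀ i, |height x s (T i)| ≤ sinh237) :
    ∃ e : Fin 3 → ℝ, (∀ i, e i = 1 ∨ e i = -1) ∧ Is237 (fun i => e i • T i) := by
  have hR := hS.isRootSet x hs.ne'
  have habs := hS.abs_height_eq hg hTS hs hT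
  have hpos := sinh237_pos
  have hsign : ∀ i, ∃ e : ℝ, (e = 1 ∨ e = -1) ∧ e • T i ∈ S ∧ height x s (e • T i) = sinh237 := by
    intro i
    have hneg : (-1 : ℝ) • T i ∈ S := by
      have h := hS.refl _ (hTS i) _ (hTS i)
      rw [hS.unit _ (hTS i)] at h
      convert h using 1
      ext k; simp; ring
    have hsm : ∀ e : ℝ, height x s (e • T i) = e * height x s (T i) := by
      intro e; simp only [← rebase_two, map_smul, Pi.smul_apply, smul_eq_mul]
    rcases le_or_gt 0 (height x s (T i)) with h | h
    · refine ⟨1, Or.inl rfl, by simpa using hTS i, ?_⟩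
      rw [hsm, one_mul, ← habs i, abs_of_nonneg h]
    · refine ⟨-1, Or.inr rfl, hneg, ?_⟩
      rw [hsm, ← habs i, abs_of_neg h]; ring
  choose e he heS heh using hsign
  refine ⟨e, he, ?_⟩
  have hg' : IsGood (fun i => e i • T i) :=
    hg.smul fun i => by rcases he i with h | h <;> rw [h] <;> norm_num
  set T' : Fin 3 → Fin 3 → ℝ := fun i => e i • T i with hT'
  have hgood := hg'.rebase x hs.ne'
  suffices h : Is237 (fun i => rebase x s (T' i)) by
    obtain ⟨σ, h1, h2, h3⟩ := h
    simp only [lform_rebase x hs.ne'] at h1 h2 h3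
    exact ⟨σ, h1, h2, h3⟩
  refine is237_of_not_descends hR hgood (fun i => ⟨_, heS i, rfl⟩) (fun i => ?_) (fun i => ?_) ?_
  · rw [rebase_two, heh]; exact hpos
  · rw [rebase_two, heh]; exact sinh237_lt.le
  · rintro i j hij ⟨p, q, hp, ⟨w, hw, hwe⟩, hlf, hlt⟩
    have hwe' : w = p • T' i + q • T' j := by
      apply LinearMap.ker_eq_bot.mp (rebase_ker x hs.ne')
      rw [hwe, map_add, LinearMap.map_smul (rebase x s) p, LinearMap.map_smul (rebase x s) q]
    rw [← hwe, lform_rebase x hs.ne', hwe'] at hlf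
    rw [← hwe, rebase_two, rebase_two, heh, abs_of_pos hpos, hwe'] at hlt
    have hnew := hg'.update hij hp hlf
    rw [hwe'] at hw
    have := hS.abs_height_eq hnew (fun k => by
      by_cases hk : k = i
      · subst hk; rwa [Function.update_self]
      · rw [Function.update_of_ne hk]; exact heS k) hs (fun k => by
      by_cases hk : k = i
      · subst hk; rw [Function.update_self]; exact hlt.le
      · rw [Function.update_of_ne hk, heh, abs_of_pos hpos]) i
    rw [Function.update_self] at this
    exact hlt.ne this

/-! ### The Hermitian model and hyperbolic cosines of distances -/

/-- `cosh` of the hyperbolic distance. -/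
noncomputable def coshDist (p q : H3) : ℝ :=
  1 + (‖p.z - q.z‖ ^ 2 + (p.t - q.t) ^ 2) / (2 * p.t * q.t)

theorem hdist_eq (p q : H3) : hdist p q = Real.arcosh (coshDist p q) := rfl

theorem one_le_coshDist (p q : H3) : 1 ≤ coshDist p q := by
  have h1 := p.t_pos
  have h2 := q.t_pos
  unfold coshDist
  have : 0 ≤ (‖p.z - q.z‖ ^ 2 + (p.t - q.t) ^ 2) / (2 * p.t * q.t) := by positivity
  linarith

theorem coshDist_comm (p q : H3) : coshDist p q = coshDist q p := by
  unfold coshDist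
  rw [norm_sub_rev]
  ring

theorem eq_of_coshDist_eq_one {p q : H3} (h : coshDist p q = 1) : p = q := by
  have h1 := p.t_pos
  have h2 := q.t_pos
  unfold coshDist at h
  have h3 : (‖p.z - q.z‖ ^ 2 + (p.t - q.t) ^ 2) / (2 * p.t * q.t) = 0 := by linarith
  rw [div_eq_zero_iff] at h3
  have h3 := h3.resolve_right (by positivity)
  have h4 : ‖p.z - q.z‖ ^ 2 = 0 := by nlinarith [sq_nonneg ‖p.z - q.z‖, sq_nonneg (p.t - q.t)]
  have h5 : (p.t - q.t) ^ 2 = 0 := by nlinarith [sq_nonneg ‖p.z - q.z‖, sq_nonneg (p.t - q.t)]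
  ext
  · simpa [sub_eq_zero] using h4
  · simpa [sub_eq_zero] using h5

/-- The positive Hermitian matrix of determinant one which represents a point. -/
noncomputable def herm (p : H3) : Matrix (Fin 2) (Fin 2) ℂ :=
  !![(p.z * conj p.z + p.t ^ 2) / p.t, p.z / p.t; conj p.z / p.t, 1 / p.t]

theorem det_herm_add (p q : H3) :
    (herm p + herm q).det = ((2 + 2 * coshDist p q : ℝ) : ℂ) := by
  have h1 : (p.t : ℂ) ≠ 0 := by exact_mod_cast p.t_pos.ne'
  have h2 : (q.t : ℂ) ≠ 0 := by exact_mod_cast q.t_pos.ne'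
  rw [Matrix.det_fin_two, coshDist]
  push_cast
  rw [← Complex.mul_conj']
  simp only [herm, Matrix.add_apply, Matrix.of_apply, Matrix.cons_val', Matrix.cons_val_zero,
    Matrix.cons_val_one, Matrix.cons_val_fin_one, map_sub]
  field_simp
  ring

theorem herm_smul (A : SL(2, ℂ)) (p : H3) :
    herm (A • p) = (A : Matrix (Fin 2) (Fin 2) ℂ) * herm p * (A : Matrix (Fin 2) (Fin 2) ℂ).conjTranspose := by
  have hd : (den A p : ℂ) ≠ 0 := by exact_mod_cast (den_pos A p).ne'
  have ht : (p.t : ℂ) ≠ 0 := by exact_mod_cast p.t_pos.ne'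
  have hdet : A 0 0 * A 1 1 - A 0 1 * A 1 0 = 1 := by
    have := A.det_coe; rwa [Matrix.det_fin_two] at this
  have hdet' := congrArg conj hdet
  simp only [map_sub, map_mul, map_one] at hdet'
  have hden := den_coe A p
  have hnum : num A p = (A 0 0 * p.z + A 0 1) * conj (A 1 0 * p.z + A 1 1)
    + A 0 0 * conj (A 1 0) * (p.t : ℂ) ^ 2 := rfl
  have hprod : (A 0 0 * A 1 1 - A 0 1 * A 1 0) *
      (conj (A 0 0) * conj (A 1 1) - conj (A 0 1) * conj (A 1 0)) = 1 := by
    rw [hdet, hdet', one_mul]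
  have hcn : conj (num A p) = conj (A 0 0 * p.z + A 0 1) * (A 1 0 * p.z + A 1 1)
    + conj (A 0 0) * (A 1 0) * (p.t : ℂ) ^ 2 := by
    rw [hnum]; simp
  have h00 : num A p * conj (num A p) + (p.t : ℂ) ^ 2 = den A p *
      ((A 0 0 * p.z + A 0 1) * conj (A 0 0 * p.z + A 0 1)
        + A 0 0 * conj (A 0 0) * (p.t : ℂ) ^ 2) := by
    rw [hcn, hnum, hden]
    simp only [map_add, map_mul]
    linear_combination (-(p.t : ℂ) ^ 2) * hprod
  ext i j
  fin_cases i <;> fin_cases j <;>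
    simp only [herm, smul_z, smul_t, Matrix.mul_apply, Fin.sum_univ_two, Matrix.of_apply,
      Matrix.cons_val', Matrix.cons_val_zero, Matrix.cons_val_one, Matrix.cons_val_fin_one,
      Matrix.conjTranspose_apply, map_div₀, conj_den, Complex.ofReal_div, Fin.zero_eta,
      Fin.mk_one, Fin.isValue, RCLike.star_def]
  · field_simp
    rw [h00]
    simp only [map_add, map_mul]
    ring
  · field_simp
    rw [hnum]
    simp only [map_add, map_mul]
    ring
  · field_simp
    rw [hcn]
    simp only [map_add, map_mul]
    ring
  · field_simp
    rw [hden]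
    simp only [map_add, map_mul]
    ring

theorem coshDist_smul (A : SL(2, ℂ)) (p q : H3) : coshDist (A • p) (A • q) = coshDist p q := by
  have h := det_herm_add (A • p) (A • q)
  rw [herm_smul, herm_smul, ← Matrix.add_mul, ← Matrix.mul_add, Matrix.det_mul, Matrix.det_mul,
    Matrix.det_conjTranspose, A.det_coe, star_one, one_mul, mul_one, det_herm_add] at h
  have : (2 + 2 * coshDist p q) = (2 + 2 * coshDist (A • p) (A • q)) := by exact_mod_cast h
  linarith

theorem mk_smul (A : SL(2, ℂ)) (p : H3) : (QuotientGroup.mk A : PSL(2, ℂ)) • p = A • p := rfl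

theorem coshDist_smul' (g : PSL(2, ℂ)) (p q : H3) :
    coshDist (g • p) (g • q) = coshDist p q := by
  obtain ⟨A, rfl⟩ := QuotientGroup.mk_surjective g
  exact coshDist_smul A p q

theorem hdist_smul (g : PSL(2, ℂ)) (p q : H3) : hdist (g • p) (g • q) = hdist p q := by
  rw [hdist_eq, hdist_eq, coshDist_smul']

theorem inner_direction (p q r : H3) : inner ℝ (direction p q) (direction p r) =
    4 * p.t ^ 2 * q.t * r.t * (coshDist p q * coshDist p r - coshDist q r) := by
  have h1 := p.t_pos.ne'
  have h2 := q.t_pos.ne'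
  have h3 := r.t_pos.ne'
  simp only [direction, coshDist, PiLp.inner_apply, Fin.sum_univ_three, ← Complex.normSq_eq_norm_sq,
    Complex.normSq_apply, Complex.sub_re, Complex.sub_im]
  simp
  field_simp
  ring

theorem norm_direction (p q : H3) :
    ‖direction p q‖ = 2 * p.t * q.t * √(coshDist p q ^ 2 - 1) := by
  have h1 := p.t_pos
  have h2 := q.t_pos
  have h := inner_direction p q q
  have hqq : coshDist q q = 1 := by simp [coshDist]
  rw [real_inner_self_eq_norm_sq, hqq] at h
  have h3 : ‖direction p q‖ ^ 2 = (2 * p.t * q.t) ^ 2 * (coshDist p q ^ 2 - 1) := by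
    rw [h]; ring
  rw [← Real.sqrt_sq (norm_nonneg _), h3, Real.sqrt_mul (by positivity),
    Real.sqrt_sq (by positivity)]

/-- The hyperbolic law of cosines. -/
theorem hangle_eq (q p r : H3) : hangle q p r = Real.arccos
    ((coshDist p q * coshDist p r - coshDist q r) /
      (√(coshDist p q ^ 2 - 1) * √(coshDist p r ^ 2 - 1))) := by
  have h1 := p.t_pos
  have h2 := q.t_pos
  have h3 := r.t_pos
  rw [hangle, InnerProductGeometry.angle, inner_direction, norm_direction, norm_direction]
  congr 1
  rw [show 2 * p.t * q.t * √(coshDist p q ^ 2 - 1) * (2 * p.t * r.t * √(coshDist p r ^ 2 - 1)) =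
    (4 * p.t ^ 2 * q.t * r.t) * (√(coshDist p q ^ 2 - 1) * √(coshDist p r ^ 2 - 1)) by ring]
  rw [mul_div_mul_left]
  positivity

theorem hangle_smul (g : PSL(2, ℂ)) (q p r : H3) :
    hangle (g • q) (g • p) (g • r) = hangle q p r := by
  simp only [hangle_eq, coshDist_smul']

/-! ### Half-turns about lines in the plane of real points -/

/-- The real traceless matrix attached to a vector. -/
def realMat (v : Fin 3 → ℝ) : Matrix (Fin 2) (Fin 2) ℂ :=
  !![(v 0 : ℂ), ((v 1 + v 2 : ℝ) : ℂ); ((v 1 - v 2 : ℝ) : ℂ), -(v 0 : ℂ)]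

/-- `A` is the matrix `i M(v)`, of the half-turn about the line orthogonal to `v`. -/
def IsHalfTurn (A : SL(2, ℂ)) (v : Fin 3 → ℝ) : Prop :=
  (A : Matrix (Fin 2) (Fin 2) ℂ) = Complex.I • realMat v

theorem IsHalfTurn.unit {A : SL(2, ℂ)} {v : Fin 3 → ℝ} (h : IsHalfTurn A v) :
    lform v v = 1 := by
  have hd := A.det_coe
  rw [h, Matrix.det_smul, Matrix.det_fin_two] at hd
  simp [realMat] at hd
  have : ((lform v v : ℝ) : ℂ) = 1 := by
    unfold lform; push_cast; rw [← hd]; ring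
  exact_mod_cast this

theorem exists_isHalfTurn {v : Fin 3 → ℝ} (hv : lform v v = 1) : ∃ A, IsHalfTurn A v := by
  refine ⟨⟨Complex.I • realMat v, ?_⟩, rfl⟩
  rw [Matrix.det_smul, Matrix.det_fin_two]
  simp [realMat]
  have : ((lform v v : ℝ) : ℂ) = 1 := by rw [hv]; simp
  rw [← this]; unfold lform; push_cast; ring

theorem IsHalfTurn.entries {A : SL(2, ℂ)} {v : Fin 3 → ℝ} (h : IsHalfTurn A v) :
    A 0 0 = Complex.I * (v 0 : ℝ) ∧ A 0 1 = Complex.I * (v 1 + v 2 : ℝ) ∧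
    A 1 0 = Complex.I * (v 1 - v 2 : ℝ) ∧ A 1 1 = -(Complex.I * (v 0 : ℝ)) := by
  have e : ∀ i j, A i j = (Complex.I • realMat v) i j := fun i j => by rw [← h]
  refine ⟨?_, ?_, ?_, ?_⟩ <;> rw [e] <;> simp [realMat]

theorem coshDist_eq_herm (p q : H3) : coshDist p q =
    ((herm p 0 0).re * (1 / q.t) + (1 / p.t) * ((q.z.re ^ 2 + q.z.im ^ 2 + q.t ^ 2) / q.t)
      - 2 * ((herm p 0 1).re * q.z.re + (herm p 0 1).im * q.z.im) / q.t) / 2 := by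
  have h1 := p.t_pos.ne'
  have h2 := q.t_pos.ne'
  have e1 : herm p 0 0 = (((p.z.re ^ 2 + p.z.im ^ 2 + p.t ^ 2) / p.t : ℝ) : ℂ) := by
    simp [herm, Complex.mul_conj, Complex.normSq_apply, sq]
  have e2 : herm p 0 1 = p.z / p.t := rfl
  rw [e1, e2, Complex.ofReal_re, Complex.div_ofReal_re, Complex.div_ofReal_im, coshDist,
    ← Complex.normSq_eq_norm_sq, Complex.normSq_apply, Complex.sub_re, Complex.sub_im]
  field_simp
  ring

theorem IsHalfTurn.coshDist_smul_self {A : SL(2, ℂ)} {v : Fin 3 → ℝ} (h : IsHalfTurn A v)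
    (p : H3) : coshDist (A • p) p =
    ((v 0 * p.z.re + (v 1 + v 2)) ^ 2 + v 0 ^ 2 * (p.z.im ^ 2 + p.t ^ 2)
      + (((v 1 - v 2) * p.z.re - v 0) ^ 2 + (v 1 - v 2) ^ 2 * (p.z.im ^ 2 + p.t ^ 2)) *
        (p.z.re ^ 2 + p.z.im ^ 2 + p.t ^ 2)
      - 2 * (p.z.re * ((v 0 * p.z.re + (v 1 + v 2)) * ((v 1 - v 2) * p.z.re - v 0)
        + v 0 * (v 1 - v 2) * (p.z.im ^ 2 + p.t ^ 2)) - p.z.im ^ 2)) / (2 * p.t ^ 2) := by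
  have ht := p.t_pos.ne'
  have htc : (p.t : ℂ) ≠ 0 := by exact_mod_cast ht
  obtain ⟨e00, e01, e10, e11⟩ := h.entries
  have hu : v 0 * v 0 + v 1 * v 1 - v 2 * v 2 = 1 := h.unit
  have hden : den A p = ((v 1 - v 2) * p.z.re - v 0) ^ 2
      + (v 1 - v 2) ^ 2 * (p.z.im ^ 2 + p.t ^ 2) := by
    rw [den, e10, e11, ← Complex.normSq_eq_norm_sq, ← Complex.normSq_eq_norm_sq,
      Complex.normSq_apply, Complex.normSq_apply]
    simp
    ring
  have h1t : 1 / (A • p).t = den A p / p.t := by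
    rw [smul_t, one_div_div]
  have hh := herm_smul A p
  have h00 : (herm (A • p) 0 0).re = ((v 0 * p.z.re + (v 1 + v 2)) ^ 2
      + v 0 ^ 2 * (p.z.im ^ 2 + p.t ^ 2)) / p.t := by
    have : herm (A • p) 0 0 = (((v 0 * p.z.re + (v 1 + v 2)) ^ 2
      + v 0 ^ 2 * (p.z.im ^ 2 + p.t ^ 2)) / p.t : ℝ) := by
      rw [hh]
      simp only [herm, Matrix.mul_apply, Fin.sum_univ_two, Matrix.of_apply,
        Matrix.cons_val', Matrix.cons_val_zero, Matrix.cons_val_one, Matrix.cons_val_fin_one,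
        Matrix.conjTranspose_apply, e00, e01, RCLike.star_def, map_mul, Complex.conj_I,
        Complex.conj_ofReal]
      push_cast
      have hz : p.z = p.z.re + p.z.im * Complex.I := (Complex.re_add_im _).symm
      have hz' : conj p.z = p.z.re - p.z.im * Complex.I := by
        apply Complex.ext <;> simp
      rw [hz', hz]
      simp only [Complex.add_re, Complex.ofReal_re, Complex.mul_re, Complex.I_re, mul_zero,
        Complex.ofReal_im, Complex.I_im, mul_one, sub_self, add_zero, Complex.add_im,
        Complex.mul_im, zero_add]
      field_simp
      ring_nf
      simp only [Complex.I_sq, show Complex.I ^ 4 = 1 by rw [show 4 = 2 * 2 by rfl, pow_mul]; simp]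
      ring
    rw [this, Complex.ofReal_re]
  have h01 : herm (A • p) 0 1 = num A p / p.t := by
    have hd : (den A p : ℂ) ≠ 0 := by exact_mod_cast (den_pos A p).ne'
    change (A • p).z / ((A • p).t : ℂ) = _
    rw [smul_z, smul_t]; push_cast
    field_simp
  have hnre : (num A p).re = (v 0 * p.z.re + (v 1 + v 2)) * ((v 1 - v 2) * p.z.re - v 0)
      + v 0 * (v 1 - v 2) * (p.z.im ^ 2 + p.t ^ 2) := by
    rw [num, e00, e01, e10, e11]
    simp [← Complex.ofReal_pow]
    ring
  have hnim : (num A p).im = -p.z.im := by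
    rw [num, e00, e01, e10, e11]
    simp [← Complex.ofReal_pow]
    linear_combination (-p.z.im) * hu
  rw [coshDist_eq_herm, h00, h1t, hden, h01, Complex.div_ofReal_re, Complex.div_ofReal_im,
    hnre, hnim]
  field_simp
  ring

theorem IsHalfTurn.coshDist_smul_self' {A : SL(2, ℂ)} {v : Fin 3 → ℝ} (h : IsHalfTurn A v)
    (p : H3) {a b c : ℝ} (ha : a = v 0 - (v 1 - v 2) * p.z.re)
    (hb : b = v 1 + v 2 + 2 * v 0 * p.z.re - (v 1 - v 2) * p.z.re ^ 2) (hc : c = v 1 - v 2) :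
    coshDist (A • p) p = (2 * p.t ^ 2 * a ^ 2 + 2 * p.t ^ 2 * c ^ 2 * p.z.im ^ 2
      + (b + c * p.z.im ^ 2) ^ 2 + 4 * p.z.im ^ 2 * a ^ 2 + c ^ 2 * p.t ^ 4) / (2 * p.t ^ 2) := by
  have hu : v 0 * v 0 + v 1 * v 1 - v 2 * v 2 = 1 := h.unit
  rw [h.coshDist_smul_self]
  congr 1
  subst ha hb hc
  linear_combination (-2 * p.z.im ^ 2) * hu

theorem IsHalfTurn.le_coshDist {A : SL(2, ℂ)} {v : Fin 3 → ℝ} (h : IsHalfTurn A v)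
    (p : H3) : 1 + 2 * height p.z.re (√(p.z.im ^ 2 + p.t ^ 2)) v ^ 2 ≤ coshDist (A • p) p := by
  have hu : v 0 * v 0 + v 1 * v 1 - v 2 * v 2 = 1 := h.unit
  have ht := p.t_pos
  rw [h.coshDist_smul_self' p rfl rfl rfl]
  unfold height
  have hs0 : 0 < p.z.im ^ 2 + p.t ^ 2 := by positivity
  set s := √(p.z.im ^ 2 + p.t ^ 2)
  have hs : s ^ 2 = p.z.im ^ 2 + p.t ^ 2 := Real.sq_sqrt hs0.le
  have hs1 : 0 < s := Real.sqrt_pos.mpr hs0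
  obtain ⟨a, ha⟩ : ∃ a, a = v 0 - (v 1 - v 2) * p.z.re := ⟨_, rfl⟩
  obtain ⟨b, hb⟩ : ∃ b, b = v 1 + v 2 + 2 * v 0 * p.z.re - (v 1 - v 2) * p.z.re ^ 2 := ⟨_, rfl⟩
  obtain ⟨c, hc⟩ : ∃ c, c = v 1 - v 2 := ⟨_, rfl⟩
  have hdet : a ^ 2 + b * c = 1 := by
    rw [ha, hb, hc]; linear_combination hu
  rw [← ha, ← hb, ← hc]
  clear_value s
  set y := p.z.im
  set t := p.t
  have e : (2 * t ^ 2 * a ^ 2 + 2 * t ^ 2 * c ^ 2 * y ^ 2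
      + (b + c * y ^ 2) ^ 2 + 4 * y ^ 2 * a ^ 2 + c ^ 2 * t ^ 4) / (2 * t ^ 2) -
      (1 + 2 * ((b - c * s ^ 2) / (2 * s)) ^ 2) =
      y ^ 2 * (4 * a ^ 2 * s ^ 2 + c ^ 2 * t ^ 2 * s ^ 2 + (b + c * y ^ 2) ^ 2
        + 2 * t ^ 2 - 2 * a ^ 2 * t ^ 2 + t ^ 2 * c ^ 2 * y ^ 2) / (2 * t ^ 2 * s ^ 2) := by
    rw [div_pow, mul_pow 2 s, hs]
    have : y ^ 2 + t ^ 2 ≠ 0 := hs0.ne'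
    field_simp
    linear_combination (2 * t ^ 4 + 4 * t ^ 2 * y ^ 2) * hdet
  have : 0 ≤ y ^ 2 * (4 * a ^ 2 * s ^ 2 + c ^ 2 * t ^ 2 * s ^ 2 + (b + c * y ^ 2) ^ 2
        + 2 * t ^ 2 - 2 * a ^ 2 * t ^ 2 + t ^ 2 * c ^ 2 * y ^ 2) / (2 * t ^ 2 * s ^ 2) := by
    have h1 : 4 * a ^ 2 * s ^ 2 - 2 * a ^ 2 * t ^ 2 = 4 * a ^ 2 * y ^ 2 + 2 * a ^ 2 * t ^ 2 := by
      rw [hs]; ring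
    have h2 : 0 ≤ 4 * a ^ 2 * s ^ 2 + c ^ 2 * t ^ 2 * s ^ 2 + (b + c * y ^ 2) ^ 2
        + 2 * t ^ 2 - 2 * a ^ 2 * t ^ 2 + t ^ 2 * c ^ 2 * y ^ 2 := by
      have : 0 ≤ 4 * a ^ 2 * y ^ 2 + 2 * a ^ 2 * t ^ 2 + c ^ 2 * t ^ 2 * s ^ 2
        + (b + c * y ^ 2) ^ 2 + 2 * t ^ 2 + t ^ 2 * c ^ 2 * y ^ 2 := by positivity
      linarith
    positivity
  linarith

theorem IsHalfTurn.coshDist_eq {A : SL(2, ℂ)} {v : Fin 3 → ℝ} (h : IsHalfTurn A v)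
    {p : H3} (hp : p.z.im = 0) : coshDist (A • p) p = 1 + 2 * height p.z.re p.t v ^ 2 := by
  have hu : v 0 * v 0 + v 1 * v 1 - v 2 * v 2 = 1 := h.unit
  have ht := p.t_pos.ne'
  rw [h.coshDist_smul_self' p rfl rfl rfl, hp]
  unfold height
  field_simp
  linear_combination (2 * p.t ^ 2) * hu

/-! ### Elements of order two and their axes -/

theorem mk_eq_mk_iff {A B : SL(2, ℂ)} :
    (QuotientGroup.mk A : PSL(2, ℂ)) = QuotientGroup.mk B ↔ A = B ∨ A = -B := by
  rw [QuotientGroup.eq, Matrix.SpecialLinearGroup.mem_center_iff]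
  constructor
  · rintro ⟨r, hr, h⟩
    have hr2 : r ^ 2 = 1 := by simpa using hr
    have hB : B = A * (A⁻¹ * B) := by group
    have hB' : (B : Matrix (Fin 2) (Fin 2) ℂ) = r • (A : Matrix (Fin 2) (Fin 2) ℂ) := by
      conv_lhs => rw [hB, Matrix.SpecialLinearGroup.coe_mul, ← h]
      ext i j; simp [mul_comm]
    rcases mul_self_eq_one_iff.mp ((sq r).symm.trans hr2) with rfl | rfl
    · left; ext i j; rw [hB']; simp
    · right; ext i j; simp [hB']
  · rintro (rfl | rfl)
    · exact ⟨1, by simp, by simp⟩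
    · refine ⟨-1, by simp, ?_⟩
      have : (-B)⁻¹ * B = -1 := by
        rw [inv_mul_eq_iff_eq_mul]; simp
      rw [this]; ext i j; fin_cases i <;> fin_cases j <;> simp [Matrix.scalar_apply]

theorem mul_self_of_traceless {A : SL(2, ℂ)} (h : A 1 1 = -A 0 0) : A * A = -1 := by
  have hdet := A.det_coe
  rw [Matrix.det_fin_two, h] at hdet
  ext i j
  fin_cases i <;> fin_cases j <;> simp [Matrix.mul_apply, Fin.sum_univ_two, h]
  · linear_combination -hdet
  · ring
  · ring
  · linear_combination -hdet

theorem orderOf_mk_eq_two_iff {A : SL(2, ℂ)} :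
    orderOf (QuotientGroup.mk A : PSL(2, ℂ)) = 2 ↔ A 1 1 = -A 0 0 := by
  have e1 : (QuotientGroup.mk A : PSL(2, ℂ)) ^ 2 = QuotientGroup.mk (A * A) := by rw [sq]; rfl
  have e2 : (1 : PSL(2, ℂ)) = QuotientGroup.mk 1 := rfl
  rw [orderOf_eq_prime_iff, ne_eq, e1, e2, mk_eq_mk_iff, mk_eq_mk_iff]
  have hdet := A.det_coe
  rw [Matrix.det_fin_two] at hdet
  constructor
  · rintro ⟨h | h, hne⟩
    · have e00 := congrFun (congrFun (congrArg Subtype.val h) 0) 0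
      have e01 := congrFun (congrFun (congrArg Subtype.val h) 0) 1
      have e10 := congrFun (congrFun (congrArg Subtype.val h) 1) 0
      have e11 := congrFun (congrFun (congrArg Subtype.val h) 1) 1
      simp [Matrix.mul_apply, Fin.sum_univ_two] at e00 e01 e10 e11
      by_contra hcon
      have ht : A 0 0 + A 1 1 ≠ 0 := fun h0 => hcon (by linear_combination h0)
      apply hne
      have h01 : A 0 1 = 0 := by
        have : A 0 1 * (A 0 0 + A 1 1) = 0 := by linear_combination e01
        exact (mul_eq_zero.mp this).resolve_right ht
      have h10 : A 1 0 = 0 := by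
        have : A 1 0 * (A 0 0 + A 1 1) = 0 := by linear_combination e10
        exact (mul_eq_zero.mp this).resolve_right ht
      rw [h01, zero_mul, sub_zero] at hdet
      rw [h01, zero_mul, add_zero] at e00
      have h11 : A 1 1 = A 0 0 := by
        linear_combination A 0 0 * hdet - A 1 1 * e00
      rcases mul_self_eq_one_iff.mp e00 with h | h
      · left; ext i j; fin_cases i <;> fin_cases j <;> simp [h, h01, h10, h11]
      · right; ext i j; fin_cases i <;> fin_cases j <;> simp [h, h01, h10, h11]
    · have e00 := congrFun (congrFun (congrArg Subtype.val h) 0) 0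
      have e11 := congrFun (congrFun (congrArg Subtype.val h) 1) 1
      simp [Matrix.mul_apply, Fin.sum_univ_two] at e00 e11
      have : (A 0 0 + A 1 1) * (A 0 0 + A 1 1) = 0 := by
        linear_combination e00 + e11 + 2 * hdet
      have := mul_self_eq_zero.mp this
      linear_combination this
  · intro h
    refine ⟨Or.inr (mul_self_of_traceless h), ?_⟩
    rintro (h1 | h1)
    · rw [h1] at h; norm_num at h
    · rw [h1] at h; norm_num at h

theorem mem_axis_iff {g : PSL(2, ℂ)} {p : H3} : p ∈ axis g ↔ g • p = p := Iff.rfl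

theorem mem_axis_of_traceless {A : SL(2, ℂ)} (h : A 1 1 = -A 0 0) (hc : A 1 0 ≠ 0) {κ : ℝ}
    (hκ : κ ^ 2 < 1) {p : H3} (hz : p.z = (A 0 0 + Complex.I * κ) / A 1 0)
    (ht : p.t = √(1 - κ ^ 2) / ‖A 1 0‖) : A • p = p := by
  have hdet := A.det_coe
  rw [Matrix.det_fin_two, h] at hdet
  have hc' : conj (A 1 0) ≠ 0 := by simpa using hc
  have hn : 0 < ‖A 1 0‖ := norm_pos_iff.mpr hc
  have ht2 : p.t ^ 2 = (1 - κ ^ 2) / ‖A 1 0‖ ^ 2 := by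
    rw [ht, div_pow, Real.sq_sqrt (by linarith)]
  have ht2c : (p.t : ℂ) ^ 2 = (1 - κ ^ 2) / (A 1 0 * conj (A 1 0)) := by
    rw [Complex.mul_conj']; exact_mod_cast ht2
  have hcz : A 1 0 * p.z + A 1 1 = Complex.I * κ := by
    rw [hz, h]; field_simp; ring
  have hden : (den A p : ℂ) = 1 := by
    rw [den_coe, hcz, ht2c]
    simp only [map_mul, Complex.conj_I, Complex.conj_ofReal]
    field_simp
    ring_nf
    rw [Complex.I_sq]; ring
  have hden' : den A p = 1 := by exact_mod_cast hden
  ext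
  · rw [smul_z, hden, div_one]
    unfold num
    rw [hcz, ht2c, hz]
    simp only [map_mul, Complex.conj_I, Complex.conj_ofReal]
    field_simp
    have hI := Complex.I_sq
    linear_combination (Complex.I * κ) * hdet + (-A 0 0 * κ ^ 2) * hI
  · rw [smul_t, hden', div_one]

theorem exists_isHalfTurn_of_axis {A : SL(2, ℂ)} (h : A 1 1 = -A 0 0)
    (hA : ∀ p : H3, A • p = p → p.z.im = 0) : ∃ v, IsHalfTurn A v := by
  have hdet := A.det_coe
  rw [Matrix.det_fin_two, h] at hdet
  suffices hre : (A 0 0).re = 0 ∧ (A 0 1).re = 0 ∧ (A 1 0).re = 0 by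
    obtain ⟨h0, h1, h2⟩ := hre
    refine ⟨![(A 0 0).im, ((A 0 1).im + (A 1 0).im) / 2, ((A 0 1).im - (A 1 0).im) / 2], ?_⟩
    unfold IsHalfTurn
    ext i j
    fin_cases i <;> fin_cases j <;> apply Complex.ext <;> simp [realMat, h0, h1, h2, h] <;> ring
  by_cases hc : A 1 0 = 0
  · rw [hc, mul_zero, sub_zero] at hdet
    have hA0 : A 0 0 ≠ 0 := by intro h0; rw [h0] at hdet; simp at hdet
    have hre : (A 0 0).re = 0 ∧ (A 0 0).im ≠ 0 := by
      have h1 := congrArg Complex.re hdet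
      have h2 := congrArg Complex.im hdet
      simp at h1 h2
      have h3 : (A 0 0).re * (A 0 0).im = 0 := by linarith
      rcases mul_eq_zero.mp h3 with h4 | h4
      · exact ⟨h4, fun h5 => hA0 (Complex.ext h4 h5)⟩
      · rw [h4] at h1; nlinarith [sq_nonneg (A 0 0).re]
    have hfix := hA ⟨-A 0 1 / (2 * A 0 0), 1, one_pos⟩ (by
      have hden : den A ⟨-A 0 1 / (2 * A 0 0), 1, one_pos⟩ = 1 := by
        have : ‖A 0 0‖ ^ 2 = 1 := by
          rw [← norm_pow]
          have : A 0 0 ^ 2 = -1 := by linear_combination -hdet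
          rw [this]; simp
        simp [den, hc, h, this]
      ext
      · rw [smul_z, hden]
        simp only [num, hc, h, map_zero, zero_mul, mul_zero, zero_add, add_zero, map_neg,
          Complex.ofReal_one, div_one]
        have : conj (A 0 0) = -A 0 0 := by
          apply Complex.ext <;> simp [hre.1]
        rw [this]
        field_simp
        linear_combination (-A 0 1) * hdet
      · rw [smul_t, hden, div_one])
    refine ⟨hre.1, ?_, by simp [hc]⟩
    have e : A 0 0 = Complex.I * (A 0 0).im := by
      apply Complex.ext <;> simp [hre.1]
    simp only at hfix
    rw [e, Complex.div_im] at hfix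
    simp [hre.2] at hfix
    exact hfix
  · have hn : 0 < ‖A 1 0‖ := norm_pos_iff.mpr hc
    have h1 := hA ⟨(A 0 0 + Complex.I * (0 : ℝ)) / A 1 0, √(1 - 0 ^ 2) / ‖A 1 0‖, by
      simpa using hn⟩ (mem_axis_of_traceless h hc (κ := 0) (by norm_num) rfl rfl)
    have h2 := hA ⟨(A 0 0 + Complex.I * (1 / 2 : ℝ)) / A 1 0, √(1 - (1 / 2) ^ 2) / ‖A 1 0‖, by
      have : 0 < √(1 - (1 / 2) ^ 2 : ℝ) := Real.sqrt_pos.mpr (by norm_num)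
      positivity⟩ (mem_axis_of_traceless h hc (κ := 1 / 2) (by norm_num) rfl rfl)
    simp only [Complex.ofReal_zero, mul_zero, add_zero] at h1
    simp only [add_div, Complex.add_im, h1, zero_add] at h2
    obtain ⟨r, hr⟩ : ∃ r : ℝ, A 0 0 = r * A 1 0 := by
      refine ⟨(A 0 0 / A 1 0).re, ?_⟩
      have : A 0 0 / A 1 0 = ((A 0 0 / A 1 0).re : ℂ) := by
        apply Complex.ext <;> simp [h1]
      rw [← this, div_mul_cancel₀ _ hc]
    obtain ⟨q, hq⟩ : ∃ q : ℝ, A 1 0 * q = Complex.I := by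
      refine ⟨2 * (Complex.I * (1 / 2 : ℝ) / A 1 0).re, ?_⟩
      have : Complex.I * (1 / 2 : ℝ) / A 1 0 = ((Complex.I * (1 / 2 : ℝ) / A 1 0).re : ℂ) := by
        apply Complex.ext
        · rfl
        · rw [h2]; simp
      rw [Complex.ofReal_mul, ← this]
      push_cast
      field_simp
    have hq0 : q ≠ 0 := by rintro rfl; simp at hq; exact Complex.I_ne_zero hq.symm
    have hc1 : A 1 0 = Complex.I * (q⁻¹ : ℝ) := by
      rw [← hq]; push_cast
      rw [mul_assoc, mul_inv_cancel₀ (by exact_mod_cast hq0), mul_one]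
    have ha1 : A 0 0 = Complex.I * (r * q⁻¹ : ℝ) := by
      rw [hr, hc1]; push_cast; ring
    have hb1 : A 0 1 = Complex.I * ((1 - (r * q⁻¹) ^ 2) * q : ℝ) := by
      have h3 : A 0 1 * A 1 0 = -(1 + A 0 0 ^ 2) := by linear_combination -hdet
      have h4 : A 0 1 = -(1 + A 0 0 ^ 2) / A 1 0 := by rw [← h3, mul_div_cancel_right₀ _ hc]
      have hq0' : (q : ℂ) ≠ 0 := by exact_mod_cast hq0
      rw [h4, ha1, hc1]
      push_cast
      rw [div_eq_iff (by simp [hq0'])]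
      have hI := Complex.I_sq
      field_simp
      linear_combination (-(r : ℂ) ^ 2 - (q : ℂ) ^ 2 + r ^ 2) * hI
    refine ⟨?_, ?_, ?_⟩
    · rw [ha1]; simp
    · rw [hb1]; exact Complex.I_mul_re _ |>.trans (by rw [Complex.ofReal_im, neg_zero])
    · rw [hc1]; simp

/-! ### Conjugation invariance -/

theorem closure_conj (h : PSL(2, ℂ)) (f : Fin 3 → PSL(2, ℂ)) :
    Subgroup.closure (Set.range fun i => h * f i * h⁻¹) =
      (Subgroup.closure (Set.range f)).map (MulAut.conj h).toMonoidHom := by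
  rw [MonoidHom.map_closure, ← Set.range_comp]
  rfl

theorem isVirtuallyAbelian_congr {G H : Type*} [Group G] [Group H] (e : G ≃* H)
    (hG : IsVirtuallyAbelian G) : IsVirtuallyAbelian H := by
  obtain ⟨A, hA, hcomm⟩ := hG
  refine ⟨A.map e.toMonoidHom, ?_, ?_⟩
  · constructor
    rw [Subgroup.index_map_of_bijective (f := e.toMonoidHom) e.bijective]
    exact hA.index_ne_zero
  · infer_instance

theorem IsKleinian.conj {Γ : Subgroup PSL(2, ℂ)} (hΓ : IsKleinian Γ) (h : PSL(2, ℂ)) :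
    IsKleinian (Γ.map (MulAut.conj h).toMonoidHom) := by
  set e : Γ ≃* Γ.map (MulAut.conj h).toMonoidHom :=
    Γ.equivMapOfInjective _ (MulAut.conj h).injective
  refine ⟨?_, fun hv => hΓ.2 (isVirtuallyAbelian_congr e.symm hv)⟩
  have := hΓ.1
  have hcont : Continuous e.symm := by
    refine Topology.IsInducing.subtypeVal.continuous_iff.mpr ?_
    refine (show Continuous fun x : Γ.map (MulAut.conj h).toMonoidHom =>
      h⁻¹ * x.1 * h by fun_prop).congr fun x => ?_
    obtain ⟨y, rfl⟩ := e.surjective x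
    have h1 : ((e y : PSL(2, ℂ))) = h * y * h⁻¹ := rfl
    change h⁻¹ * (e y : PSL(2, ℂ)) * h = (e.symm (e y) : PSL(2, ℂ))
    rw [h1, MulEquiv.symm_apply_apply]
    group
  exact DiscreteTopology.of_continuous_injective hcont e.symm.injective

theorem margulisConstant_conj (h : PSL(2, ℂ)) (f : Fin 3 → PSL(2, ℂ)) :
    margulisConstant (fun i => h * f i * h⁻¹) = margulisConstant f := by
  unfold margulisConstant
  refine (Equiv.iInf_congr (MulAction.toPerm h) fun x => ?_).symm
  refine iSup_congr fun i => ?_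
  rw [MulAction.toPerm_apply, mul_smul, mul_smul, inv_smul_smul, hdist_smul]

theorem margulisConstant_perm (σ : Equiv.Perm (Fin 3)) (f : Fin 3 → PSL(2, ℂ)) :
    margulisConstant (f ∘ σ) = margulisConstant f := by
  unfold margulisConstant
  exact iInf_congr fun x => σ.iSup_comp (g := fun i => hdist (f i • x) x)

theorem axis_conj (h g : PSL(2, ℂ)) {p : H3} (hp : p ∈ axis g) : h • p ∈ axis (h * g * h⁻¹) := by
  rw [mem_axis_iff] at *
  rw [mul_smul, mul_smul, inv_smul_smul, hp]

theorem AxesBound237Triangle.conj {f : Fin 3 → PSL(2, ℂ)} (hf : AxesBound237Triangle f)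
    (h : PSL(2, ℂ)) : AxesBound237Triangle (fun i => h * f i * h⁻¹) := by
  obtain ⟨V, σ, hV, hax, h0, h1, h2⟩ := hf
  refine ⟨fun i => h • V i, σ, fun i j hij => hV (MulAction.injective h hij),
    fun i j hij => axis_conj h _ (hax i j hij), ?_, ?_, ?_⟩ <;> rwa [hangle_smul]

/-! ### Moving a plane to the plane of real points -/

theorem exists_SL {a b c d : ℂ} (h : a * d - b * c = 1) :
    ∃ A : SL(2, ℂ), A 0 0 = a ∧ A 0 1 = b ∧ A 1 0 = c ∧ A 1 1 = d :=
  ⟨⟨!![a, b; c, d], by rw [Matrix.det_fin_two]; simpa using h⟩, rfl, rfl, rfl, rfl⟩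

theorem IsPlane.exists_smul {P : Set H3} (hP : IsPlane P) :
    ∃ h : PSL(2, ℂ), ∀ p ∈ P, (h • p).z.im = 0 := by
  rcases hP with ⟨u, k, hu, rfl⟩ | ⟨c, r, hr, rfl⟩
  · obtain ⟨α, hα⟩ := IsAlgClosed.exists_pow_nat_eq (Complex.I * conj u) (n := 2) (by norm_num)
    have hα0 : α ≠ 0 := by
      rintro rfl
      simp at hα
      exact hu hα
    obtain ⟨A, h00, h01, h10, h11⟩ := exists_SL (a := α) (b := -Complex.I * k / α) (c := 0)
      (d := α⁻¹) (by simp [hα0])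
    refine ⟨QuotientGroup.mk A, ?_⟩
    rintro p hp
    rw [mk_smul, smul_z, Complex.div_ofReal_im]
    refine div_eq_zero_iff.mpr (Or.inl ?_)
    have hp : (conj u * p.z).re = k := hp
    have hcα : conj α ≠ 0 := by simpa using hα0
    have hnum : num A p = (Complex.I * (conj u * p.z - k)) * ((‖α‖ ^ 2)⁻¹ : ℝ) := by
      push_cast
      rw [← Complex.mul_conj', num, h00, h01, h10, h11]
      simp only [zero_mul, zero_add, map_inv₀, map_zero, mul_zero, add_zero]
      field_simp
      rw [hα]
      ring
    rw [hnum, Complex.im_mul_ofReal]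
    simp [← hp]
  · obtain ⟨δ, hδ⟩ := IsAlgClosed.exists_pow_nat_eq (2 * Complex.I * r)⁻¹ (n := 2) (by norm_num)
    have hr' : (r : ℂ) ≠ 0 := by exact_mod_cast hr.ne'
    obtain ⟨A, h00, h01, h10, h11⟩ := exists_SL (a := δ * Complex.I)
      (b := -(δ * Complex.I * (c + r))) (c := δ) (d := δ * (r - c)) (by
        have : δ ^ 2 * (2 * Complex.I * r) = 1 := by
          rw [hδ, inv_mul_cancel₀]; simp [hr']
        linear_combination this)
    refine ⟨QuotientGroup.mk A, ?_⟩
    rintro p hp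
    have hp : ‖p.z - c‖ ^ 2 + p.t ^ 2 = r ^ 2 := hp
    rw [mk_smul, smul_z, Complex.div_ofReal_im]
    refine div_eq_zero_iff.mpr (Or.inl ?_)
    have hp' : (p.z - c) * conj (p.z - c) + (p.t : ℂ) ^ 2 = (r : ℂ) ^ 2 := by
      rw [Complex.mul_conj']; exact_mod_cast hp
    have hnum : num A p = ((‖δ‖ ^ 2 * (-(2 * r * (p.z - c).im)) : ℝ) : ℂ) := by
      push_cast
      have him : (((p.z - c).im : ℝ) : ℂ) * (2 * Complex.I) = (p.z - c) - conj (p.z - c) := by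
        apply Complex.ext <;> simp; ring
      rw [← Complex.mul_conj', num, h00, h01, h10, h11]
      simp only [map_add, map_mul, map_sub, Complex.conj_ofReal] at him hp' ⊢
      linear_combination (δ * conj δ * Complex.I) * hp' - (δ * conj δ * r * Complex.I) * him
        + (2 * δ * conj δ * r * (p.z - c).im) * Complex.I_sq
    rw [hnum, Complex.ofReal_im]

/-! ### Reflection identities, virtually abelian groups -/

theorem realMat_anticomm (v w : Fin 3 → ℝ) :
    realMat v * realMat w + realMat w * realMat v = (2 * lform v w : ℂ) • 1 := by
  ext i j
  fin_cases i <;> fin_cases j <;>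
    simp [realMat, lform] <;> ring

theorem commute_of_commute_traceless {N B C : Matrix (Fin 2) (Fin 2) ℂ} (hN : N ≠ 0)
    (htr : N 1 1 = -N 0 0) (hB : B * N = N * B) (hC : C * N = N * C) : B * C = C * B := by
  have key : ∀ B : Matrix (Fin 2) (Fin 2) ℂ, B * N = N * B →
      B 0 1 * N 1 0 = N 0 1 * B 1 0 ∧ (B 0 0 - B 1 1) * N 0 1 = 2 * N 0 0 * B 0 1 ∧
      (B 0 0 - B 1 1) * N 1 0 = 2 * N 0 0 * B 1 0 := by
    intro B hB
    have e00 := congrFun (congrFun hB 0) 0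
    have e01 := congrFun (congrFun hB 0) 1
    have e10 := congrFun (congrFun hB 1) 0
    simp only [Matrix.mul_apply, Fin.sum_univ_two, htr] at e00 e01 e10
    refine ⟨by linear_combination e00, by linear_combination e01, by linear_combination -e10⟩
  obtain ⟨b1, b2, b3⟩ := key B hB
  obtain ⟨c1, c2, c3⟩ := key C hC
  have hpar : B 0 1 * C 1 0 = C 0 1 * B 1 0 ∧
      (B 0 0 - B 1 1) * C 0 1 = (C 0 0 - C 1 1) * B 0 1 ∧
      (B 0 0 - B 1 1) * C 1 0 = (C 0 0 - C 1 1) * B 1 0 := by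
    by_cases h0 : N 0 0 = 0
    · simp only [h0, mul_zero, zero_mul] at b2 b3 c2 c3
      by_cases h1 : N 0 1 = 0
      · have h2 : N 1 0 ≠ 0 := by
          intro h2; apply hN
          ext i j; fin_cases i <;> fin_cases j <;> simp [h0, h1, h2, htr]
        have b3 := (mul_eq_zero.mp b3).resolve_right h2
        have c3 := (mul_eq_zero.mp c3).resolve_right h2
        rw [h1, zero_mul] at b1 c1
        have b1 := (mul_eq_zero.mp b1).resolve_right h2
        have c1 := (mul_eq_zero.mp c1).resolve_right h2
        simp [b1, c1, b3, c3]
      · have b2 := (mul_eq_zero.mp b2).resolve_right h1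
        have c2 := (mul_eq_zero.mp c2).resolve_right h1
        rw [b2, c2]
        refine ⟨mul_left_cancel₀ h1 ?_, by simp, by simp⟩
        linear_combination C 0 1 * b1 - B 0 1 * c1
    · have h0' : 2 * N 0 0 ≠ 0 := by simpa using h0
      refine ⟨?_, ?_, ?_⟩
      · apply mul_left_cancel₀ (mul_ne_zero h0' h0')
        linear_combination (-(C 1 0 * (2 * N 0 0))) * b2 - ((B 0 0 - B 1 1) * N 0 1) * c3
          + (2 * N 0 0 * B 1 0) * c2 + ((C 0 0 - C 1 1) * N 0 1) * b3
      · apply mul_left_cancel₀ h0'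
        linear_combination (-(B 0 0 - B 1 1)) * c2 + (C 0 0 - C 1 1) * b2
      · apply mul_left_cancel₀ h0'
        linear_combination (-(B 0 0 - B 1 1)) * c3 + (C 0 0 - C 1 1) * b3
  obtain ⟨p1, p2, p3⟩ := hpar
  ext i j
  fin_cases i <;> fin_cases j <;> simp [Matrix.mul_apply, Fin.sum_univ_two]
  · linear_combination p1
  · linear_combination p2
  · linear_combination -p3
  · linear_combination -p1

/-- A group generated by elements which commute or anticommute with a fixed traceless matrix is
virtually abelian. -/
theorem isVirtuallyAbelian_of_normalizes {A : Fin 3 → SL(2, ℂ)} {N : Matrix (Fin 2) (Fin 2) ℂ}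
    (hN : N ≠ 0) (htr : N 1 1 = -N 0 0)
    (hA : ∀ i, (A i : Matrix (Fin 2) (Fin 2) ℂ) * N = N * A i ∨
      (A i : Matrix (Fin 2) (Fin 2) ℂ) * N = -(N * A i)) :
    IsVirtuallyAbelian (Subgroup.closure (Set.range fun i => (QuotientGroup.mk (A i) : PSL(2, ℂ)))) := by
  set Γ := Subgroup.closure (Set.range fun i => (QuotientGroup.mk (A i) : PSL(2, ℂ)))
  let E : Subgroup SL(2, ℂ) :=
    { carrier := {B | (B : Matrix (Fin 2) (Fin 2) ℂ) * N = N * B}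
      one_mem' := by simp
      mul_mem' := by
        intro a b ha hb
        simp only [Set.mem_ofPred_eq, Matrix.SpecialLinearGroup.coe_mul] at *
        rw [mul_assoc, hb, ← mul_assoc, ha, mul_assoc]
      inv_mem' := by
        intro a ha
        simp only [Set.mem_ofPred_eq] at *
        have h1 : (a : Matrix (Fin 2) (Fin 2) ℂ) * (a⁻¹ : SL(2, ℂ)) = 1 := by
          rw [← Matrix.SpecialLinearGroup.coe_mul, mul_inv_cancel]; rfl
        have h2 : ((a⁻¹ : SL(2, ℂ)) : Matrix (Fin 2) (Fin 2) ℂ) * a = 1 := by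
          rw [← Matrix.SpecialLinearGroup.coe_mul, inv_mul_cancel]; rfl
        calc ((a⁻¹ : SL(2, ℂ)) : Matrix (Fin 2) (Fin 2) ℂ) * N
            = (a⁻¹ : SL(2, ℂ)) * (N * a) * (a⁻¹ : SL(2, ℂ)) := by
              rw [mul_assoc, mul_assoc, h1, mul_one]
          _ = N * (a⁻¹ : SL(2, ℂ)) := by rw [← ha, ← mul_assoc, h2, one_mul] }
  have hdich : ∀ g ∈ Γ, ∃ B : SL(2, ℂ), QuotientGroup.mk B = g ∧
      ((B : Matrix (Fin 2) (Fin 2) ℂ) * N = N * B ∨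
        (B : Matrix (Fin 2) (Fin 2) ℂ) * N = -(N * B)) := by
    intro g hg
    induction hg using Subgroup.closure_induction with
    | mem x hx => obtain ⟨i, rfl⟩ := hx; exact ⟨A i, rfl, hA i⟩
    | one => exact ⟨1, rfl, Or.inl (by simp)⟩
    | mul x y _ _ hx hy =>
      obtain ⟨B, rfl, hB⟩ := hx
      obtain ⟨C, rfl, hC⟩ := hy
      refine ⟨B * C, rfl, ?_⟩
      rw [Matrix.SpecialLinearGroup.coe_mul, mul_assoc]
      rcases hC with hC | hC <;> rcases hB with hB | hB
      · left; rw [hC, ← mul_assoc, hB, mul_assoc]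
      · right; rw [hC, ← mul_assoc, hB, neg_mul, mul_assoc]
      · right; rw [hC, mul_neg, ← mul_assoc, hB, mul_assoc]
      · left; rw [hC, mul_neg, ← mul_assoc, hB, neg_mul, neg_neg, mul_assoc]
    | inv x _ hx =>
      obtain ⟨B, rfl, hB⟩ := hx
      refine ⟨B⁻¹, rfl, ?_⟩
      have h1 : (B : Matrix (Fin 2) (Fin 2) ℂ) * (B⁻¹ : SL(2, ℂ)) = 1 := by
        rw [← Matrix.SpecialLinearGroup.coe_mul, mul_inv_cancel]; rfl
      have h2 : ((B⁻¹ : SL(2, ℂ)) : Matrix (Fin 2) (Fin 2) ℂ) * B = 1 := by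
        rw [← Matrix.SpecialLinearGroup.coe_mul, inv_mul_cancel]; rfl
      have h3 : ((B⁻¹ : SL(2, ℂ)) : Matrix (Fin 2) (Fin 2) ℂ) * N =
          (B⁻¹ : SL(2, ℂ)) * (N * B) * (B⁻¹ : SL(2, ℂ)) := by
        rw [mul_assoc, mul_assoc, h1, mul_one]
      rcases hB with hB | hB
      · left; rw [h3, ← hB, ← mul_assoc, h2, one_mul]
      · right
        rw [h3, ← neg_neg (N * (B : Matrix (Fin 2) (Fin 2) ℂ)), ← hB, mul_neg, neg_mul,
          ← mul_assoc, h2, one_mul]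
  refine ⟨(E.map (QuotientGroup.mk' (Subgroup.center SL(2, ℂ)))).subgroupOf Γ, ?_, ?_⟩
  · set C := (E.map (QuotientGroup.mk' (Subgroup.center SL(2, ℂ)))).subgroupOf Γ
    have htwo : ∀ g h : Γ, g ∉ C → h ∉ C → g⁻¹ * h ∈ C := by
      intro g h hg hh
      obtain ⟨B, hBg, hB⟩ := hdich g g.2
      obtain ⟨D, hDh, hD⟩ := hdich h h.2
      have hB' : (B : Matrix (Fin 2) (Fin 2) ℂ) * N = -(N * B) :=
        hB.resolve_left fun h0 => hg ⟨B, h0, hBg⟩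
      have hD' : (D : Matrix (Fin 2) (Fin 2) ℂ) * N = -(N * D) :=
        hD.resolve_left fun h0 => hh ⟨D, h0, hDh⟩
      refine ⟨B⁻¹ * D, ?_, ?_⟩
      · have h1 : (B : Matrix (Fin 2) (Fin 2) ℂ) * (B⁻¹ : SL(2, ℂ)) = 1 := by
          rw [← Matrix.SpecialLinearGroup.coe_mul, mul_inv_cancel]; rfl
        have h2 : ((B⁻¹ : SL(2, ℂ)) : Matrix (Fin 2) (Fin 2) ℂ) * B = 1 := by
          rw [← Matrix.SpecialLinearGroup.coe_mul, inv_mul_cancel]; rfl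
        change ((B⁻¹ * D : SL(2, ℂ)) : Matrix (Fin 2) (Fin 2) ℂ) * N = N * (B⁻¹ * D : SL(2, ℂ))
        have h4 : ((B⁻¹ : SL(2, ℂ)) : Matrix (Fin 2) (Fin 2) ℂ) * N = -(N * (B⁻¹ : SL(2, ℂ))) := by
          calc ((B⁻¹ : SL(2, ℂ)) : Matrix (Fin 2) (Fin 2) ℂ) * N
              = (B⁻¹ : SL(2, ℂ)) * (N * B) * (B⁻¹ : SL(2, ℂ)) := by
                rw [mul_assoc, mul_assoc, h1, mul_one]
            _ = _ := by
                rw [← neg_neg (N * (B : Matrix (Fin 2) (Fin 2) ℂ)), ← hB', mul_neg, neg_mul,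
                  ← mul_assoc, h2, one_mul]
        rw [Matrix.SpecialLinearGroup.coe_mul, mul_assoc, hD', mul_neg, ← mul_assoc, h4, neg_mul,
          neg_neg, mul_assoc]
      · rw [map_mul, map_inv]
        change (QuotientGroup.mk B : PSL(2, ℂ))⁻¹ * QuotientGroup.mk D = _
        rw [hBg, hDh]; rfl
    constructor
    by_cases hall : ∀ g : Γ, g ∈ C
    · rw [(Subgroup.eq_top_iff' C).mpr hall, Subgroup.index_top]; exact one_ne_zero
    · push Not at hall
      obtain ⟨g₀, hg₀⟩ := hall
      have : Finite (Γ ⧸ C) := by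
        refine Finite.of_surjective (fun b : Bool => (QuotientGroup.mk (if b then 1 else g₀) : Γ ⧸ C))
          fun q => ?_
        obtain ⟨g, rfl⟩ := QuotientGroup.mk_surjective q
        by_cases hg : g ∈ C
        · exact ⟨true, QuotientGroup.eq.mpr (by simpa using hg)⟩
        · exact ⟨false, QuotientGroup.eq.mpr (by simpa using htwo _ _ hg₀ hg)⟩
      exact Subgroup.index_ne_zero_of_finite
  · refine ⟨⟨?_⟩⟩
    rintro ⟨⟨a, ha⟩, B, hB, hBa⟩ ⟨⟨b, hb⟩, D, hD, hDb⟩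
    have hc : B * D = D * B :=
      Subtype.ext (commute_of_commute_traceless hN htr hB hD)
    apply Subtype.ext; apply Subtype.ext
    change a * b = b * a
    have hBa' : (QuotientGroup.mk B : PSL(2, ℂ)) = a := hBa
    have hDb' : (QuotientGroup.mk D : PSL(2, ℂ)) = b := hDb
    rw [← hBa', ← hDb', ← QuotientGroup.mk_mul, hc, QuotientGroup.mk_mul]

theorem isGood_of_not_isVirtuallyAbelian {A : Fin 3 → SL(2, ℂ)} {T : Fin 3 → Fin 3 → ℝ}
    (hA : ∀ i, IsHalfTurn (A i) (T i))
    (h : ¬ IsVirtuallyAbelian (Subgroup.closure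
      (Set.range fun i => (QuotientGroup.mk (A i) : PSL(2, ℂ))))) : IsGood T := by
  have hnorm : ∀ v : Fin 3 → ℝ, v ≠ 0 →
      (∀ i, v = T i ∨ lform (T i) v = 0) → False := by
    intro v hv hT
    apply h
    refine isVirtuallyAbelian_of_normalizes (N := realMat v) ?_ (by simp [realMat]) ?_
    · intro h0
      apply hv
      have h1 := congrFun (congrFun h0 0) 0
      have h2 := congrFun (congrFun h0 0) 1
      have h3 := congrFun (congrFun h0 1) 0
      simp only [realMat, Matrix.of_apply, Matrix.cons_val', Matrix.cons_val_zero,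
        Matrix.cons_val_one, Matrix.cons_val_fin_one, Matrix.zero_apply,
        Complex.ofReal_eq_zero] at h1 h2 h3
      ext i; fin_cases i
      · exact h1
      · change v 1 = 0; linarith
      · change v 2 = 0; linarith
    · intro i
      rw [hA i, Matrix.smul_mul, Matrix.mul_smul]
      rcases hT i with h1 | h1
      · left; rw [h1]
      · right
        have := realMat_anticomm (T i) v
        rw [h1, Complex.ofReal_zero, mul_zero, zero_smul] at this
        rw [eq_neg_of_add_eq_zero_left this, smul_neg]
  refine ⟨fun hdet => ?_, fun i => ?_⟩
  · obtain ⟨w, hw, hTw⟩ := Matrix.exists_mulVec_eq_zero_iff.mpr hdet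
    refine hnorm ![w 0, w 1, -w 2] ?_ fun i => Or.inr ?_
    · intro h0
      apply hw
      have h1 := congrFun h0 0
      have h2 := congrFun h0 1
      have h3 := congrFun h0 2
      simp at h1 h2 h3
      ext i; fin_cases i <;> simpa
    · have := congrFun hTw i
      simp [Matrix.mulVec, dotProduct, Fin.sum_univ_three] at this
      simp [lform]; linarith
  · by_contra hcon
    push Not at hcon
    refine hnorm (T i) ?_ fun j => ?_
    · intro h0
      have := (hA i).unit
      rw [h0] at this; simp [lform] at this
    · by_cases hij : j = i
      · left; rw [hij]
      · right; rw [lform_comm]; exact hcon j hij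

/-! ### The mirrors of a discrete group -/

/-- The normals of the half-turns of `Γ` about lines in the plane of real points. -/
def mirrors (Γ : Subgroup PSL(2, ℂ)) : Set (Fin 3 → ℝ) :=
  {v | ∃ A, IsHalfTurn A v ∧ (QuotientGroup.mk A : PSL(2, ℂ)) ∈ Γ}

theorem isClosed_center : IsClosed (Subgroup.center SL(2, ℂ) : Set SL(2, ℂ)) := by
  have : (Subgroup.center SL(2, ℂ) : Set SL(2, ℂ)) = Set.centralizer Set.univ := by
    rw [Set.centralizer_univ, Subgroup.coe_center]
  rw [this]
  exact Set.isClosed_centralizer _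

theorem t2Space_psl : T2Space PSL(2, ℂ) :=
  have := isClosed_center
  have : T3Space (SL(2, ℂ) ⧸ Subgroup.center SL(2, ℂ)) := QuotientGroup.instT3Space _
  inferInstanceAs (T2Space (SL(2, ℂ) ⧸ Subgroup.center SL(2, ℂ)))

/-- A discrete subgroup meets a compact set in a finite set. -/
theorem finite_inter_of_discrete {Γ : Subgroup PSL(2, ℂ)} (hΓ : DiscreteTopology Γ)
    {K : Set PSL(2, ℂ)} (hK : IsCompact K) : (K ∩ Γ).Finite := by
  have := t2Space_psl
  have hcl : IsClosed (Γ : Set PSL(2, ℂ)) := Subgroup.isClosed_of_discrete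
  have hd : IsDiscrete (Γ : Set PSL(2, ℂ)) := ⟨hΓ⟩
  exact (hK.inter_right hcl).finite (hd.mono Set.inter_subset_right)

theorem realMat_injective : Function.Injective realMat := by
  intro v w h
  have h1 := congrFun (congrFun h 0) 0
  have h2 := congrFun (congrFun h 0) 1
  have h3 := congrFun (congrFun h 1) 0
  simp only [realMat, Matrix.of_apply, Matrix.cons_val', Matrix.cons_val_zero,
    Matrix.cons_val_one, Matrix.cons_val_fin_one, Complex.ofReal_inj] at h1 h2 h3
  ext i; fin_cases i
  · exact h1
  · change v 1 = w 1; linarith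
  · change v 2 = w 2; linarith

theorem realMat_neg (v : Fin 3 → ℝ) : realMat (-v) = -realMat v := by
  ext i j; fin_cases i <;> fin_cases j <;> simp [realMat] <;> ring

theorem continuous_realMat : Continuous realMat := by
  refine continuous_matrix fun i j => ?_
  fin_cases i <;> fin_cases j <;> simp [realMat] <;> fun_prop

theorem IsHalfTurn.conj_mul {A B : SL(2, ℂ)} {v w : Fin 3 → ℝ} (hA : IsHalfTurn A v)
    (hB : IsHalfTurn B w) : IsHalfTurn (A * B * A) (w - (2 * lform v w) • v) := by
  have hu := hA.unit
  unfold IsHalfTurn at *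
  have h1 := realMat_anticomm v w
  have h2 : realMat v * realMat v = 1 := by
    have h := realMat_anticomm v v
    rw [hu] at h
    rw [← two_smul ℂ, Complex.ofReal_one, mul_one] at h
    exact smul_right_injective _ (two_ne_zero (α := ℂ)) h
  have h3 : realMat v * realMat w * realMat v = (2 * lform v w : ℂ) • realMat v - realMat w := by
    rw [eq_sub_of_add_eq h1, sub_mul, mul_assoc, h2, mul_one, smul_mul_assoc, one_mul]
  have h4 : realMat (w - (2 * lform v w) • v) = realMat w - (2 * lform v w : ℂ) • realMat v := by
    ext i j; fin_cases i <;> fin_cases j <;> simp [realMat] <;> ring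
  rw [Matrix.SpecialLinearGroup.coe_mul, Matrix.SpecialLinearGroup.coe_mul, hA, hB, h4,
    smul_mul_smul_comm, smul_mul_smul_comm, h3, Complex.I_mul_I, neg_one_mul, neg_smul, ← smul_neg,
    neg_sub]

theorem isMirrorSet_mirrors {Γ : Subgroup PSL(2, ℂ)} (hΓ : DiscreteTopology Γ) :
    IsMirrorSet (mirrors Γ) where
  unit := by rintro v ⟨A, hA, -⟩; exact hA.unit
  refl := by
    rintro v ⟨A, hA, hAΓ⟩ w ⟨B, hB, hBΓ⟩
    exact ⟨A * B * A, hA.conj_mul hB, Γ.mul_mem (Γ.mul_mem hAΓ hBΓ) hAΓ⟩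
  fin r := by
    set K : Set (Fin 3 → ℝ) := Metric.closedBall 0 r ∩ {v | lform v v = 1} with hKdef
    have hK : IsCompact K := by
      refine (isCompact_closedBall 0 r).inter_right (isClosed_eq ?_ continuous_const)
      unfold lform; fun_prop
    let F : K → SL(2, ℂ) := fun v =>
      ⟨Complex.I • realMat v, (exists_isHalfTurn v.2.2).choose_spec ▸
        (exists_isHalfTurn v.2.2).choose.det_coe⟩
    have hF : Continuous F :=
      Topology.IsInducing.subtypeVal.continuous_iff.mpr
        ((continuous_realMat.comp continuous_subtype_val).const_smul Complex.I)
    have hc : IsCompact (Set.range fun v => (QuotientGroup.mk (F v) : PSL(2, ℂ))) := by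
      have := isCompact_iff_compactSpace.mp hK
      exact isCompact_range (QuotientGroup.continuous_mk.comp hF)
    have hfin := finite_inter_of_discrete hΓ hc
    have hpre : {v ∈ mirrors Γ | ‖v‖ ≤ r} ⊆ Subtype.val ''
        ((fun v => (QuotientGroup.mk (F v) : PSL(2, ℂ))) ⁻¹'
          ((Set.range fun v => (QuotientGroup.mk (F v) : PSL(2, ℂ))) ∩ Γ)) := by
      rintro v ⟨⟨A, hA, hAΓ⟩, hv⟩
      have hvK : v ∈ K := ⟨by simpa using hv, hA.unit⟩
      refine ⟨⟨v, hvK⟩, ⟨⟨_, rfl⟩, ?_⟩, rfl⟩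
      have : F ⟨v, hvK⟩ = A := Subtype.ext hA.symm
      change (QuotientGroup.mk (F ⟨v, hvK⟩) : PSL(2, ℂ)) ∈ Γ
      rwa [this]
    refine Set.Finite.subset (Set.Finite.image _ ?_) hpre
    refine hfin.preimage' fun b _ => ?_
    by_cases hb : ∃ v₀, (QuotientGroup.mk (F v₀) : PSL(2, ℂ)) = b
    · obtain ⟨v₀, rfl⟩ := hb
      refine Set.Finite.of_finite_image (f := Subtype.val) ?_ Subtype.val_injective.injOn
      refine Set.Finite.subset (Set.toFinite {v₀.1, -v₀.1}) ?_
      rintro _ ⟨v, hv, rfl⟩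
      have hv : (QuotientGroup.mk (F v) : PSL(2, ℂ)) = QuotientGroup.mk (F v₀) := hv
      have hI : Function.Injective fun M : Matrix (Fin 2) (Fin 2) ℂ => Complex.I • M :=
        smul_right_injective _ Complex.I_ne_zero
      rcases mk_eq_mk_iff.mp hv with h | h
      · left
        exact realMat_injective (hI (congrArg Subtype.val h))
      · right
        apply realMat_injective
        rw [realMat_neg]
        apply hI
        have := congrArg Subtype.val h
        simp only [smul_neg]
        exact this
    · convert Set.finite_empty
      ext v; simp only [Set.mem_preimage, Set.mem_singleton_iff, Set.mem_empty_iff_false, iff_false]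
      exact fun h => hb ⟨v, h⟩

/-! ### The Margulis constant in terms of heights -/

/-- The extremal value of the displacement. -/
noncomputable def cosh237 : ℝ := 1 + 2 * sinh237 ^ 2

theorem one_lt_cosh237 : 1 < cosh237 := by
  have := sinh237_pos
  unfold cosh237; nlinarith

theorem le_iSup_hdist (f : Fin 3 → PSL(2, ℂ)) (x : H3) (i : Fin 3) :
    hdist (f i • x) x ≤ ⨆ i, hdist (f i • x) x :=
  le_ciSup (f := fun i => hdist (f i • x) x) (Set.finite_range _).bddAbove i

theorem bddBelow_range_iSup (f : Fin 3 → PSL(2, ℂ)) :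
    BddBelow (Set.range fun x : H3 => ⨆ i, hdist (f i • x) x) := by
  refine ⟨0, ?_⟩
  rintro _ ⟨x, rfl⟩
  exact (Real.arcosh_nonneg (one_le_coshDist _ _)).trans (le_iSup_hdist f x 0)

instance : Nonempty H3 := ⟨⟨0, 1, one_pos⟩⟩

/-- If some heights exceed `r` everywhere then the Margulis constant is at least
`arcosh (1 + 2 r²)`. -/
theorem le_margulisConstant {A : Fin 3 → SL(2, ℂ)} {T : Fin 3 → Fin 3 → ℝ}
    (hA : ∀ i, IsHalfTurn (A i) (T i)) {r : ℝ} (hr : 0 ≤ r)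
    (h : ∀ x s, 0 < s → ∃ i, r ≤ |height x s (T i)|) :
    Real.arcosh (1 + 2 * r ^ 2) ≤
      margulisConstant fun i => (QuotientGroup.mk (A i) : PSL(2, ℂ)) := by
  refine le_ciInf fun p => ?_
  have ht := p.t_pos
  obtain ⟨i, hi⟩ := h p.z.re (√(p.z.im ^ 2 + p.t ^ 2)) (Real.sqrt_pos.mpr (by positivity))
  refine le_trans ?_ (le_iSup_hdist _ p i)
  rw [hdist_eq, Real.arcosh_le_arcosh (by positivity)
    (zero_lt_one.trans_le (one_le_coshDist _ _)), mk_smul]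
  refine le_trans ?_ ((hA i).le_coshDist p)
  have : r ^ 2 ≤ height p.z.re (√(p.z.im ^ 2 + p.t ^ 2)) (T i) ^ 2 := by
    rw [← sq_abs (height _ _ _)]; gcongr
  linarith

theorem arcosh_cosh237_le {A : Fin 3 → SL(2, ℂ)} {T : Fin 3 → Fin 3 → ℝ}
    (hA : ∀ i, IsHalfTurn (A i) (T i))
    (hK : IsKleinian (Subgroup.closure
      (Set.range fun i => (QuotientGroup.mk (A i) : PSL(2, ℂ))))) :
    Real.arcosh cosh237 ≤ margulisConstant fun i => (QuotientGroup.mk (A i) : PSL(2, ℂ)) := by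
  have hS := isMirrorSet_mirrors hK.1
  have hg := isGood_of_not_isVirtuallyAbelian hA hK.2
  refine le_margulisConstant hA sinh237_pos.le fun x s hs => ?_
  by_contra hcon
  push Not at hcon
  have := hS.abs_height_eq hg (fun i => ⟨A i, hA i, Subgroup.subset_closure ⟨i, rfl⟩⟩) hs
    (fun i => (hcon i).le) 0
  exact (hcon 0).ne this

/-- For linearly independent normals the least height is attained. -/
theorem exists_min_height {T : Fin 3 → Fin 3 → ℝ} (hg : IsGood T) :
    ∃ x s, 0 < s ∧ ∃ r, (∀ i, |height x s (T i)| ≤ r) ∧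
      ∀ x' s', 0 < s' → ∃ i, r ≤ |height x' s' (T i)| := by
  -- the vector of a point, and the linear map of its heights
  let L : (Fin 3 → ℝ) →ₗ[ℝ] (Fin 3 → ℝ) := (Matrix.of T).toLin'
  have hL : L.ker = ⊥ := by
    rw [LinearMap.ker_eq_bot']
    intro w hw
    by_contra h0
    exact hg.1 (Matrix.exists_mulVec_eq_zero_iff.mp ⟨w, h0, by simpa [L] using hw⟩)
  obtain ⟨K, -, hK⟩ := L.exists_antilipschitzWith hL
  let X : ℝ → ℝ → Fin 3 → ℝ := fun x s =>
    ![x / s, (1 - x ^ 2 - s ^ 2) / (2 * s), (1 + x ^ 2 + s ^ 2) / (2 * s)]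
  have hLX : ∀ x s, 0 < s → ∀ i, L (X x s) i = height x s (T i) := by
    intro x s hs i
    simp [L, X, Matrix.mulVec, dotProduct, Fin.sum_univ_three, height]
    field_simp
    ring
  let G : ℝ × ℝ → ℝ := fun p => ‖fun i => height p.1 p.2 (T i)‖
  have hbound : ∀ x s, 0 < s → ‖X x s‖ ≤ K * G (x, s) := by
    intro x s hs
    have h := hK.le_mul_dist (X x s) 0
    rw [map_zero, dist_zero_right, dist_zero_right] at h
    rwa [show L (X x s) = fun i => height x s (T i) from funext (hLX x s hs)] at h
  set R : ℝ := K * G (0, 1) + 1 with hR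
  have hR1 : 1 ≤ R := by
    have : 0 ≤ K * G (0, 1) := mul_nonneg K.2 (norm_nonneg _)
    linarith
  set C : Set (ℝ × ℝ) := Set.Icc (-(2 * R ^ 2)) (2 * R ^ 2) ×ˢ Set.Icc (1 / (2 * R)) (2 * R)
  have hCpos : ∀ p ∈ C, 0 < p.2 := fun p hp => by
    have : 0 < 1 / (2 * R) := by positivity
    exact this.trans_le hp.2.1
  have hC : IsCompact C := isCompact_Icc.prod isCompact_Icc
  have hC0 : (0, 1) ∈ C := by
    refine ⟨⟨by simp; positivity, by positivity⟩, ?_, by linarith⟩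
    change 1 / (2 * R) ≤ 1
    rw [div_le_iff₀ (by positivity)]; linarith
  have hG : ContinuousOn G C := fun p hp =>
    (ContinuousAt.norm (continuousAt_pi.mpr fun i =>
      continuousAt_height (T i) (hCpos p hp))).continuousWithinAt
  obtain ⟨⟨x, s⟩, hp, hmin⟩ := hC.exists_isMinOn ⟨_, hC0⟩ hG
  refine ⟨x, s, hCpos _ hp, G (x, s), fun i => ?_, fun x' s' hs' => ?_⟩
  · exact norm_le_pi_norm (fun i => height x s (T i)) i
  · have hle : G (x, s) ≤ G (x', s') := by
      by_cases hp' : (x', s') ∈ C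
      · exact hmin hp'
      · by_contra hlt
        rw [not_le] at hlt
        apply hp'
        have h1 : ‖X x' s'‖ ≤ R := by
          refine (hbound x' s' hs').trans ?_
          have h2 : G (x, s) ≤ G (0, 1) := hmin hC0
          have : (K : ℝ) * G (x', s') ≤ K * G (0, 1) := by
            gcongr; exact hlt.le.trans h2
          linarith
        have h2 := (norm_le_pi_norm (X x' s') 2).trans h1
        have h3 := (norm_le_pi_norm (X x' s') 0).trans h1
        simp only [X, Matrix.cons_val, Real.norm_eq_abs, Matrix.cons_val_zero] at h2 h3
        have h4 := (abs_le.mp h2).2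
        rw [div_le_iff₀ (by positivity)] at h4
        have h5 : s' ≤ 2 * R := by nlinarith [sq_nonneg x']
        have h6 : |x'| ≤ R * s' := by
          rw [abs_div, abs_of_pos hs', div_le_iff₀ hs'] at h3; exact h3
        have h7 : R * s' ≤ 2 * R ^ 2 := by nlinarith
        refine ⟨abs_le.mp (h6.trans h7), ?_, h5⟩
        change 1 / (2 * R) ≤ s'
        rw [div_le_iff₀ (by positivity)]
        nlinarith [sq_nonneg x', sq_nonneg s']
    by_contra hcon
    push Not at hcon
    have : G (x', s') < G (x, s) := by
      refine (pi_norm_lt_iff ((norm_nonneg _).lt_of_ne' ?_)).mpr fun i => hcon i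
      intro h0
      have := hcon 0
      exact absurd (this.trans_eq h0) (not_lt.mpr (abs_nonneg _))
    linarith

theorem exists_is237_of_margulisConstant_eq {A : Fin 3 → SL(2, ℂ)} {T : Fin 3 → Fin 3 → ℝ}
    (hA : ∀ i, IsHalfTurn (A i) (T i))
    (hK : IsKleinian (Subgroup.closure
      (Set.range fun i => (QuotientGroup.mk (A i) : PSL(2, ℂ)))))
    (hm : (margulisConstant fun i => (QuotientGroup.mk (A i) : PSL(2, ℂ))) = Real.arcosh cosh237) :
    ∃ e : Fin 3 → ℝ, (∀ i, e i = 1 ∨ e i = -1) ∧ Is237 (fun i => e i • T i) := by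
  have hS := isMirrorSet_mirrors hK.1
  have hg := isGood_of_not_isVirtuallyAbelian hA hK.2
  obtain ⟨x, s, hs, r, hr, hmin⟩ := exists_min_height hg
  have hr0 : 0 ≤ r := (abs_nonneg _).trans (hr 0)
  have h1 := le_margulisConstant hA hr0 hmin
  rw [hm, Real.arcosh_le_arcosh (by positivity) (zero_lt_one.trans one_lt_cosh237), cosh237] at h1
  have h2 : r ≤ sinh237 := abs_le_of_sq_le_sq' (by linarith) sinh237_pos.le |>.2
  exact hS.exists_is237 hg (fun i => ⟨A i, hA i, Subgroup.subset_closure ⟨i, rfl⟩⟩) hs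
    fun i => (hr i).trans h2

/-! ### The `(2,3,7)` triangle: from the Gram matrix to the triangle -/

/-- The timelike vector of a point in the plane of real points. -/
noncomputable def pointVec (p : H3) : Fin 3 → ℝ :=
  ![-p.z.re / p.t, -(1 - p.z.re ^ 2 - p.t ^ 2) / (2 * p.t), (1 + p.z.re ^ 2 + p.t ^ 2) / (2 * p.t)]

theorem height_eq_lform (p : H3) (v : Fin 3 → ℝ) :
    height p.z.re p.t v = -lform (pointVec p) v := by
  have := p.t_pos.ne'
  simp [height, lform, pointVec]
  field_simp
  ring

theorem coshDist_eq_lform {p q : H3} (hp : p.z.im = 0) (hq : q.z.im = 0) :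
    coshDist p q = -lform (pointVec p) (pointVec q) := by
  have h1 := p.t_pos.ne'
  have h2 := q.t_pos.ne'
  rw [coshDist, ← Complex.normSq_eq_norm_sq, Complex.normSq_apply, Complex.sub_re, Complex.sub_im,
    hp, hq]
  simp [lform, pointVec]
  field_simp
  ring

theorem exists_pointVec {X : Fin 3 → ℝ} (hX : lform X X = -1) :
    ∃ p : H3, p.z.im = 0 ∧ ∃ e : ℝ, (e = 1 ∨ e = -1) ∧ pointVec p = e • X := by
  have key : ∀ X : Fin 3 → ℝ, lform X X = -1 → 0 < X 2 - X 1 →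
      ∃ p : H3, p.z.im = 0 ∧ pointVec p = X := by
    intro X hX hpos
    refine ⟨⟨(-(X 0 / (X 2 - X 1)) : ℝ), 1 / (X 2 - X 1), by positivity⟩, Complex.ofReal_im _, ?_⟩
    have hX' : X 0 * X 0 + X 1 * X 1 - X 2 * X 2 = -1 := hX
    have hne := hpos.ne'
    ext i
    fin_cases i
    · simp only [pointVec, Complex.ofReal_re, Fin.zero_eta, Matrix.cons_val_zero]
      field_simp
    · simp only [pointVec, Complex.ofReal_re, Fin.mk_one, Matrix.cons_val_one,
        Matrix.cons_val_zero]
      field_simp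
      linear_combination hX'
    · simp only [pointVec, Complex.ofReal_re, Fin.reduceFinMk, Matrix.cons_val]
      field_simp
      linear_combination hX'
  have hne : X 2 - X 1 ≠ 0 := by
    intro h
    have hX' : X 0 * X 0 + X 1 * X 1 - X 2 * X 2 = -1 := hX
    rw [show X 2 = X 1 by linarith] at hX'
    nlinarith [mul_self_nonneg (X 0)]
  rcases lt_or_gt_of_ne hne with h | h
  · obtain ⟨p, hp, hpX⟩ := key (-X) (by simpa [lform] using hX) (by simp; linarith)
    exact ⟨p, hp, -1, Or.inr rfl, by rw [hpX]; simp⟩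
  · obtain ⟨p, hp, hpX⟩ := key X hX h
    exact ⟨p, hp, 1, Or.inl rfl, by rw [hpX]; simp⟩

theorem IsHalfTurn.mem_axis {A : SL(2, ℂ)} {v : Fin 3 → ℝ} (h : IsHalfTurn A v) {p : H3}
    (hp : p.z.im = 0) (hpv : lform (pointVec p) v = 0) :
    p ∈ axis (QuotientGroup.mk A : PSL(2, ℂ)) := by
  rw [mem_axis_iff, mk_smul]
  apply eq_of_coshDist_eq_one
  rw [h.coshDist_eq hp, height_eq_lform, hpv]
  norm_num

/-- The Lorentzian cross product. -/
def lcross (v w : Fin 3 → ℝ) : Fin 3 → ℝ :=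
  ![v 1 * w 2 - v 2 * w 1, v 2 * w 0 - v 0 * w 2, -(v 0 * w 1 - v 1 * w 0)]

theorem lform_lcross (v w x y : Fin 3 → ℝ) : lform (lcross v w) (lcross x y) =
    lform v y * lform w x - lform v x * lform w y := by
  simp [lform, lcross]; ring

theorem lform_lcross_left (v w : Fin 3 → ℝ) : lform (lcross v w) v = 0 := by
  simp [lform, lcross]; ring

theorem lform_lcross_right (v w : Fin 3 → ℝ) : lform (lcross v w) w = 0 := by
  simp [lform, lcross]; ring

/-- The intersection point of two mirrors. -/
theorem exists_vertex {v w : Fin 3 → ℝ} (hv : lform v v = 1) (hw : lform w w = 1) {n : ℝ}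
    (hn : 0 < n) (h : n ^ 2 = 1 - lform v w ^ 2) :
    ∃ p : H3, p.z.im = 0 ∧ ∃ e : ℝ, (e = 1 ∨ e = -1) ∧ pointVec p = (e / n) • lcross v w := by
  obtain ⟨p, hp, e, he, hpe⟩ := exists_pointVec (X := n⁻¹ • lcross v w) (by
    have : lform (n⁻¹ • lcross v w) (n⁻¹ • lcross v w) =
        n⁻¹ ^ 2 * lform (lcross v w) (lcross v w) := by
      simp [lform]; ring
    rw [this, lform_lcross, hv, hw, lform_comm w v]
    field_simp
    linarith)
  exact ⟨p, hp, e, he, by rw [hpe, smul_smul]; rfl⟩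

/-- The hyperbolic cosines of the sides of the `(2,3,7)` triangle. -/
def HasSides237 (V : Fin 3 → H3) : Prop :=
  coshDist (V 0) (V 1) = Real.cos (Real.pi / 7) / (√3 / 2) ∧
  coshDist (V 0) (V 2) = 1 / (2 * √(1 - Real.cos (Real.pi / 7) ^ 2)) ∧
  coshDist (V 1) (V 2) =
    Real.cos (Real.pi / 7) / (2 * (√3 / 2) * √(1 - Real.cos (Real.pi / 7) ^ 2))

theorem HasSides237.sqrts {V : Fin 3 → H3} (h : HasSides237 V) :
    √(coshDist (V 0) (V 1) ^ 2 - 1) = √(Real.cos (Real.pi / 7) ^ 2 - 3 / 4) / (√3 / 2) ∧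
    √(coshDist (V 0) (V 2) ^ 2 - 1) =
      √(Real.cos (Real.pi / 7) ^ 2 - 3 / 4) / √(1 - Real.cos (Real.pi / 7) ^ 2) ∧
    √(coshDist (V 1) (V 2) ^ 2 - 1) = √(Real.cos (Real.pi / 7) ^ 2 - 3 / 4) /
      ((√3 / 2) * √(1 - Real.cos (Real.pi / 7) ^ 2)) := by
  obtain ⟨h1, h2, h3⟩ := h
  have hk := cos_pi_div_seven_bounds
  have hs : (√3 / 2) ^ 2 = 3 / 4 := by rw [div_pow, Real.sq_sqrt (by norm_num)]; norm_num
  have hs0 : 0 < √3 / 2 := by positivity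
  have hS : √(1 - Real.cos (Real.pi / 7) ^ 2) ^ 2 = 1 - Real.cos (Real.pi / 7) ^ 2 :=
    Real.sq_sqrt (by nlinarith)
  have hS0 : 0 < √(1 - Real.cos (Real.pi / 7) ^ 2) := Real.sqrt_pos.mpr (by nlinarith)
  rw [h1, h2, h3]
  set S := √(1 - Real.cos (Real.pi / 7) ^ 2)
  set s := √3 / 2
  set k := Real.cos (Real.pi / 7)
  have aux : ∀ {x y : ℝ}, 0 < y → x * y ^ 2 = k ^ 2 - 3 / 4 → √x = √(k ^ 2 - 3 / 4) / y := by
    intro x y hy hxy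
    rw [eq_div_iff hy.ne', ← hxy, Real.sqrt_mul' _ (by positivity), Real.sqrt_sq hy.le]
  refine ⟨aux hs0 ?_, aux hS0 ?_, aux (by positivity) ?_⟩
  · have h4 : (k / s) ^ 2 * s ^ 2 = k ^ 2 := by rw [← mul_pow, div_mul_cancel₀ _ hs0.ne']
    linear_combination h4 - hs
  · have h4 : (1 / (2 * S)) ^ 2 * S ^ 2 = 1 / 4 := by
      clear_value S
      field_simp
      norm_num
    linear_combination h4 - hS
  · have h4 : (k / (2 * s * S)) ^ 2 * (s * S) ^ 2 = k ^ 2 / 4 := by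
      clear_value S s
      field_simp
      norm_num
    linear_combination h4 - S ^ 2 * hs - (3 / 4) * hS

theorem HasSides237.angles {V : Fin 3 → H3} (h : HasSides237 V) :
    hangle (V 1) (V 0) (V 2) = Real.pi / 2 ∧ hangle (V 2) (V 1) (V 0) = Real.pi / 3 ∧
    hangle (V 0) (V 2) (V 1) = Real.pi / 7 := by
  obtain ⟨q1, q2, q3⟩ := h.sqrts
  obtain ⟨h1, h2, h3⟩ := h
  have hk := cos_pi_div_seven_bounds
  have hpi := Real.pi_pos
  have hs : (√3 / 2) ^ 2 = 3 / 4 := by rw [div_pow, Real.sq_sqrt (by norm_num)]; norm_num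
  have hs0 : 0 < √3 / 2 := by positivity
  have hS : √(1 - Real.cos (Real.pi / 7) ^ 2) ^ 2 = 1 - Real.cos (Real.pi / 7) ^ 2 :=
    Real.sq_sqrt (by nlinarith)
  have hS0 : 0 < √(1 - Real.cos (Real.pi / 7) ^ 2) := Real.sqrt_pos.mpr (by nlinarith)
  have hE : √(Real.cos (Real.pi / 7) ^ 2 - 3 / 4) ^ 2 = Real.cos (Real.pi / 7) ^ 2 - 3 / 4 :=
    Real.sq_sqrt (by nlinarith)
  have hE0 : 0 < √(Real.cos (Real.pi / 7) ^ 2 - 3 / 4) := Real.sqrt_pos.mpr (by nlinarith)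
  rw [hangle_eq, hangle_eq, hangle_eq, coshDist_comm (V 1) (V 0), coshDist_comm (V 2) (V 0),
    coshDist_comm (V 2) (V 1), q1, q2, q3, h1, h2, h3]
  refine ⟨?_, ?_, ?_⟩
  · rw [Real.arccos_eq_pi_div_two, div_eq_zero_iff]
    left
    field_simp
    ring
  · rw [← Real.arccos_cos (x := Real.pi / 3) (by positivity) (by linarith), Real.cos_pi_div_three]
    congr 1
    set S := √(1 - Real.cos (Real.pi / 7) ^ 2)
    set s := √3 / 2
    set E := √(Real.cos (Real.pi / 7) ^ 2 - 3 / 4)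
    set k := Real.cos (Real.pi / 7)
    field_simp
    linear_combination -hE - hs
  · conv_rhs => rw [← Real.arccos_cos (x := Real.pi / 7) (by positivity) (by linarith)]
    congr 1
    set S := √(1 - Real.cos (Real.pi / 7) ^ 2)
    set s := √3 / 2
    set E := √(Real.cos (Real.pi / 7) ^ 2 - 3 / 4)
    set k := Real.cos (Real.pi / 7)
    field_simp
    linear_combination (-4 * k) * hE + (-4 * k) * hS

theorem HasSides237.injective {V : Fin 3 → H3} (h : HasSides237 V) : Function.Injective V := by
  obtain ⟨q1, q2, q3⟩ := h.sqrts
  have hk := cos_pi_div_seven_bounds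
  have hS0 : 0 < √(1 - Real.cos (Real.pi / 7) ^ 2) := Real.sqrt_pos.mpr (by nlinarith)
  have hE0 : 0 < √(Real.cos (Real.pi / 7) ^ 2 - 3 / 4) := Real.sqrt_pos.mpr (by nlinarith)
  have hself : ∀ p : H3, √(coshDist p p ^ 2 - 1) = 0 := by intro p; simp [coshDist]
  have n1 : V 0 ≠ V 1 := by
    intro h; rw [h, hself] at q1; exact (div_pos hE0 (by positivity)).ne q1
  have n2 : V 0 ≠ V 2 := by
    intro h; rw [h, hself] at q2; exact (div_pos hE0 (by positivity)).ne q2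
  have n3 : V 1 ≠ V 2 := by
    intro h; rw [h, hself] at q3; exact (div_pos hE0 (by positivity)).ne q3
  intro i j hij
  fin_cases i <;> fin_cases j
  · rfl
  · exact absurd hij n1
  · exact absurd hij n2
  · exact absurd hij.symm n1
  · rfl
  · exact absurd hij n3
  · exact absurd hij.symm n2
  · exact absurd hij.symm n3
  · rfl

theorem Is237.axesBound {A : Fin 3 → SL(2, ℂ)} {T : Fin 3 → Fin 3 → ℝ}
    (hA : ∀ i, IsHalfTurn (A i) (T i)) (hT : Is237 T) :
    AxesBound237Triangle fun i => (QuotientGroup.mk (A i) : PSL(2, ℂ)) := by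
  obtain ⟨σ, h12, h02, h01⟩ := hT
  have hu : ∀ i, lform (T i) (T i) = 1 := fun i => (hA i).unit
  have hk := cos_pi_div_seven_bounds
  have hk0 : 0 < Real.cos (Real.pi / 7) := by linarith
  have hs : (√3 / 2) ^ 2 = 3 / 4 := by rw [div_pow, Real.sq_sqrt (by norm_num)]; norm_num
  have hs0 : 0 < √3 / 2 := by positivity
  have hS : √(1 - Real.cos (Real.pi / 7) ^ 2) ^ 2 = 1 - Real.cos (Real.pi / 7) ^ 2 :=
    Real.sq_sqrt (by nlinarith)
  have hS0 : 0 < √(1 - Real.cos (Real.pi / 7) ^ 2) := Real.sqrt_pos.mpr (by nlinarith)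
  obtain ⟨p0, hp0, e0, he0, hpe0⟩ := exists_vertex (hu (σ 1)) (hu (σ 2)) (n := 1) one_pos
    (by rw [h12]; norm_num)
  obtain ⟨p1, hp1, e1, he1, hpe1⟩ := exists_vertex (hu (σ 0)) (hu (σ 2)) hs0
    (by rw [h02, hs]; norm_num)
  obtain ⟨p2, hp2, e2, he2, hpe2⟩ := exists_vertex (hu (σ 0)) (hu (σ 1)) hS0
    (by rw [h01, hS]; ring)
  have hsm : ∀ (a b : ℝ) (v w : Fin 3 → ℝ), lform (a • v) (b • w) = a * b * lform v w := by
    intro a b v w; simp [lform]; ring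
  have habs : ∀ {p q : H3} {a : ℝ}, 0 ≤ a → (coshDist p q = a ∨ coshDist p q = -a) →
      coshDist p q = a := by
    intro p q a ha h
    rcases h with h | h
    · exact h
    · have := one_le_coshDist p q
      linarith
  have hsides : HasSides237 ![p0, p1, p2] := by
    refine ⟨habs (div_nonneg hk0.le hs0.le) ?_, habs (by positivity) ?_,
      habs (div_nonneg hk0.le (mul_nonneg (mul_nonneg two_pos.le hs0.le) hS0.le)) ?_⟩
    · change coshDist p0 p1 = _ ∨ coshDist p0 p1 = _
      rw [coshDist_eq_lform hp0 hp1, hpe0, hpe1, hsm, lform_lcross, h12,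
        lform_comm (T (σ 1)) (T (σ 0)), h01, hu]
      rcases he0 with rfl | rfl <;> rcases he1 with rfl | rfl
      · right; field_simp; ring
      · left; field_simp; ring
      · left; field_simp; ring
      · right; field_simp; ring
    · change coshDist p0 p2 = _ ∨ coshDist p0 p2 = _
      rw [coshDist_eq_lform hp0 hp2, hpe0, hpe2, hsm, lform_lcross, hu, lform_comm (T (σ 2)),
        h02, lform_comm (T (σ 1)), h01, lform_comm (T (σ 2)), h12]
      rcases he0 with rfl | rfl <;> rcases he2 with rfl | rfl
      · left; field_simp; ring
      · right; field_simp; ring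
      · right; field_simp; ring
      · left; field_simp; ring
    · change coshDist p1 p2 = _ ∨ coshDist p1 p2 = _
      rw [coshDist_eq_lform hp1 hp2, hpe1, hpe2, hsm, lform_lcross, hu, h01,
        lform_comm (T (σ 2)) (T (σ 0)), h02, lform_comm (T (σ 2)), h12]
      rcases he1 with rfl | rfl <;> rcases he2 with rfl | rfl
      · right; field_simp; ring
      · left; field_simp; ring
      · left; field_simp; ring
      · right; field_simp; ring
  obtain ⟨a0, a1, a2⟩ := hsides.angles
  have hsm' : ∀ (a : ℝ) (v w : Fin 3 → ℝ), lform (a • v) w = a * lform v w := by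
    intro a v w; simp [lform]; ring
  refine ⟨_, σ, hsides.injective, ?_, a0, a1, a2⟩
  intro i j hij
  fin_cases i <;> fin_cases j
  · exact absurd rfl hij
  · exact (hA _).mem_axis hp1 (by
      change lform (pointVec p1) _ = 0
      rw [hpe1, hsm']
      exact mul_eq_zero_of_right _ (lform_lcross_left _ _))
  · exact (hA _).mem_axis hp2 (by
      change lform (pointVec p2) _ = 0
      rw [hpe2, hsm']
      exact mul_eq_zero_of_right _ (lform_lcross_left _ _))
  · exact (hA _).mem_axis hp0 (by
      change lform (pointVec p0) _ = 0
      rw [hpe0, hsm']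
      exact mul_eq_zero_of_right _ (lform_lcross_left _ _))
  · exact absurd rfl hij
  · exact (hA _).mem_axis hp2 (by
      change lform (pointVec p2) _ = 0
      rw [hpe2, hsm']
      exact mul_eq_zero_of_right _ (lform_lcross_right _ _))
  · exact (hA _).mem_axis hp0 (by
      change lform (pointVec p0) _ = 0
      rw [hpe0, hsm']
      exact mul_eq_zero_of_right _ (lform_lcross_right _ _))
  · exact (hA _).mem_axis hp1 (by
      change lform (pointVec p1) _ = 0
      rw [hpe1, hsm']
      exact mul_eq_zero_of_right _ (lform_lcross_right _ _))
  · exact absurd rfl hij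

/-! ### From the triangle to its sides -/

theorem eq_cos_of_arccos_eq {x θ : ℝ} (h : Real.arccos x = θ) (h0 : 0 < θ) (hπ : θ < Real.pi) :
    x = Real.cos θ := by
  have h1 : x < 1 := Real.arccos_pos.mp (h ▸ h0)
  have h2 : -1 < x := by
    by_contra hcon
    rw [Real.arccos_of_le_neg_one (not_lt.mp hcon)] at h
    exact hπ.ne h.symm
  rw [← h, Real.cos_arccos h2.le h1.le]

theorem hasSides237_of_angles {V : Fin 3 → H3} (hV : Function.Injective V)
    (h0 : hangle (V 1) (V 0) (V 2) = Real.pi / 2) (h1 : hangle (V 2) (V 1) (V 0) = Real.pi / 3)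
    (h2 : hangle (V 0) (V 2) (V 1) = Real.pi / 7) : HasSides237 V := by
  have hpi := Real.pi_pos
  have hk := cos_pi_div_seven_bounds
  have hone : ∀ i j, i ≠ j → 1 < coshDist (V i) (V j) := fun i j hij =>
    (one_le_coshDist _ _).lt_of_ne' fun h => hij (hV (eq_of_coshDist_eq_one h))
  have n1 := hone 0 1 (by decide)
  have n2 := hone 0 2 (by decide)
  have n3 := hone 1 2 (by decide)
  rw [hangle_eq] at h0 h1 h2
  have h0 := eq_cos_of_arccos_eq h0 (by linarith) (by linarith)
  have h1 := eq_cos_of_arccos_eq h1 (by linarith) (by linarith)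
  have h2 := eq_cos_of_arccos_eq h2 (by linarith) (by linarith)
  rw [coshDist_comm (V 1) (V 0), coshDist_comm (V 2) (V 0), Real.cos_pi_div_three] at h1
  rw [coshDist_comm (V 2) (V 0), coshDist_comm (V 2) (V 1)] at h2
  rw [Real.cos_pi_div_two] at h0
  unfold HasSides237
  set P := coshDist (V 0) (V 1)
  set Q := coshDist (V 0) (V 2)
  set W := coshDist (V 1) (V 2)
  set k := Real.cos (Real.pi / 7)
  have hP : 0 < P ^ 2 - 1 := by nlinarith
  have hQ : 0 < Q ^ 2 - 1 := by nlinarith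
  have hW : 0 < W ^ 2 - 1 := by nlinarith
  have sP := Real.sqrt_pos.mpr hP
  have sQ := Real.sqrt_pos.mpr hQ
  have sW := Real.sqrt_pos.mpr hW
  have sP2 := Real.sq_sqrt hP.le
  have sQ2 := Real.sq_sqrt hQ.le
  have sW2 := Real.sq_sqrt hW.le
  rw [div_eq_iff (by positivity)] at h0 h1 h2
  have hWPQ : W = P * Q := by linarith
  have e1 : 4 * Q ^ 2 * (P ^ 2 - 1) = P ^ 2 * Q ^ 2 - 1 := by
    have h3 : Q * (P ^ 2 - 1) = 1 / 2 * (√(W ^ 2 - 1) * √(P ^ 2 - 1)) := by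
      rw [← h1, hWPQ]; ring
    have h4 : Q ^ 2 * (P ^ 2 - 1) ^ 2 = 1 / 4 * ((W ^ 2 - 1) * (P ^ 2 - 1)) := by
      rw [← mul_pow, h3, mul_pow, mul_pow, sW2, sP2]; norm_num
    have h5 : Q ^ 2 * (P ^ 2 - 1) = 1 / 4 * (W ^ 2 - 1) := by
      apply mul_right_cancel₀ hP.ne'
      linear_combination h4
    rw [hWPQ] at h5
    linear_combination 4 * h5
  have e2 : P ^ 2 * (Q ^ 2 - 1) = k ^ 2 * (P ^ 2 * Q ^ 2 - 1) := by
    have h3 : P * (Q ^ 2 - 1) = k * (√(Q ^ 2 - 1) * √(W ^ 2 - 1)) := by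
      rw [← h2, hWPQ]; ring
    have h4 : P ^ 2 * (Q ^ 2 - 1) ^ 2 = k ^ 2 * ((Q ^ 2 - 1) * (W ^ 2 - 1)) := by
      rw [← mul_pow, h3, mul_pow, mul_pow, sW2, sQ2]
    have h5 : P ^ 2 * (Q ^ 2 - 1) = k ^ 2 * (W ^ 2 - 1) := by
      apply mul_right_cancel₀ hQ.ne'
      linear_combination h4
    rw [hWPQ] at h5
    linear_combination h5
  have e3 : 4 * Q ^ 2 * (1 - k ^ 2) = 1 := by
    have : (Q ^ 2 - 1) * (4 * Q ^ 2 * (1 - k ^ 2) - 1) = 0 := by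
      linear_combination (3 * Q ^ 2) * e2 - (Q ^ 2 - 1 - k ^ 2 * Q ^ 2) * e1
    linarith [(mul_eq_zero.mp this).resolve_left hQ.ne']
  have e4 : 3 * P ^ 2 = 4 * k ^ 2 := by
    have hQ0 : Q ^ 2 ≠ 0 := by positivity
    apply mul_left_cancel₀ hQ0
    linear_combination e1 + e3
  have hs : (√3 / 2) ^ 2 = 3 / 4 := by rw [div_pow, Real.sq_sqrt (by norm_num)]; norm_num
  have hs0 : 0 < √3 / 2 := by positivity
  have hS : √(1 - k ^ 2) ^ 2 = 1 - k ^ 2 := Real.sq_sqrt (by nlinarith)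
  have hS0 : 0 < √(1 - k ^ 2) := Real.sqrt_pos.mpr (by nlinarith)
  set S := √(1 - k ^ 2)
  set s := √3 / 2
  have f1 : P = k / s := by
    rw [eq_div_iff hs0.ne']
    have : (P * s) ^ 2 = k ^ 2 := by rw [mul_pow, hs]; linarith
    exact (pow_left_inj₀ (by positivity) (by linarith) two_ne_zero).mp this
  have f2 : Q = 1 / (2 * S) := by
    rw [eq_div_iff (by positivity)]
    have : (Q * (2 * S)) ^ 2 = 1 ^ 2 := by rw [mul_pow, mul_pow, hS]; linarith
    exact (pow_left_inj₀ (by positivity) (by norm_num) two_ne_zero).mp this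
  refine ⟨f1, f2, ?_⟩
  rw [hWPQ, f1, f2]
  field_simp

/-! ### Congruent triangles are conjugate -/

theorem exists_smul_eq_base (p : H3) : ∃ A : SL(2, ℂ), A • p = ⟨0, 1, one_pos⟩ := by
  have ht := p.t_pos
  have hs : (√p.t : ℂ) ≠ 0 := by exact_mod_cast (Real.sqrt_pos.mpr ht).ne'
  obtain ⟨A, h1, h2, h3, h4⟩ := exists_SL (a := 1 / (√p.t : ℂ)) (b := -p.z / (√p.t : ℂ)) (c := 0)
    (d := (√p.t : ℂ)) (by field_simp; ring)
  have hd : den A p = p.t := by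
    rw [den, h3, h4]
    simp [abs_of_nonneg (Real.sqrt_nonneg p.t), Real.sq_sqrt ht.le]
  refine ⟨A, H3.ext ?_ ?_⟩
  · rw [smul_z, num, h1, h2, h3, h4]
    simp only [map_zero]
    field_simp
    ring
  · rw [smul_t, hd, div_self ht.ne']

theorem exists_smul_vertical (q : H3) : ∃ A : SL(2, ℂ),
    A • (⟨0, 1, one_pos⟩ : H3) = ⟨0, 1, one_pos⟩ ∧ (A • q).z = 0 := by
  by_cases hz : q.z = 0
  · exact ⟨1, one_smul _ _, by rw [one_smul, hz]⟩
  have hn : 0 < ‖q.z‖ := norm_pos_iff.mpr hz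
  obtain ⟨x, hx⟩ : ∃ x : ℝ, ‖q.z‖ ^ 2 * (x * x) + -(1 - ‖q.z‖ ^ 2 - q.t ^ 2) * x + -1 = 0 :=
    exists_quadratic_eq_zero (by positivity)
      ⟨√(discrim (‖q.z‖ ^ 2) (-(1 - ‖q.z‖ ^ 2 - q.t ^ 2)) (-1)), by
        rw [Real.mul_self_sqrt]
        unfold discrim
        nlinarith [sq_nonneg (1 - ‖q.z‖ ^ 2 - q.t ^ 2)]⟩
  set R := √(1 + x ^ 2 * ‖q.z‖ ^ 2) with hR
  have hR2 : R ^ 2 = 1 + x ^ 2 * ‖q.z‖ ^ 2 := Real.sq_sqrt (by positivity)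
  have hR0 : R ≠ 0 := (Real.sqrt_pos.mpr (by positivity)).ne'
  have hRC : (R : ℂ) ≠ 0 := by exact_mod_cast hR0
  have hzz : q.z * conj q.z = ((‖q.z‖ ^ 2 : ℝ) : ℂ) := by rw [Complex.mul_conj']; push_cast; rfl
  have hR2C : (R : ℂ) ^ 2 = 1 + x ^ 2 * (q.z * conj q.z) := by
    rw [hzz]; exact_mod_cast hR2
  obtain ⟨A, h1, h2, h3, h4⟩ := exists_SL (a := 1 / (R : ℂ)) (b := x * q.z / (R : ℂ))
    (c := -(x * conj q.z / R)) (d := 1 / (R : ℂ)) (by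
      field_simp
      linear_combination -hR2C)
  refine ⟨A, H3.ext ?_ ?_, ?_⟩
  · rw [smul_z, num, h1, h2, h3, h4]
    simp
    ring_nf
    simp
  · have : den A ⟨0, 1, one_pos⟩ = 1 := by
      rw [den, h3, h4]
      simp only [mul_zero, zero_add, norm_neg, norm_div, norm_mul, Complex.norm_conj, norm_one,
        Complex.norm_real, Real.norm_eq_abs, div_pow, mul_pow, sq_abs, one_pow]
      field_simp
      linarith
    rw [smul_t, this, div_one]
  · rw [smul_z, num, h1, h2, h3, h4, div_eq_zero_iff]
    left
    simp only [map_add, map_mul, map_neg, map_div₀, Complex.conj_ofReal, Complex.conj_conj, map_one]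
    have hxC : (q.z * conj q.z) * (x * x) + -(1 - (q.z * conj q.z) - (q.t : ℂ) ^ 2) * x + -1
        = 0 := by rw [hzz]; exact_mod_cast hx
    field_simp
    linear_combination (-q.z) * hxC

theorem exists_flip : ∃ A : SL(2, ℂ), ∀ p : H3, p.z = 0 → (A • p).z = 0 ∧ (A • p).t = 1 / p.t := by
  obtain ⟨A, h1, h2, h3, h4⟩ := exists_SL (a := 0) (b := 1) (c := -1) (d := 0) (by norm_num)
  refine ⟨A, fun p hp => ⟨?_, ?_⟩⟩
  · rw [smul_z, num, h1, h2, h3, h4, hp]; simp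
  · have := p.t_pos.ne'
    rw [smul_t, den, h3, h4, hp]
    simp
    field_simp

theorem exists_rotation (r : H3) : ∃ A : SL(2, ℂ),
    (∀ p : H3, p.z = 0 → A • p = p) ∧ (A • r).z.im = 0 ∧ 0 ≤ (A • r).z.re := by
  obtain ⟨u, hu, hur⟩ : ∃ u : ℂ, ‖u‖ = 1 ∧ u ^ 2 * r.z = ‖r.z‖ := by
    refine ⟨Complex.exp ((-(r.z.arg / 2) : ℝ) * Complex.I), Complex.norm_exp_ofReal_mul_I _, ?_⟩
    rw [← Complex.exp_nat_mul]
    nth_rewrite 2 [← Complex.norm_mul_exp_arg_mul_I r.z]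
    rw [mul_left_comm, ← Complex.exp_add]
    have : ((2 : ℕ) : ℂ) * ((-(r.z.arg / 2) : ℝ) * Complex.I) + r.z.arg * Complex.I = 0 := by
      push_cast; ring
    rw [this, Complex.exp_zero, mul_one]
  have huu : u * conj u = 1 := by rw [Complex.mul_conj', hu]; norm_num
  obtain ⟨A, h1, h2, h3, h4⟩ := exists_SL (a := u) (b := 0) (c := 0) (d := conj u)
    (by rw [huu]; ring)
  have hd : ∀ p, den A p = 1 := by intro p; rw [den, h3, h4]; simp [hu]
  have hz : (A • r).z = ‖r.z‖ := by
    rw [smul_z, num, hd, h1, h2, h3, h4, ← hur]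
    simp
    ring
  refine ⟨A, fun p hp => H3.ext ?_ ?_, ?_, ?_⟩
  · rw [smul_z, num, hd, h1, h2, h3, h4, hp]; simp
  · rw [smul_t, hd, div_one]
  · rw [hz, Complex.ofReal_im]
  · rw [hz, Complex.ofReal_re]; exact norm_nonneg _

theorem exists_normal_form (V : Fin 3 → H3) (hV : V 0 ≠ V 1) : ∃ A : SL(2, ℂ),
    (A • V 0).z = 0 ∧ (A • V 0).t = 1 ∧ (A • V 1).z = 0 ∧ 1 < (A • V 1).t ∧
    (A • V 2).z.im = 0 ∧ 0 ≤ (A • V 2).z.re := by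
  obtain ⟨A, hA⟩ := exists_smul_eq_base (V 0)
  obtain ⟨B, hB0, hB1⟩ := exists_smul_vertical (A • V 1)
  obtain ⟨C, hC0, hC0', hC1, hC1'⟩ : ∃ C : SL(2, ℂ), (C • V 0).z = 0 ∧ (C • V 0).t = 1 ∧
      (C • V 1).z = 0 ∧ 1 < (C • V 1).t := by
    have e0 : (B * A) • V 0 = ⟨0, 1, one_pos⟩ := by rw [mul_smul, hA, hB0]
    have e1 : ((B * A) • V 1).z = 0 := by rw [mul_smul, hB1]
    rcases lt_trichotomy ((B * A) • V 1).t 1 with h | h | h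
    · obtain ⟨F, hF⟩ := exists_flip
      refine ⟨F * (B * A), ?_, ?_, ?_, ?_⟩
      · rw [mul_smul]; exact (hF _ (by rw [e0])).1
      · rw [mul_smul, (hF _ (by rw [e0])).2, e0]; norm_num
      · rw [mul_smul]; exact (hF _ e1).1
      · rw [mul_smul, (hF _ e1).2]; exact one_lt_one_div ((B * A) • V 1).t_pos h
    · refine absurd ?_ hV
      apply MulAction.injective (B * A)
      change (B * A) • V 0 = (B * A) • V 1
      rw [e0]
      exact H3.ext e1.symm h.symm
    · exact ⟨B * A, by rw [e0], by rw [e0], e1, h⟩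
  obtain ⟨D, hD, hD2, hD2'⟩ := exists_rotation (C • V 2)
  refine ⟨D * C, ?_, ?_, ?_, ?_, ?_, ?_⟩ <;> rw [mul_smul]
  · rw [hD _ hC0, hC0]
  · rw [hD _ hC0, hC0']
  · rw [hD _ hC1, hC1]
  · rwa [hD _ hC1]
  · exact hD2
  · exact hD2'

theorem normal_form_unique {U W : Fin 3 → H3}
    (hU0 : (U 0).z = 0) (hU0' : (U 0).t = 1) (hU1 : (U 1).z = 0) (hU1' : 1 < (U 1).t)
    (hU2 : (U 2).z.im = 0) (hU2' : 0 ≤ (U 2).z.re)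
    (hW0 : (W 0).z = 0) (hW0' : (W 0).t = 1) (hW1 : (W 1).z = 0) (hW1' : 1 < (W 1).t)
    (hW2 : (W 2).z.im = 0) (hW2' : 0 ≤ (W 2).z.re)
    (h01 : coshDist (U 0) (U 1) = coshDist (W 0) (W 1))
    (h02 : coshDist (U 0) (U 2) = coshDist (W 0) (W 2))
    (h12 : coshDist (U 1) (U 2) = coshDist (W 1) (W 2)) : U = W := by
  have hnorm : ∀ z : ℂ, z.im = 0 → ‖z‖ ^ 2 = z.re ^ 2 := by
    intro z hz; rw [← Complex.normSq_eq_norm_sq, Complex.normSq_apply, hz]; ring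
  have u2 := (U 2).t_pos
  have w2 := (W 2).t_pos
  unfold coshDist at h01 h02 h12
  rw [hU0, hU0', hU1, hW0, hW0', hW1] at h01
  rw [hU0, hU0', hW0, hW0', zero_sub, zero_sub, norm_neg, norm_neg, hnorm _ hU2, hnorm _ hW2] at h02
  rw [hU1, hW1, zero_sub, zero_sub, norm_neg, norm_neg, hnorm _ hU2, hnorm _ hW2] at h12
  have hτ : (U 1).t = (W 1).t := by
    simp only [sub_self, norm_zero] at h01
    field_simp at h01
    have : ((U 1).t - (W 1).t) * ((U 1).t * (W 1).t - 1) = 0 := by linear_combination h01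
    rcases mul_eq_zero.mp this with h | h
    · linarith
    · nlinarith
  rw [hτ] at h12
  set τ := (W 1).t
  field_simp at h02 h12
  have hs : (U 2).t = (W 2).t := by
    have : (τ ^ 2 - 1) * ((U 2).t - (W 2).t) = 0 := by linear_combination h02 - h12
    rcases mul_eq_zero.mp this with h | h
    · nlinarith
    · linarith
  rw [hs] at h02
  have hx : (U 2).z.re = (W 2).z.re := by
    apply (pow_left_inj₀ hU2' hW2' two_ne_zero).mp
    apply mul_right_cancel₀ w2.ne'
    linear_combination h02
  funext i
  fin_cases i
  · exact H3.ext (hU0.trans hW0.symm) (hU0'.trans hW0'.symm)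
  · exact H3.ext (hU1.trans hW1.symm) hτ
  · exact H3.ext (Complex.ext hx (hU2.trans hW2.symm)) hs

theorem exists_smul_eq_of_coshDist {V W : Fin 3 → H3} (hV : V 0 ≠ V 1) (hW : W 0 ≠ W 1)
    (h01 : coshDist (V 0) (V 1) = coshDist (W 0) (W 1))
    (h02 : coshDist (V 0) (V 2) = coshDist (W 0) (W 2))
    (h12 : coshDist (V 1) (V 2) = coshDist (W 1) (W 2)) :
    ∃ g : PSL(2, ℂ), ∀ i, g • V i = W i := by
  obtain ⟨A, a1, a2, a3, a4, a5, a6⟩ := exists_normal_form V hV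
  obtain ⟨B, b1, b2, b3, b4, b5, b6⟩ := exists_normal_form W hW
  have h := normal_form_unique (U := fun i => A • V i) (W := fun i => B • W i)
    a1 a2 a3 a4 a5 a6 b1 b2 b3 b4 b5 b6 (by simpa only [coshDist_smul] using h01)
    (by simpa only [coshDist_smul] using h02) (by simpa only [coshDist_smul] using h12)
  refine ⟨QuotientGroup.mk (B⁻¹ * A), fun i => ?_⟩
  rw [mk_smul, mul_smul, congrFun h i, inv_smul_smul]

theorem det_herm (p : H3) : (herm p).det = 1 := by
  have ht : (p.t : ℂ) ≠ 0 := by exact_mod_cast p.t_pos.ne'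
  rw [Matrix.det_fin_two]
  simp [herm]
  field_simp
  ring

theorem eq_of_herm_eq_smul {p q : H3} {c : ℂ} (h : herm q = c • herm p) : p = q := by
  have hp := p.t_pos
  have hq := q.t_pos
  have e11 : (1 : ℂ) / q.t = c * (1 / p.t) := by simpa [herm] using congrFun (congrFun h 1) 1
  have e01 : q.z / q.t = c * (p.z / p.t) := by simpa [herm] using congrFun (congrFun h 0) 1
  have hpC : (p.t : ℂ) ≠ 0 := by exact_mod_cast hp.ne'
  have hqC : (q.t : ℂ) ≠ 0 := by exact_mod_cast hq.ne'
  have hd := det_herm q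
  rw [h, Matrix.det_smul, det_herm] at hd
  have hc : c = ((p.t / q.t : ℝ) : ℂ) := by
    field_simp at e11
    push_cast
    rw [eq_div_iff hqC]
    linear_combination -e11
  have hc2 : (p.t / q.t) ^ 2 = 1 := by
    rw [hc] at hd
    have : (((p.t / q.t) ^ 2 : ℝ) : ℂ) = 1 := by simpa using hd
    exact_mod_cast this
  have hc1 : p.t / q.t = 1 := by
    have : 0 < p.t / q.t := by positivity
    nlinarith
  have ht : p.t = q.t := by rwa [div_eq_one_iff_eq hq.ne'] at hc1
  refine H3.ext ?_ ht
  rw [hc, hc1, ht] at e01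
  field_simp at e01
  simpa using e01.symm

theorem commute_herm {A : SL(2, ℂ)} {p q : H3} (hp : A • p = p) (hq : A • q = q) :
    Commute (A : Matrix (Fin 2) (Fin 2) ℂ) (herm q * (herm p).adjugate) := by
  have h1 := herm_smul A p
  have h2 := herm_smul A q
  rw [hp] at h1
  rw [hq] at h2
  set M := (A : Matrix (Fin 2) (Fin 2) ℂ)
  have e1 : herm p * (herm p).adjugate = 1 := by rw [Matrix.mul_adjugate, det_herm, one_smul]
  have e2 : (herm p).adjugate * herm p = 1 := by rw [Matrix.adjugate_mul, det_herm, one_smul]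
  have e3 : M.conjTranspose * (herm p).adjugate * M = (herm p).adjugate := by
    have hd : M.det = 1 := A.det_coe
    have : herm p * M.conjTranspose⁻¹ = M * herm p := by
      conv_lhs => rw [h1]
      rw [Matrix.mul_assoc, Matrix.mul_nonsing_inv _ (by
        rw [Matrix.det_conjTranspose, hd]; simp), Matrix.mul_one]
    have h4 : M.conjTranspose⁻¹ = (herm p).adjugate * M * herm p := by
      rw [Matrix.mul_assoc, ← this, ← Matrix.mul_assoc, e2, Matrix.one_mul]
    have h5 : M.conjTranspose * ((herm p).adjugate * M * herm p) = 1 := by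
      rw [← h4, Matrix.mul_nonsing_inv _ (by rw [Matrix.det_conjTranspose, hd]; simp)]
    calc M.conjTranspose * (herm p).adjugate * M
        = M.conjTranspose * ((herm p).adjugate * M * herm p) * (herm p).adjugate := by
          simp only [Matrix.mul_assoc, e1, Matrix.mul_one]
      _ = _ := by rw [h5, Matrix.one_mul]
  change M * (herm q * (herm p).adjugate) = herm q * (herm p).adjugate * M
  conv_rhs => rw [h2]
  rw [← Matrix.mul_assoc, Matrix.mul_assoc _ _ M, Matrix.mul_assoc _ M.conjTranspose,
    ← Matrix.mul_assoc M.conjTranspose, e3]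

theorem mk_eq_mk_of_fixes {A B : SL(2, ℂ)} (hA : A 1 1 = -A 0 0) (hB : B 1 1 = -B 0 0) {p q : H3}
    (hpq : p ≠ q) (hAp : A • p = p) (hAq : A • q = q) (hBp : B • p = p) (hBq : B • q = q) :
    (QuotientGroup.mk A : PSL(2, ℂ)) = QuotientGroup.mk B := by
  have hcA := commute_herm hAp hAq
  have hcB := commute_herm hBp hBq
  have hdA := A.det_coe
  have hdB := B.det_coe
  rw [Matrix.det_fin_two, hA] at hdA
  rw [Matrix.det_fin_two, hB] at hdB
  set N := herm q * (herm p).adjugate with hN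
  have hns : ¬ (N 0 1 = 0 ∧ N 1 0 = 0 ∧ N 0 0 = N 1 1) := by
    rintro ⟨n1, n2, n3⟩
    apply hpq
    apply eq_of_herm_eq_smul (c := N 1 1)
    have : herm q = N * herm p := by
      rw [hN, Matrix.mul_assoc, Matrix.adjugate_mul, det_herm, one_smul, Matrix.mul_one]
    have hN' : N = N 1 1 • (1 : Matrix (Fin 2) (Fin 2) ℂ) := by
      ext i j
      fin_cases i <;> fin_cases j <;> simp [n1, n2, n3]
    rw [this]
    conv_lhs => rw [hN']
    rw [Matrix.smul_mul, Matrix.one_mul]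
  set N₀ := N - ((N 0 0 + N 1 1) / 2) • (1 : Matrix (Fin 2) (Fin 2) ℂ) with hN₀
  have hcomm : (A : Matrix (Fin 2) (Fin 2) ℂ) * B = B * A := by
    refine commute_of_commute_traceless (N := N₀) ?_ ?_ ?_ ?_
    · intro h
      have e00 := congrFun (congrFun h 0) 0
      have e01 := congrFun (congrFun h 0) 1
      have e10 := congrFun (congrFun h 1) 0
      simp [hN₀] at e00 e01 e10
      exact hns ⟨e01, e10, by linear_combination 2 * e00⟩
    · simp [hN₀]; ring
    · rw [hN₀, Matrix.mul_sub, Matrix.sub_mul, hcA.eq]; simp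
    · rw [hN₀, Matrix.mul_sub, Matrix.sub_mul, hcB.eq]; simp
  have e00 := congrFun (congrFun hcomm 0) 0
  have e01 := congrFun (congrFun hcomm 0) 1
  have e10 := congrFun (congrFun hcomm 1) 0
  simp only [Matrix.mul_apply, Fin.sum_univ_two, hA, hB] at e00 e01 e10
  have hl : ∀ i j, A i j = -(A 0 0 * B 0 0 + A 0 1 * B 1 0) * B i j := by
    intro i j
    fin_cases i <;> fin_cases j <;> simp only [Fin.zero_eta, Fin.mk_one, hA, hB]
    · linear_combination (-A 0 0) * hdB - (B 1 0 / 2) * e01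
    · linear_combination (-A 0 1) * hdB + (B 0 0 / 2) * e01
    · linear_combination (-A 1 0) * hdB - (B 0 0 / 2) * e10 + B 1 0 * e00
    · linear_combination (A 0 0) * hdB + (B 1 0 / 2) * e01
  set l := -(A 0 0 * B 0 0 + A 0 1 * B 1 0)
  have hl2 : l ^ 2 = 1 := by
    rw [hl 0 0, hl 0 1, hl 1 0] at hdA
    linear_combination hdA - l ^ 2 * hdB
  rw [mk_eq_mk_iff]
  rcases (by simpa using hl2 : l = 1 ∨ l = -1) with h | h
  · left; ext i j; rw [hl, h, one_mul]
  · right; ext i j; rw [hl, h]; simp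

theorem eq_of_mem_axis {f g : PSL(2, ℂ)} (hf : orderOf f = 2) (hg : orderOf g = 2) {p q : H3}
    (hpq : p ≠ q) (hfp : p ∈ axis f) (hfq : q ∈ axis f) (hgp : p ∈ axis g) (hgq : q ∈ axis g) :
    f = g := by
  obtain ⟨A, rfl⟩ := QuotientGroup.mk_surjective f
  obtain ⟨B, rfl⟩ := QuotientGroup.mk_surjective g
  exact mk_eq_mk_of_fixes (orderOf_mk_eq_two_iff.mp hf) (orderOf_mk_eq_two_iff.mp hg) hpq
    hfp hfq hgp hgq

theorem AxesBound237Triangle.exists_conj {f g : Fin 3 → PSL(2, ℂ)}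
    (hf : ∀ i, orderOf (f i) = 2) (hg : ∀ i, orderOf (g i) = 2)
    (hf' : AxesBound237Triangle f) (hg' : AxesBound237Triangle g) :
    ∃ (h : PSL(2, ℂ)) (σ : Equiv.Perm (Fin 3)), ∀ i, g i = h * f (σ i) * h⁻¹ := by
  obtain ⟨V, σ, hV, hVf, a0, a1, a2⟩ := hf'
  obtain ⟨W, τ, hW, hWg, b0, b1, b2⟩ := hg'
  obtain ⟨s01, s02, s12⟩ := hasSides237_of_angles hV a0 a1 a2
  obtain ⟨t01, t02, t12⟩ := hasSides237_of_angles hW b0 b1 b2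
  obtain ⟨h, hh⟩ := exists_smul_eq_of_coshDist (hV.ne (by decide)) (hW.ne (by decide))
    (s01.trans t01.symm) (s02.trans t02.symm) (s12.trans t12.symm)
  refine ⟨h, τ.symm.trans σ, fun i => ?_⟩
  obtain ⟨i, rfl⟩ := τ.surjective i
  have hex : ∃ j k : Fin 3, i ≠ j ∧ i ≠ k ∧ j ≠ k := by decide +revert
  obtain ⟨j, k, hij, hik, hjk⟩ := hex
  have hfix : ∀ j, i ≠ j → W j ∈ axis (h * f (σ i) * h⁻¹) := by
    intro j hij
    have := hVf i j hij
    rw [mem_axis_iff] at this ⊢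
    rw [← hh j, mul_smul, inv_smul_smul, mul_smul, this]
  have hord : orderOf (h * f (σ i) * h⁻¹) = 2 :=
    (orderOf_injective (MulAut.conj h).toMonoidHom (MulAut.conj h).injective (f (σ i))).trans
      (hf (σ i))
  simpa using eq_of_mem_axis (hg (τ i)) hord (hW.ne hjk) (hWg i j hij) (hWg i k hik) (hfix j hij)
    (hfix k hik)

/-! ### The `(2,3,7)` triangle group -/

/-- Unit normals to the sides of a `(2,3,7)` triangle. -/
noncomputable def modelVec : Fin 3 → Fin 3 → ℝ :=
  ![![1, 0, 0], ![0, 1, 0],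
    ![-1 / 2, -Real.cos (Real.pi / 7), √(Real.cos (Real.pi / 7) ^ 2 - 3 / 4)]]

theorem eta_sq : √(Real.cos (Real.pi / 7) ^ 2 - 3 / 4) ^ 2 = Real.cos (Real.pi / 7) ^ 2 - 3 / 4 :=
  Real.sq_sqrt (by nlinarith [cos_pi_div_seven_bounds.1])

theorem eta_bounds : 0.2 < √(Real.cos (Real.pi / 7) ^ 2 - 3 / 4) ∧
    √(Real.cos (Real.pi / 7) ^ 2 - 3 / 4) < 1 := by
  have hk := cos_pi_div_seven_bounds
  constructor
  · apply Real.lt_sqrt_of_sq_lt; nlinarith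
  · rw [Real.sqrt_lt' one_pos]; nlinarith

theorem lform_modelVec (i : Fin 3) : lform (modelVec i) (modelVec i) = 1 := by
  have h := eta_sq
  fin_cases i
  · simp [lform, modelVec]
  · simp [lform, modelVec]
  · simp only [lform, modelVec, Fin.reduceFinMk, Matrix.cons_val]
    linear_combination -h

theorem is237_modelVec : Is237 modelVec := by
  refine ⟨Equiv.swap 0 2, ?_, ?_, ?_⟩
  · simp [lform, modelVec, Equiv.swap_apply_of_ne_of_ne]
  · simp [lform, modelVec]; norm_num
  · simp [lform, modelVec, Equiv.swap_apply_of_ne_of_ne]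

/-- Linear combinations of the normals. -/
noncomputable def modelCombo (r : Fin 3 → ℝ) : Fin 3 → ℝ :=
  ![r 0 - r 2 / 2, r 1 - Real.cos (Real.pi / 7) * r 2,
    √(Real.cos (Real.pi / 7) ^ 2 - 3 / 4) * r 2]

/-- The half-turn about the `j`-th side, on coordinate vectors, as a function of `c = 2 cos(π/7)`
or one of its conjugates. -/
def turnCoord (c : ℝ) (j : Fin 3) (v : Fin 3 → ℝ) : Fin 3 → ℝ :=
  ![![v 0 - v 2, -v 1, -v 2], ![-v 0, v 1 - c * v 2, -v 2], ![-v 0, -v 1, v 2 - v 0 - c * v 1]] j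

/-- The quadratic form in coordinates. -/
noncomputable def coordForm (c : ℝ) (v : Fin 3 → ℝ) : ℝ :=
  v 0 ^ 2 + v 1 ^ 2 + v 2 ^ 2 - v 0 * v 2 - c * v 1 * v 2

theorem coordForm_turnCoord (c : ℝ) (j : Fin 3) (v : Fin 3 → ℝ) :
    coordForm c (turnCoord c j v) = coordForm c v := by
  fin_cases j <;> simp [coordForm, turnCoord] <;> ring

theorem modelCombo_turnCoord (j : Fin 3) (v : Fin 3 → ℝ) :
    modelCombo (turnCoord (2 * Real.cos (Real.pi / 7)) j v) =
      -modelCombo v + (2 * lform (modelVec j) (modelCombo v)) • modelVec j := by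
  have h := eta_sq
  set η := √(Real.cos (Real.pi / 7) ^ 2 - 3 / 4) with hη
  ext i
  fin_cases j <;> fin_cases i <;>
    simp only [modelCombo, turnCoord, lform, modelVec, Fin.zero_eta, Fin.mk_one, Fin.reduceFinMk,
      Matrix.cons_val, Matrix.cons_val_zero, Matrix.cons_val_one, Pi.add_apply, Pi.neg_apply,
      Pi.smul_apply, smul_eq_mul, ← hη]
  · ring
  · ring
  · ring
  · ring
  · ring
  · ring
  · linear_combination (-v 2) * h
  · linear_combination (-2 * Real.cos (Real.pi / 7) * v 2) * h
  · linear_combination (2 * η * v 2) * h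

theorem realMat_comm_turn {v : Fin 3 → ℝ} (hv : lform v v = 1) (w : Fin 3 → ℝ) :
    realMat v * realMat w = realMat (-w + (2 * lform v w) • v) * realMat v := by
  have h1 := realMat_anticomm v w
  have h2 : realMat v * realMat v = 1 := by
    have h := realMat_anticomm v v
    rw [hv, ← two_smul ℂ, Complex.ofReal_one, mul_one] at h
    exact smul_right_injective _ (two_ne_zero (α := ℂ)) h
  have h3 : realMat (-w + (2 * lform v w) • v) = -realMat w + (2 * lform v w : ℂ) • realMat v := by
    ext i j; fin_cases i <;> fin_cases j <;> simp [realMat] <;> ring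
  rw [h3, add_mul, smul_mul_assoc, h2, ← h1]
  simp

/-- `c` lists `2 cos(π/7)` and its two conjugates. -/
structure IsConjTriple (c : Fin 3 → ℝ) : Prop where
  zero : c 0 = 2 * Real.cos (Real.pi / 7)
  root : ∀ j, c j ^ 3 = c j ^ 2 + 2 * c j - 1
  one_gt : 0.4 < c 1
  one_lt : c 1 < 0.5
  two_gt : -1.3 < c 2
  two_lt : c 2 < -1.2

theorem exists_isConjTriple : ∃ c, IsConjTriple c := by
  have hcont : Continuous fun x : ℝ => x ^ 3 - x ^ 2 - 2 * x + 1 := by fun_prop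
  obtain ⟨a, ha, ha'⟩ := intermediate_value_Ioo' (a := (0.4 : ℝ)) (b := 0.5) (by norm_num)
    hcont.continuousOn (show (0 : ℝ) ∈ Set.Ioo _ _ by constructor <;> norm_num)
  obtain ⟨b, hb, hb'⟩ := intermediate_value_Ioo (a := (-1.3 : ℝ)) (b := -1.2) (by norm_num)
    hcont.continuousOn (show (0 : ℝ) ∈ Set.Ioo _ _ by constructor <;> norm_num)
  refine ⟨![2 * Real.cos (Real.pi / 7), a, b], rfl, fun j => ?_, ha.1, ha.2, hb.1, hb.2⟩
  fin_cases j
  · change (2 * Real.cos (Real.pi / 7)) ^ 3 = (2 * Real.cos (Real.pi / 7)) ^ 2 +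
      2 * (2 * Real.cos (Real.pi / 7)) - 1
    linear_combination cos_pi_div_seven_cubic
  · change a ^ 3 = a ^ 2 + 2 * a - 1
    simp only at ha'
    linear_combination ha'
  · change b ^ 3 = b ^ 2 + 2 * b - 1
    simp only at hb'
    linear_combination hb'

/-- The images of the algebraic integers `x + y c + z c²` under the three embeddings. -/
def conjInt (c : Fin 3 → ℝ) : Set (Fin 3 → ℝ) :=
  {a | ∃ x y z : ℤ, ∀ j, a j = x + y * c j + z * c j ^ 2}

theorem conjInt_sub {c a b : Fin 3 → ℝ} (ha : a ∈ conjInt c) (hb : b ∈ conjInt c) :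
    (fun j => a j - b j) ∈ conjInt c := by
  obtain ⟨x, y, z, h⟩ := ha
  obtain ⟨x', y', z', h'⟩ := hb
  exact ⟨x - x', y - y', z - z', fun j => by
    change a j - b j = _
    rw [h, h']; push_cast; ring⟩

theorem conjInt_neg {c a : Fin 3 → ℝ} (ha : a ∈ conjInt c) : (fun j => -a j) ∈ conjInt c := by
  obtain ⟨x, y, z, h⟩ := ha
  exact ⟨-x, -y, -z, fun j => by
    change -a j = _
    rw [h]; push_cast; ring⟩

theorem conjInt_mul_root {c a : Fin 3 → ℝ} (hc : IsConjTriple c) (ha : a ∈ conjInt c) :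
    (fun j => c j * a j) ∈ conjInt c := by
  obtain ⟨x, y, z, h⟩ := ha
  refine ⟨-z, x + 2 * z, y + z, fun j => ?_⟩
  change c j * a j = _
  rw [h]
  push_cast
  linear_combination (z : ℝ) * hc.root j

theorem abs_le_of_one_le_mul {p q B : ℝ} (hp : 1 ≤ p) (h : |q * p| ≤ B) : |q| ≤ B := by
  rw [abs_mul, abs_of_pos (zero_lt_one.trans_le hp)] at h
  exact (le_mul_of_one_le_right (abs_nonneg q) hp).trans h

theorem abs_mul_le_of_abs_le_one {p q B : ℝ} (hp : |p| ≤ 1) (h : |q| ≤ B) : |q * p| ≤ B := by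
  rw [abs_mul]
  exact (mul_le_of_le_one_right (abs_nonneg q) hp).trans h

theorem IsConjTriple.abs_coeff_le {c : Fin 3 → ℝ} (hc : IsConjTriple c) {x y z R : ℝ}
    (hR : ∀ j, |x + y * c j + z * c j ^ 2| ≤ R) :
    |x| ≤ 100 * R ∧ |y| ≤ 100 * R ∧ |z| ≤ 100 * R := by
  have hk := cos_pi_div_seven_bounds
  have c0 := hc.zero
  have b1 := hc.one_gt
  have b2 := hc.one_lt
  have b3 := hc.two_gt
  have b4 := hc.two_lt
  have r0 := hR 0
  have r1 := hR 1
  have r2 := hR 2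
  have hR0 : 0 ≤ R := (abs_nonneg _).trans r0
  clear hR
  have d01 : |y + z * (c 0 + c 1)| ≤ 2 * R := by
    apply abs_le_of_one_le_mul (p := c 0 - c 1) (by linarith)
    have : (y + z * (c 0 + c 1)) * (c 0 - c 1) =
        (x + y * c 0 + z * c 0 ^ 2) - (x + y * c 1 + z * c 1 ^ 2) := by ring
    rw [this]
    exact (abs_sub _ _).trans (by linarith)
  have d12 : |y + z * (c 1 + c 2)| ≤ 2 * R := by
    apply abs_le_of_one_le_mul (p := c 1 - c 2) (by linarith)
    have : (y + z * (c 1 + c 2)) * (c 1 - c 2) =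
        (x + y * c 1 + z * c 1 ^ 2) - (x + y * c 2 + z * c 2 ^ 2) := by ring
    rw [this]
    exact (abs_sub _ _).trans (by linarith)
  have hz : |z| ≤ 4 * R := by
    apply abs_le_of_one_le_mul (p := c 0 - c 2) (by linarith)
    have : z * (c 0 - c 2) = (y + z * (c 0 + c 1)) - (y + z * (c 1 + c 2)) := by ring
    rw [this]
    exact (abs_sub _ _).trans (by linarith)
  have hz1 : |z * (c 1 + c 2)| ≤ 4 * R :=
    abs_mul_le_of_abs_le_one (by rw [abs_le]; constructor <;> linarith) hz
  have hy : |y| ≤ 6 * R := by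
    have : y = (y + z * (c 1 + c 2)) - z * (c 1 + c 2) := by ring
    rw [this]
    exact (abs_sub _ _).trans (by linarith)
  have hy1 : |y * c 1| ≤ 6 * R :=
    abs_mul_le_of_abs_le_one (by rw [abs_le]; constructor <;> linarith) hy
  have hz2 : |z * c 1 ^ 2| ≤ 4 * R :=
    abs_mul_le_of_abs_le_one (by rw [abs_le]; constructor <;> nlinarith) hz
  have hx : |x| ≤ 11 * R := by
    have : x = (x + y * c 1 + z * c 1 ^ 2) - (y * c 1 + z * c 1 ^ 2) := by ring
    rw [this]
    exact (abs_sub _ _).trans (by linarith [abs_add_le (y * c 1) (z * c 1 ^ 2)])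
  exact ⟨by linarith, by linarith, by linarith⟩

theorem finite_conjInt {c : Fin 3 → ℝ} (hc : IsConjTriple c) (R : ℝ) :
    {a ∈ conjInt c | ∀ j, |a j| ≤ R}.Finite := by
  set N : ℤ := ⌈100 * R⌉
  have hN : 100 * R ≤ N := Int.le_ceil _
  refine ((Set.finite_Icc (fun _ : Fin 3 => -N) (fun _ => N)).image
    fun (n : Fin 3 → ℤ) (j : Fin 3) => (n 0 : ℝ) + n 1 * c j + n 2 * c j ^ 2).subset ?_
  rintro a ⟨⟨x, y, z, h⟩, hR⟩
  refine ⟨![x, y, z], ?_, funext fun j => (h j).symm⟩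
  obtain ⟨hx, hy, hz⟩ := hc.abs_coeff_le (x := x) (y := y) (z := z) (R := R)
    fun j => (h j) ▸ hR j
  have cast : ∀ n : ℤ, |(n : ℝ)| ≤ 100 * R → -N ≤ n ∧ n ≤ N := by
    intro n hn
    rw [← abs_le]
    exact_mod_cast hn.trans hN
  have X := cast x hx
  have Y := cast y hy
  have Z := cast z hz
  constructor <;> intro i <;> fin_cases i
  exacts [X.1, Y.1, Z.1, X.2, Y.2, Z.2]

/-- Elements that map the normals to integral combinations of the normals, for which the
conjugate combinations are unit vectors of the conjugate forms. -/
def IsIntegral237 (c : Fin 3 → ℝ) (A : SL(2, ℂ)) : Prop :=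
  ∀ i, ∃ r : Fin 3 → Fin 3 → ℝ, (∀ l, (fun j => r j l) ∈ conjInt c) ∧
    (∀ j, coordForm (c j) (r j) = 1) ∧
    (A : Matrix (Fin 2) (Fin 2) ℂ) * realMat (modelVec i) = realMat (modelCombo (r 0)) * A

theorem isIntegral237_one (c : Fin 3 → ℝ) : IsIntegral237 c 1 := by
  intro i
  refine ⟨fun _ => Pi.single i 1, fun l => ⟨if l = i then 1 else 0, 0, 0, fun j => ?_⟩, fun j => ?_,
    ?_⟩
  · by_cases h : l = i
    · subst h; simp
    · simp [h]
  · fin_cases i <;> simp [coordForm]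
  · have : modelCombo (Pi.single i 1) = modelVec i := by
      ext j
      fin_cases i <;> fin_cases j <;> simp [modelCombo, modelVec]; norm_num
    rw [this]; simp

theorem IsIntegral237.mul {c : Fin 3 → ℝ} (hc : IsConjTriple c) {A B : SL(2, ℂ)}
    (hA : IsIntegral237 c A) {k : Fin 3} (hB : IsHalfTurn B (modelVec k)) :
    IsIntegral237 c (B * A) := by
  intro i
  obtain ⟨r, hr, hu, h⟩ := hA i
  refine ⟨fun j => turnCoord (c j) k (r j), fun l => ?_, fun j => ?_, ?_⟩
  · have h0 := hr 0
    have h1 := hr 1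
    have h2 := hr 2
    have n0 := conjInt_neg h0
    have n1 := conjInt_neg h1
    have n2 := conjInt_neg h2
    fin_cases k <;> fin_cases l
    exacts [conjInt_sub h0 h2, n1, n2, n0, conjInt_sub h1 (conjInt_mul_root hc h2), n2, n0, n1,
      conjInt_sub (conjInt_sub h2 h0) (conjInt_mul_root hc h1)]
  · rw [coordForm_turnCoord, hu]
  · change _ = realMat (modelCombo (turnCoord (c 0) k (r 0))) * _
    rw [hc.zero, modelCombo_turnCoord, Matrix.SpecialLinearGroup.coe_mul, Matrix.mul_assoc, h,
      ← Matrix.mul_assoc, ← Matrix.mul_assoc, hB, Matrix.smul_mul, realMat_comm_turn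
      (lform_modelVec k), Matrix.mul_smul]

theorem isIntegral237_neg {c : Fin 3 → ℝ} {A : SL(2, ℂ)} (hA : IsIntegral237 c A) :
    IsIntegral237 c (-A) := by
  intro i
  obtain ⟨r, hr, hu, h⟩ := hA i
  exact ⟨r, hr, hu, by rw [Matrix.SpecialLinearGroup.coe_neg, neg_mul, mul_neg, h]⟩

theorem abs_le_of_coordForm {c : ℝ} (hc : c ^ 2 < 2) {v : Fin 3 → ℝ} (h : coordForm c v = 1)
    (l : Fin 3) : |v l| ≤ 10 := by
  have h' : (v 0 - v 2 / 2) ^ 2 + (v 1 - c * v 2 / 2) ^ 2 + v 2 ^ 2 * (3 / 4 - c ^ 2 / 4) = 1 := by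
    rw [← h, coordForm]; ring
  have hv2 : v 2 ^ 2 ≤ 4 := by
    nlinarith [sq_nonneg (v 0 - v 2 / 2), sq_nonneg (v 1 - c * v 2 / 2), sq_nonneg (v 2)]
  have hpos : 0 ≤ v 2 ^ 2 * (3 / 4 - c ^ 2 / 4) := mul_nonneg (sq_nonneg _) (by linarith)
  have h0 := abs_le_of_sq_le_sq' (show (v 0 - v 2 / 2) ^ 2 ≤ 1 ^ 2 by
    nlinarith [sq_nonneg (v 1 - c * v 2 / 2)]) zero_le_one
  have h1 := abs_le_of_sq_le_sq' (show (v 1 - c * v 2 / 2) ^ 2 ≤ 1 ^ 2 by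
    nlinarith [sq_nonneg (v 0 - v 2 / 2)]) zero_le_one
  have h2 := abs_le_of_sq_le_sq' (show v 2 ^ 2 ≤ 2 ^ 2 by linarith) zero_le_two
  have h3 := abs_le_of_sq_le_sq' (show (c * v 2) ^ 2 ≤ 3 ^ 2 by
    rw [mul_pow]; nlinarith [sq_nonneg (v 2), sq_nonneg c]) (by norm_num)
  rw [abs_le]
  fin_cases l
  · change -10 ≤ v 0 ∧ v 0 ≤ 10
    constructor <;> linarith
  · change -10 ≤ v 1 ∧ v 1 ≤ 10
    constructor <;> linarith
  · change -10 ≤ v 2 ∧ v 2 ≤ 10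
    constructor <;> linarith

theorem abs_modelVec_le (i l : Fin 3) : |modelVec i l| ≤ 1 := by
  have hk := cos_pi_div_seven_bounds
  have hη := eta_bounds
  fin_cases i <;> fin_cases l <;> simp [modelVec]
  · norm_num [abs_of_nonneg]
  · rw [abs_le]; constructor <;> linarith
  · rw [abs_of_pos (by linarith)]; exact hη.2.le

theorem norm_realMat_le {v : Fin 3 → ℝ} {B : ℝ} (hv : ∀ l, |v l| ≤ B) (i j : Fin 2) :
    ‖realMat v i j‖ ≤ 2 * B := by
  have h0 := hv 0
  have h1 := hv 1
  have h2 := hv 2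
  have hB : 0 ≤ B := (abs_nonneg _).trans h0
  have e1 : |v 1 + v 2| ≤ 2 * B := (abs_add_le _ _).trans (by linarith)
  have e2 : |v 1 - v 2| ≤ 2 * B := (abs_sub _ _).trans (by linarith)
  fin_cases i <;> fin_cases j
  · change ‖((v 0 : ℝ) : ℂ)‖ ≤ _
    rw [Complex.norm_real, Real.norm_eq_abs]; linarith
  · change ‖((v 1 + v 2 : ℝ) : ℂ)‖ ≤ _
    rwa [Complex.norm_real, Real.norm_eq_abs]
  · change ‖((v 1 - v 2 : ℝ) : ℂ)‖ ≤ _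
    rwa [Complex.norm_real, Real.norm_eq_abs]
  · change ‖-((v 0 : ℝ) : ℂ)‖ ≤ _
    rw [norm_neg, Complex.norm_real, Real.norm_eq_abs]; linarith

theorem abs_le_of_norm_realMat {v : Fin 3 → ℝ} {B : ℝ} (hv : ∀ i j, ‖realMat v i j‖ ≤ B)
    (l : Fin 3) : |v l| ≤ B := by
  have e0 : ‖((v 0 : ℝ) : ℂ)‖ ≤ B := hv 0 0
  have e1 : ‖((v 1 + v 2 : ℝ) : ℂ)‖ ≤ B := hv 0 1
  have e2 : ‖((v 1 - v 2 : ℝ) : ℂ)‖ ≤ B := hv 1 0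
  rw [Complex.norm_real, Real.norm_eq_abs, abs_le] at e0 e1 e2
  rw [abs_le]
  fin_cases l
  · exact e0
  · change -B ≤ v 1 ∧ v 1 ≤ B
    constructor <;> linarith
  · change -B ≤ v 2 ∧ v 2 ≤ B
    constructor <;> linarith

theorem norm_mul_apply_le {M N : Matrix (Fin 2) (Fin 2) ℂ} {a b : ℝ} (hM : ∀ i j, ‖M i j‖ ≤ a)
    (hN : ∀ i j, ‖N i j‖ ≤ b) (i j : Fin 2) : ‖(M * N) i j‖ ≤ 2 * (a * b) := by
  have ha : 0 ≤ a := (norm_nonneg _).trans (hM 0 0)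
  rw [Matrix.mul_apply, Fin.sum_univ_two]
  refine (norm_add_le _ _).trans ?_
  rw [norm_mul, norm_mul, two_mul]
  gcongr <;> first | exact hM _ _ | exact hN _ _

theorem abs_le_of_modelCombo {r : Fin 3 → ℝ} {B : ℝ} (h : ∀ l, |modelCombo r l| ≤ B) (l : Fin 3) :
    |r l| ≤ 10 * B := by
  have hk := cos_pi_div_seven_bounds
  have hη := eta_bounds
  have h0 : |r 0 - r 2 / 2| ≤ B := h 0
  have h1 : |r 1 - Real.cos (Real.pi / 7) * r 2| ≤ B := h 1
  have h2 : |√(Real.cos (Real.pi / 7) ^ 2 - 3 / 4) * r 2| ≤ B := h 2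
  have hr2 : |r 2| ≤ 5 * B := by
    rw [abs_mul, abs_of_pos (by linarith)] at h2
    nlinarith [abs_nonneg (r 2)]
  have hkr : |Real.cos (Real.pi / 7) * r 2| ≤ 5 * B := by
    rw [abs_mul, abs_of_pos (by linarith)]
    nlinarith [abs_nonneg (r 2)]
  have hB : 0 ≤ B := (abs_nonneg _).trans h0
  rw [abs_le] at h0 h1 hr2 hkr ⊢
  fin_cases l
  · change -(10 * B) ≤ r 0 ∧ r 0 ≤ 10 * B
    constructor <;> linarith
  · change -(10 * B) ≤ r 1 ∧ r 1 ≤ 10 * B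
    constructor <;> linarith
  · change -(10 * B) ≤ r 2 ∧ r 2 ≤ 10 * B
    constructor <;> linarith

theorem eq_one_or_neg_one_of_commute {C : SL(2, ℂ)}
    (h0 : (C : Matrix (Fin 2) (Fin 2) ℂ) * realMat (modelVec 0) = realMat (modelVec 0) * C)
    (h1 : (C : Matrix (Fin 2) (Fin 2) ℂ) * realMat (modelVec 1) = realMat (modelVec 1) * C) :
    C = 1 ∨ C = -1 := by
  have e01 := congrFun (congrFun h0 0) 1
  have e10 := congrFun (congrFun h0 1) 0
  have f01 := congrFun (congrFun h1 0) 1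
  simp [Matrix.mul_apply, Fin.sum_univ_two, realMat, modelVec] at e01 e10 f01
  have g01 : C 0 1 = 0 := by linear_combination (-1 / 2) * e01
  have g10 : C 1 0 = 0 := by linear_combination (1 / 2) * e10
  have hd := C.det_coe
  rw [Matrix.det_fin_two, g01, g10, ← f01] at hd
  have hd : (C 0 0 - 1) * (C 0 0 + 1) = 0 := by linear_combination hd
  rcases mul_eq_zero.mp hd with h | h
  · left
    have h := sub_eq_zero.mp h
    ext i j; fin_cases i <;> fin_cases j <;> simp [g01, g10, ← f01, h]
  · right
    have h := eq_neg_of_add_eq_zero_left h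
    ext i j; fin_cases i <;> fin_cases j <;> simp [g01, g10, ← f01, h]

theorem finite_isIntegral237 {c : Fin 3 → ℝ} (hc : IsConjTriple c) :
    {A : SL(2, ℂ) | IsIntegral237 c A ∧ ∀ i j, ‖A i j‖ ≤ 2}.Finite := by
  set D : Set (Fin 3 → ℝ) :=
    Set.pi Set.univ fun _ => (fun a : Fin 3 → ℝ => a 0) '' {a ∈ conjInt c | ∀ j, |a j| ≤ 320}
  have hD : D.Finite := Set.Finite.pi fun _ => (finite_conjInt hc 320).image _
  set Φ : SL(2, ℂ) → Fin 3 → Matrix (Fin 2) (Fin 2) ℂ :=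
    fun A i => (A : Matrix (Fin 2) (Fin 2) ℂ) * realMat (modelVec i) * (A⁻¹ : SL(2, ℂ))
  refine Set.Finite.of_finite_fibers Φ ?_ ?_
  · refine (Set.Finite.pi fun _ : Fin 3 => hD.image (realMat ∘ modelCombo)).subset ?_
    rintro _ ⟨A, ⟨hA, hb⟩, rfl⟩ i -
    obtain ⟨r, hr, hu, h⟩ := hA i
    have hAA : (A : Matrix (Fin 2) (Fin 2) ℂ) * (A⁻¹ : SL(2, ℂ)) = 1 := by
      rw [← Matrix.SpecialLinearGroup.coe_mul, mul_inv_cancel, Matrix.SpecialLinearGroup.coe_one]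
    have hΦ : Φ A i = realMat (modelCombo (r 0)) := by
      change _ * _ * _ = _
      rw [h, Matrix.mul_assoc, hAA, Matrix.mul_one]
    refine ⟨r 0, ?_, hΦ.symm⟩
    have hinv : ∀ i j, ‖(A⁻¹ : SL(2, ℂ)) i j‖ ≤ 2 := by
      intro i j
      rw [Matrix.SpecialLinearGroup.coe_inv, Matrix.adjugate_fin_two]
      fin_cases i <;> fin_cases j <;> simp [hb]
    have hr0 : ∀ l, |r 0 l| ≤ 320 := by
      have := abs_le_of_modelCombo (r := r 0) (B := 32) (abs_le_of_norm_realMat fun a b => by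
        rw [← hΦ]
        refine (norm_mul_apply_le (norm_mul_apply_le hb (norm_realMat_le (abs_modelVec_le i)))
          hinv a b).trans ?_
        norm_num)
      intro l
      exact (this l).trans (by norm_num)
    intro l _
    refine ⟨fun j => r j l, ⟨hr l, fun j => ?_⟩, rfl⟩
    have b1 := hc.one_gt
    have b2 := hc.one_lt
    have b3 := hc.two_gt
    have b4 := hc.two_lt
    fin_cases j
    · exact hr0 l
    · exact (abs_le_of_coordForm (by nlinarith) (hu 1) l).trans (by norm_num)
    · exact (abs_le_of_coordForm (by nlinarith) (hu 2) l).trans (by norm_num)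
  · rintro _ ⟨A, hA, rfl⟩
    refine (Set.toFinite {A, -A}).subset ?_
    rintro B ⟨-, hB⟩
    have hB : Φ B = Φ A := hB
    have hcomm : ∀ i, ((A⁻¹ * B : SL(2, ℂ)) : Matrix (Fin 2) (Fin 2) ℂ) * realMat (modelVec i) =
        realMat (modelVec i) * ((A⁻¹ * B : SL(2, ℂ)) : Matrix (Fin 2) (Fin 2) ℂ) := by
      intro i
      have h := congrFun hB i
      simp only [Φ] at h
      have hAA : ((A⁻¹ : SL(2, ℂ)) : Matrix (Fin 2) (Fin 2) ℂ) * A = 1 := by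
        rw [← Matrix.SpecialLinearGroup.coe_mul, inv_mul_cancel, Matrix.SpecialLinearGroup.coe_one]
      have hBB : ((B⁻¹ : SL(2, ℂ)) : Matrix (Fin 2) (Fin 2) ℂ) * B = 1 := by
        rw [← Matrix.SpecialLinearGroup.coe_mul, inv_mul_cancel, Matrix.SpecialLinearGroup.coe_one]
      have h2 := congrArg (fun X => ((A⁻¹ : SL(2, ℂ)) : Matrix (Fin 2) (Fin 2) ℂ) * X * B) h
      simp only [Matrix.mul_assoc, hBB, Matrix.mul_one] at h2
      rw [← Matrix.mul_assoc _ (A : Matrix (Fin 2) (Fin 2) ℂ), hAA, Matrix.one_mul] at h2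
      simpa only [Matrix.SpecialLinearGroup.coe_mul, Matrix.mul_assoc] using h2
    rcases eq_one_or_neg_one_of_commute (hcomm 0) (hcomm 1) with h | h
    · left; exact (inv_mul_eq_one.mp h).symm
    · right
      rw [inv_mul_eq_iff_eq_mul] at h
      rw [h]; simp

/-- Half-turns about the sides of a `(2,3,7)` triangle. -/
noncomputable def modelLift (i : Fin 3) : SL(2, ℂ) := (exists_isHalfTurn (lform_modelVec i)).choose

theorem isHalfTurn_modelLift (i : Fin 3) : IsHalfTurn (modelLift i) (modelVec i) :=
  (exists_isHalfTurn (lform_modelVec i)).choose_spec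

/-- The generators of the `(2,3,7)` triangle group. -/
noncomputable def model (i : Fin 3) : PSL(2, ℂ) := QuotientGroup.mk (modelLift i)

theorem orderOf_model (i : Fin 3) : orderOf (model i) = 2 := by
  rw [model, orderOf_mk_eq_two_iff]
  obtain ⟨h1, -, -, h4⟩ := (isHalfTurn_modelLift i).entries
  rw [h1, h4]

theorem discreteTopology_model : DiscreteTopology (Subgroup.closure (Set.range model)) := by
  obtain ⟨c, hc⟩ := exists_isConjTriple
  have hint : ∀ g ∈ Subgroup.closure (Set.range model),
      ∃ A : SL(2, ℂ), QuotientGroup.mk A = g ∧ IsIntegral237 c A := by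
    intro g hg
    induction hg using Subgroup.closure_induction_left with
    | one => exact ⟨1, rfl, isIntegral237_one c⟩
    | mul_left x hx y hy ih =>
      obtain ⟨k, rfl⟩ := hx
      obtain ⟨A, rfl, hA⟩ := ih
      exact ⟨modelLift k * A, rfl, hA.mul hc (isHalfTurn_modelLift k)⟩
    | inv_mul_cancel x hx y hy ih =>
      obtain ⟨k, rfl⟩ := hx
      obtain ⟨A, rfl, hA⟩ := ih
      refine ⟨modelLift k * A, ?_, hA.mul hc (isHalfTurn_modelLift k)⟩
      have : (model k)⁻¹ = model k := by
        rw [inv_eq_iff_mul_eq_one, ← sq]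
        exact (orderOf_eq_prime_iff.mp (orderOf_model k)).1
      rw [this]; rfl
  set U : Set SL(2, ℂ) := {A | ∀ i j, ‖A i j‖ < 2}
  have hU : IsOpen U := by
    simp only [U, Set.ofPred_forall]
    refine isOpen_iInter_of_finite fun i => isOpen_iInter_of_finite fun j => ?_
    refine isOpen_lt ?_ continuous_const
    have hval : Continuous fun A : SL(2, ℂ) => (A : Matrix (Fin 2) (Fin 2) ℂ) :=
      continuous_induced_dom
    exact ((continuous_apply j).comp ((continuous_apply i).comp hval)).norm
  have hUo : IsOpen ((QuotientGroup.mk : SL(2, ℂ) → PSL(2, ℂ)) '' U) :=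
    QuotientGroup.isOpenMap_coe U hU
  have hfin : ((QuotientGroup.mk : SL(2, ℂ) → PSL(2, ℂ)) '' U ∩
      Subgroup.closure (Set.range model)).Finite := by
    refine ((finite_isIntegral237 hc).image (QuotientGroup.mk : SL(2, ℂ) → PSL(2, ℂ))).subset ?_
    rintro _ ⟨⟨A, hA, rfl⟩, hg⟩
    obtain ⟨B, hBA, hB⟩ := hint _ hg
    refine ⟨A, ⟨?_, fun i j => (hA i j).le⟩, rfl⟩
    rcases mk_eq_mk_iff.mp hBA with rfl | rfl
    · exact hB
    · simpa using isIntegral237_neg hB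
  have := t2Space_psl
  apply discreteTopology_of_isOpen_singleton_one
  set V : Set (Subgroup.closure (Set.range model)) :=
    Subtype.val ⁻¹' ((QuotientGroup.mk : SL(2, ℂ) → PSL(2, ℂ)) '' U)
  have hV : IsOpen V := hUo.preimage continuous_subtype_val
  have hVf : V.Finite := by
    apply Set.Finite.of_finite_image (f := Subtype.val) _ Subtype.val_injective.injOn
    refine hfin.subset ?_
    rintro _ ⟨x, hx, rfl⟩
    exact ⟨hx, x.2⟩
  have h1 : (1 : Subgroup.closure (Set.range model)) ∈ V := by
    refine ⟨1, fun i j => ?_, rfl⟩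
    fin_cases i <;> fin_cases j <;> simp
  have : {(1 : Subgroup.closure (Set.range model))} = V ∩ (V \ {1})ᶜ := by
    ext x
    simp only [Set.mem_singleton_iff, Set.mem_inter_iff, Set.mem_compl_iff, Set.mem_sdiff, not_and,
      not_not]
    constructor
    · rintro rfl; exact ⟨h1, fun _ => rfl⟩
    · rintro ⟨h, h'⟩; exact h' h
  rw [this]
  exact hV.inter (hVf.subset Set.sdiff_subset).isClosed.isOpen_compl

theorem IsHalfTurn.im_eq_zero_of_fixed {A : SL(2, ℂ)} {v : Fin 3 → ℝ} (h : IsHalfTurn A v)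
    {p : H3} (hp : A • p = p) : p.z.im = 0 := by
  have hu : v 0 * v 0 + v 1 * v 1 - v 2 * v 2 = 1 := h.unit
  have ht := p.t_pos
  have h1 := h.coshDist_smul_self' p rfl rfl rfl
  rw [hp, show coshDist p p = 1 by simp [coshDist], eq_div_iff (by positivity)] at h1
  set a := v 0 - (v 1 - v 2) * p.z.re with ha
  set c := v 1 - v 2 with hc
  set b := v 1 + v 2 + 2 * v 0 * p.z.re - c * p.z.re ^ 2 with hb
  have habc : a ^ 2 + b * c = 1 := by rw [hb, ha, ← hu, hc]; ring
  have key : (b + c * p.z.im ^ 2 - c * p.t ^ 2) ^ 2 + 4 * (p.z.im * a) ^ 2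
      + 4 * (p.t * (c * p.z.im)) ^ 2 = 0 := by
    linear_combination -h1 - 2 * p.t ^ 2 * habc
  by_contra hy
  have p1 := sq_nonneg (b + c * p.z.im ^ 2 - c * p.t ^ 2)
  have p2 := sq_nonneg (p.z.im * a)
  have p3 := sq_nonneg (p.t * (c * p.z.im))
  have h2 : (p.z.im * a) ^ 2 = 0 := by linarith
  have h3 : (p.t * (c * p.z.im)) ^ 2 = 0 := by linarith
  have h4 : a = 0 := by simpa [hy] using h2
  have h5 : c = 0 := by simpa [hy, ht.ne'] using h3
  rw [h4, h5] at habc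
  norm_num at habc

/-- The points mapped to the plane of real points form a plane. -/
theorem isPlane_im_smul (g : PSL(2, ℂ)) : IsPlane {p : H3 | (g • p).z.im = 0} := by
  obtain ⟨A, rfl⟩ := QuotientGroup.mk_surjective g
  have hdet := A.det_coe
  rw [Matrix.det_fin_two] at hdet
  set a := A 0 0 with ha
  set b := A 0 1 with hb
  set c := A 1 0 with hc
  set d := A 1 1 with hd
  set K := (a * conj c).im with hK
  set m := (b * conj d).im with hm
  set w := a * conj d - conj b * c with hw
  have hre := congrArg Complex.re hdet
  have him := congrArg Complex.im hdet
  have hdisc : w.re ^ 2 + w.im ^ 2 - 4 * K * m = 1 := by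
    simp only [hw, hK, hm, Complex.sub_re, Complex.sub_im, Complex.mul_re, Complex.mul_im,
      Complex.conj_re, Complex.conj_im, Complex.one_re, Complex.one_im] at hre him ⊢
    linear_combination ((a.re * d.re - a.im * d.im) - (b.re * c.re - b.im * c.im) + 1) * hre +
      ((a.re * d.im + a.im * d.re) - (b.re * c.im + b.im * c.re)) * him
  have hset : {p : H3 | ((QuotientGroup.mk A : PSL(2, ℂ)) • p).z.im = 0} =
      {p : H3 | K * (p.z.re ^ 2 + p.z.im ^ 2 + p.t ^ 2) + (w.im * p.z.re + w.re * p.z.im) + m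
        = 0} := by
    ext p
    have hp := den_pos A p
    have hn : (num A p).im = K * (p.z.re ^ 2 + p.z.im ^ 2 + p.t ^ 2)
        + (w.im * p.z.re + w.re * p.z.im) + m := by
      simp only [num, ← ha, ← hb, ← hc, ← hd, hw, hK, hm, Complex.add_im, Complex.add_re,
        Complex.sub_re, Complex.sub_im, Complex.mul_re, Complex.mul_im, Complex.conj_re,
        Complex.conj_im, ← Complex.ofReal_pow, Complex.ofReal_re, Complex.ofReal_im]
      ring
    change (num A p / (den A p : ℂ)).im = 0 ↔ _
    rw [Complex.div_ofReal_im, div_eq_zero_iff, or_iff_left hp.ne', hn]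
    rfl
  rw [hset]
  clear_value w K m
  by_cases hK0 : K = 0
  · left
    refine ⟨Complex.I * conj w, -m, ?_, ?_⟩
    · intro h0
      have : w = 0 := by simpa using h0
      rw [this, hK0] at hdisc
      norm_num at hdisc
    · ext p
      simp only [Set.mem_ofPred_eq, hK0, map_mul, Complex.conj_I, Complex.conj_conj,
        Complex.mul_re, Complex.mul_im, Complex.neg_re, Complex.neg_im, Complex.I_re, Complex.I_im]
      constructor <;> intro h <;> linarith
  · right
    refine ⟨⟨-w.im / (2 * K), -w.re / (2 * K)⟩, 1 / (2 * |K|), by positivity, ?_⟩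
    ext p
    have hr : (1 / (2 * |K|)) ^ 2 = 1 / (4 * K ^ 2) := by
      rw [div_pow, mul_pow, sq_abs]; norm_num
    rw [Set.mem_ofPred_eq, Set.mem_ofPred_eq, hr, ← Complex.normSq_eq_norm_sq, Complex.normSq_apply,
      Complex.sub_re, Complex.sub_im]
    have : K * ((p.z.re - -w.im / (2 * K)) * (p.z.re - -w.im / (2 * K)) +
        (p.z.im - -w.re / (2 * K)) * (p.z.im - -w.re / (2 * K)) + p.t ^ 2 - 1 / (4 * K ^ 2)) =
        K * (p.z.re ^ 2 + p.z.im ^ 2 + p.t ^ 2) + (w.im * p.z.re + w.re * p.z.im) + m := by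
      field_simp
      linear_combination 4 * hdisc
    rw [← this, mul_eq_zero, or_iff_right hK0, sub_eq_zero]

theorem Is222Kleinian.conj_of_real {f : Fin 3 → PSL(2, ℂ)} (hf : ∀ i, orderOf (f i) = 2)
    (hfix : ∀ i, ∀ p ∈ axis (f i), p.z.im = 0) (hK : IsKleinian (Subgroup.closure (Set.range f)))
    (h : PSL(2, ℂ)) : Is222Kleinian fun i => h * f i * h⁻¹ := by
  refine ⟨fun i => ?_, ⟨_, isPlane_im_smul h⁻¹, fun i p hp => ?_⟩, ?_⟩
  · exact (orderOf_injective (MulAut.conj h).toMonoidHom (MulAut.conj h).injective (f i)).trans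
      (hf i)
  · refine hfix i _ ?_
    have := axis_conj h⁻¹ _ hp
    rwa [show h⁻¹ * (h * f i * h⁻¹) * h⁻¹⁻¹ = f i by group] at this
  · rw [closure_conj]
    exact hK.conj h

/-! ### The triangle group is not virtually abelian -/

theorem exists_pow_eq {g : Matrix (Fin 2) (Fin 2) ℂ} {τ : ℝ} (hτ : 0 < τ)
    (hg : g * g = (τ : ℂ) • g + 1) {n : ℕ} (hn : n ≠ 0) :
    ∃ α β : ℝ, 0 < α ∧ 0 ≤ β ∧ g ^ n = (α : ℂ) • g + (β : ℂ) • (1 : Matrix (Fin 2) (Fin 2) ℂ) := by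
  obtain ⟨n, rfl⟩ := Nat.exists_eq_succ_of_ne_zero hn
  clear hn
  induction n with
  | zero => exact ⟨1, 0, one_pos, le_rfl, by simp⟩
  | succ n ih =>
    obtain ⟨α, β, hα, hβ, h⟩ := ih
    refine ⟨α * τ + β, α, by positivity, hα.le, ?_⟩
    rw [pow_succ, h, add_mul, smul_mul_assoc, hg, smul_mul_assoc, one_mul, smul_add, smul_smul]
    push_cast
    rw [add_smul]
    abel

theorem commute_of_pow_commute {g h : Matrix (Fin 2) (Fin 2) ℂ} {τ : ℝ} (hτ : 0 < τ)
    (hg : g * g = (τ : ℂ) • g + 1) (hh : h * h = (τ : ℂ) • h + 1) {m n : ℕ} (hm : m ≠ 0)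
    (hn : n ≠ 0) (hmn : Commute (g ^ m) (h ^ n)) : g * h = h * g := by
  obtain ⟨α, β, hα, -, h1⟩ := exists_pow_eq hτ hg hm
  obtain ⟨α', β', hα', -, h2⟩ := exists_pow_eq hτ hh hn
  have h3 := hmn.eq
  rw [h1, h2] at h3
  have h4 : ((α : ℂ) * α') • (g * h - h * g) = 0 := by
    rw [← sub_eq_zero] at h3
    rw [← h3]
    ext i j
    fin_cases i <;> fin_cases j <;>
      simp [Matrix.mul_apply, Fin.sum_univ_two, Matrix.one_apply] <;> ring
  rcases smul_eq_zero.mp h4 with h5 | h5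
  · exfalso
    have : (α : ℂ) * α' ≠ 0 := by exact_mod_cast (mul_pos hα hα').ne'
    exact this h5
  · exact sub_eq_zero.mp h5

theorem not_isVirtuallyAbelian_model :
    ¬ IsVirtuallyAbelian (Subgroup.closure (Set.range model)) := by
  rintro ⟨B, hB, hcomm⟩
  have hmem : ∀ i, model i ∈ Subgroup.closure (Set.range model) := fun i =>
    Subgroup.subset_closure ⟨i, rfl⟩
  set x : Subgroup.closure (Set.range model) := ⟨model 1 * model 0 * model 2,
    mul_mem (mul_mem (hmem 1) (hmem 0)) (hmem 2)⟩ with hx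
  set y : Subgroup.closure (Set.range model) := ⟨model 0 * model 2 * model 1,
    mul_mem (mul_mem (hmem 0) (hmem 2)) (hmem 1)⟩ with hy
  obtain ⟨m, hm0, -, hm⟩ := Subgroup.exists_pow_mem_of_index_ne_zero hB.index_ne_zero x
  obtain ⟨n, hn0, -, hn⟩ := Subgroup.exists_pow_mem_of_index_ne_zero hB.index_ne_zero y
  have hxy : x ^ m * y ^ n = y ^ n * x ^ m := by
    have := hcomm.is_comm.comm ⟨_, hm⟩ ⟨_, hn⟩
    exact congrArg Subtype.val this
  set G : SL(2, ℂ) := modelLift 1 * modelLift 0 * modelLift 2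
  set H : SL(2, ℂ) := modelLift 0 * modelLift 2 * modelLift 1
  have hGH : (QuotientGroup.mk (G ^ m * H ^ n) : PSL(2, ℂ)) = QuotientGroup.mk (H ^ n * G ^ m) :=
    congrArg Subtype.val hxy
  have hGH2 : G ^ (2 * m) * H ^ n = H ^ n * G ^ (2 * m) := by
    rcases mk_eq_mk_iff.mp hGH with h | h
    · rw [two_mul, pow_add, mul_assoc, h, ← mul_assoc, h, mul_assoc]
    · rw [two_mul, pow_add, mul_assoc, h, mul_neg, ← mul_assoc, h, neg_mul, neg_neg, mul_assoc]
  set g := realMat (modelVec 1) * realMat (modelVec 0) * realMat (modelVec 2) with hg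
  set h := realMat (modelVec 0) * realMat (modelVec 2) * realMat (modelVec 1) with hh
  have hG : (G : Matrix (Fin 2) (Fin 2) ℂ) = (-Complex.I) • g := by
    change ((modelLift 1 * modelLift 0 * modelLift 2 : SL(2, ℂ)) : Matrix (Fin 2) (Fin 2) ℂ) = _
    rw [Matrix.SpecialLinearGroup.coe_mul, Matrix.SpecialLinearGroup.coe_mul,
      isHalfTurn_modelLift 0, isHalfTurn_modelLift 1, isHalfTurn_modelLift 2]
    simp only [smul_mul_smul_comm, Complex.I_mul_I, neg_mul, one_mul, hg]
  have hH : (H : Matrix (Fin 2) (Fin 2) ℂ) = (-Complex.I) • h := by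
    change ((modelLift 0 * modelLift 2 * modelLift 1 : SL(2, ℂ)) : Matrix (Fin 2) (Fin 2) ℂ) = _
    rw [Matrix.SpecialLinearGroup.coe_mul, Matrix.SpecialLinearGroup.coe_mul,
      isHalfTurn_modelLift 0, isHalfTurn_modelLift 1, isHalfTurn_modelLift 2]
    simp only [smul_mul_smul_comm, Complex.I_mul_I, neg_mul, one_mul, hh]
  have hI : (-Complex.I) ^ (2 * m) * (-Complex.I) ^ n ≠ 0 := by simp
  have hpow : Commute (g ^ (2 * m)) (h ^ n) := by
    have := congrArg (fun A : SL(2, ℂ) => (A : Matrix (Fin 2) (Fin 2) ℂ)) hGH2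
    simp only [Matrix.SpecialLinearGroup.coe_mul, Matrix.SpecialLinearGroup.coe_pow, hG, hH,
      smul_pow, smul_mul_smul_comm] at this
    rw [mul_comm ((-Complex.I) ^ n)] at this
    exact smul_right_injective _ hI this
  have hη := eta_sq
  have hη0 := eta_bounds.1
  have hk := cos_pi_div_seven_bounds.1
  set η := √(Real.cos (Real.pi / 7) ^ 2 - 3 / 4) with hηd
  set k := Real.cos (Real.pi / 7) with hkd
  have hηC : (η : ℂ) ^ 2 = k ^ 2 - 3 / 4 := by
    simpa using congrArg Complex.ofReal hη
  have e1 : g = !![(k + η : ℂ), -1 / 2; -1 / 2, (η - k : ℂ)] := by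
    ext i j
    fin_cases i <;> fin_cases j <;>
      simp [hg, realMat, modelVec, ← hηd, ← hkd] <;> ring
  have e2 : h = !![(η - k : ℂ), -1 / 2; -1 / 2, (k + η : ℂ)] := by
    ext i j
    fin_cases i <;> fin_cases j <;>
      simp [hh, realMat, modelVec, ← hηd, ← hkd] <;> ring
  have hgg : g * g = ((2 * η : ℝ) : ℂ) • g + 1 := by
    rw [e1]
    ext i j
    fin_cases i <;> fin_cases j <;> simp [Matrix.mul_apply, Fin.sum_univ_two]
    · linear_combination -hηC
    · ring
    · ring
    · linear_combination -hηC
  have hhh : h * h = ((2 * η : ℝ) : ℂ) • h + 1 := by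
    rw [e2]
    ext i j
    fin_cases i <;> fin_cases j <;> simp [Matrix.mul_apply, Fin.sum_univ_two]
    · linear_combination -hηC
    · ring
    · ring
    · linear_combination -hηC
  have hc := commute_of_pow_commute (by linarith) hgg hhh (by omega) hn0.ne' hpow
  rw [e1, e2] at hc
  have hc := congrFun (congrFun hc 0) 1
  simp [Matrix.mul_apply, Fin.sum_univ_two] at hc
  have hkC : (k : ℂ) = 0 := by linear_combination (-1 / 2) * hc
  have : k = 0 := by exact_mod_cast hkC
  linarith

/-! ### Its Margulis constant -/

theorem margulisConstant_model_le : margulisConstant model ≤ Real.arcosh cosh237 := by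
  have hη := eta_sq
  have hη0 := eta_bounds.1
  have hs := sinh237_sq
  have hs0 := sinh237_pos
  set η := √(Real.cos (Real.pi / 7) ^ 2 - 3 / 4) with hηd
  set k := Real.cos (Real.pi / 7) with hkd
  have hne : η ≠ 0 := by linarith
  set ζ := -(sinh237 * (3 / 2 + k) / η) with hζ
  have hζη : ζ * η = -(sinh237 * (3 / 2 + k)) := by rw [hζ]; field_simp
  have hζ2 : ζ ^ 2 = 1 + 2 * sinh237 ^ 2 := by
    have h1 : ζ ^ 2 * η ^ 2 = sinh237 ^ 2 * (3 / 2 + k) ^ 2 := by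
      rw [← mul_pow, hζη]; ring
    have h2 : η ^ 2 ≠ 0 := by positivity
    apply mul_right_cancel₀ h2
    have hs' : sinh237 ^ 2 * (15 / 4 + 3 * k - k ^ 2) = k ^ 2 - 3 / 4 := hs
    rw [h1, hη]
    linear_combination hs'
  obtain ⟨p, hp, e, he, hpe⟩ := exists_pointVec (X := ![sinh237, sinh237, ζ]) (by
    simp only [lform, Matrix.cons_val]
    linear_combination -hζ2)
  have hl : ∀ i, lform ![sinh237, sinh237, ζ] (modelVec i) = sinh237 := by
    intro i
    fin_cases i
    · simp [lform, modelVec]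
    · simp [lform, modelVec]
    · simp only [lform, modelVec, Fin.reduceFinMk, Matrix.cons_val, ← hηd, ← hkd]
      linear_combination -hζη
  refine (ciInf_le (bddBelow_range_iSup model) p).trans (ciSup_le fun i => ?_)
  apply le_of_eq
  rw [hdist_eq]
  congr 1
  rw [model, mk_smul, (isHalfTurn_modelLift i).coshDist_eq hp, height_eq_lform, hpe, cosh237]
  have : lform (e • ![sinh237, sinh237, ζ]) (modelVec i) = e * sinh237 := by
    conv_rhs => rw [← hl i]
    simp only [lform, Pi.smul_apply, smul_eq_mul]
    ring
  rw [this]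
  rcases he with rfl | rfl <;> ring

theorem isKleinian_model : IsKleinian (Subgroup.closure (Set.range model)) :=
  ⟨discreteTopology_model, not_isVirtuallyAbelian_model⟩

theorem margulisConstant_model : margulisConstant model = Real.arcosh cosh237 :=
  le_antisymm margulisConstant_model_le (arcosh_cosh237_le isHalfTurn_modelLift isKleinian_model)

theorem axesBound_model : AxesBound237Triangle model :=
  is237_modelVec.axesBound isHalfTurn_modelLift

theorem is222Kleinian_model_conj (h : PSL(2, ℂ)) (σ : Equiv.Perm (Fin 3)) :
    Is222Kleinian fun i => h * model (σ i) * h⁻¹ := by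
  refine Is222Kleinian.conj_of_real (f := fun i => model (σ i)) (fun i => orderOf_model _)
    (fun i p hp => (isHalfTurn_modelLift (σ i)).im_eq_zero_of_fixed hp) ?_ h
  have : Set.range (fun i => model (σ i)) = Set.range model := σ.surjective.range_comp model
  rw [this]
  exact isKleinian_model

theorem margulisConstant_model_conj (h : PSL(2, ℂ)) (σ : Equiv.Perm (Fin 3)) :
    margulisConstant (fun i => h * model (σ i) * h⁻¹) = Real.arcosh cosh237 := by
  rw [margulisConstant_conj h fun i => model (σ i), ← margulisConstant_model]
  exact margulisConstant_perm σ model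

/-! ### The value of the bound -/

theorem bound237_eq_two_mul_artanh : bound237 =
    2 * Real.artanh (√((Real.cos (Real.pi / 7) ^ 2 - 3 / 4) / (3 * (1 + Real.cos (Real.pi / 7))))) := by
  have hk := cos_pi_div_seven_bounds.1
  rw [bound237, Real.cos_pi_div_three]
  congr 3
  field_simp
  ring

theorem bound237_eq : bound237 = Real.arcosh cosh237 := by
  have hk := cos_pi_div_seven_bounds
  have hs := sinh237_sq
  have hrad := rad237_pos
  rw [bound237_eq_two_mul_artanh]
  set k := Real.cos (Real.pi / 7)
  set q := (k ^ 2 - 3 / 4) / (3 * (1 + k)) with hq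
  have hq0 : 0 ≤ q := div_nonneg (by nlinarith) (by linarith)
  have hq1 : q < 1 := by rw [hq, div_lt_one (by linarith)]; nlinarith
  have hy0 := Real.sqrt_nonneg q
  have hy2 := Real.sq_sqrt hq0
  set y := √q
  have hy1 : y < 1 := by nlinarith
  have hmem : y ∈ Set.Ioo (-1) 1 := ⟨by linarith, hy1⟩
  have hcosh : Real.cosh (2 * Real.artanh y) = cosh237 := by
    rw [Real.cosh_two_mul, Real.sinh_sq, Real.cosh_artanh hmem, div_pow, hy2,
      Real.sq_sqrt (by linarith), cosh237]
    have h1 : 1 - q ≠ 0 := by linarith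
    have h2 : sinh237 ^ 2 = q / (1 - q) := by
      rw [eq_div_iff h1]
      apply mul_right_cancel₀ (show 3 * (1 + k) ≠ 0 by linarith)
      have h3 : q * (3 * (1 + k)) = k ^ 2 - 3 / 4 := div_mul_cancel₀ _ (by linarith)
      rw [rad237] at hs
      change sinh237 ^ 2 * (15 / 4 + 3 * k - k ^ 2) = k ^ 2 - 3 / 4 at hs
      linear_combination hs - (1 + sinh237 ^ 2) * h3
    rw [h2]
    field_simp
    ring
  rw [← hcosh, Real.arcosh_cosh (mul_nonneg zero_le_two (Real.artanh_nonneg hy0))]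

theorem bound237_bounds : 0.2088 ≤ bound237 ∧ bound237 < 0.2089 := by
  have hk := cos_pi_div_seven_bounds
  rw [bound237_eq_two_mul_artanh]
  set k := Real.cos (Real.pi / 7)
  set q := (k ^ 2 - 3 / 4) / (3 * (1 + k)) with hq
  have hq1 : 0.10404 ^ 2 ≤ q := by rw [hq, le_div_iff₀ (by linarith)]; nlinarith
  have hq2 : q ≤ 0.10407 ^ 2 := by rw [hq, div_le_iff₀ (by linarith)]; nlinarith
  have hy1 : 0.10404 ≤ √q := Real.le_sqrt_of_sq_le hq1
  have hy2 : √q ≤ 0.10407 := Real.sqrt_le_iff.mpr ⟨by norm_num, hq2⟩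
  set y := √q
  rw [Real.artanh_eq_half_log ⟨by linarith, by linarith⟩]
  have hpos : 0 < (1 + y) / (1 - y) := div_pos (by linarith) (by linarith)
  have hrw : 2 * (1 / 2 * Real.log ((1 + y) / (1 - y))) = Real.log ((1 + y) / (1 - y)) := by ring
  rw [hrw, Real.le_log_iff_exp_le hpos, Real.log_lt_iff_lt_exp hpos]
  have b1 := Real.exp_bound (x := 0.2088) (by norm_num [abs_of_nonneg]) (n := 6) (by norm_num)
  have b2 := Real.exp_bound (x := 0.2089) (by norm_num [abs_of_nonneg]) (n := 6) (by norm_num)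
  rw [abs_le] at b1 b2
  norm_num [Finset.sum_range_succ, Nat.factorial, abs_of_nonneg] at b1 b2
  constructor
  · refine (show Real.exp 0.2088 ≤ 1.23222 by norm_num; linarith).trans ?_
    rw [le_div_iff₀ (by linarith)]
    linarith
  · refine lt_of_le_of_lt (?_ : _ ≤ (1.23232 : ℝ)) (by norm_num; linarith)
    rw [div_le_iff₀ (by linarith)]
    linarith

/-! ### Lifting to half-turns about lines in the plane of real points -/

theorem Is222Kleinian.exists_lift {f : Fin 3 → PSL(2, ℂ)} (hf : Is222Kleinian f) :
    ∃ (h : PSL(2, ℂ)) (A : Fin 3 → SL(2, ℂ)) (T : Fin 3 → Fin 3 → ℝ),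
      (∀ i, IsHalfTurn (A i) (T i)) ∧
      (fun i => (QuotientGroup.mk (A i) : PSL(2, ℂ))) = (fun i => h * f i * h⁻¹) ∧
      IsKleinian (Subgroup.closure (Set.range fun i => (QuotientGroup.mk (A i) : PSL(2, ℂ)))) := by
  obtain ⟨hord, ⟨P, hP, hfP⟩, hK⟩ := hf
  obtain ⟨h, hh⟩ := hP.exists_smul
  choose A hA using fun i => QuotientGroup.mk_surjective (h * f i * h⁻¹)
  have hT : ∀ i, ∃ v, IsHalfTurn (A i) v := by
    intro i
    apply exists_isHalfTurn_of_axis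
    · rw [← orderOf_mk_eq_two_iff]
      refine (congrArg orderOf (hA i)).trans ?_
      exact (orderOf_injective (MulAut.conj h).toMonoidHom (MulAut.conj h).injective (f i)).trans
        (hord i)
    · intro p hp
      have hp' : p ∈ axis (h * f i * h⁻¹) := by rw [← hA i]; exact hp
      have := axis_conj h⁻¹ _ hp'
      rw [show h⁻¹ * (h * f i * h⁻¹) * h⁻¹⁻¹ = f i by group] at this
      simpa using hh _ (hfP i this)
  choose T hT using hT
  refine ⟨h, A, T, hT, funext hA, ?_⟩
  rw [funext hA, closure_conj]
  exact hK.conj h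

theorem Is222Kleinian.bound237_le {f : Fin 3 → PSL(2, ℂ)} (hf : Is222Kleinian f) :
    bound237 ≤ margulisConstant f := by
  obtain ⟨h, A, T, hA, hAf, hK⟩ := hf.exists_lift
  rw [bound237_eq, ← margulisConstant_conj h f, ← hAf]
  exact arcosh_cosh237_le hA hK

theorem IsHalfTurn.neg {A : SL(2, ℂ)} {v : Fin 3 → ℝ} (h : IsHalfTurn A v) :
    IsHalfTurn (-A) (-v) := by
  unfold IsHalfTurn at *
  rw [Matrix.SpecialLinearGroup.coe_neg, h, realMat_neg, smul_neg]

theorem Is222Kleinian.axesBound {f : Fin 3 → PSL(2, ℂ)} (hf : Is222Kleinian f)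
    (hm : margulisConstant f = bound237) : AxesBound237Triangle f := by
  obtain ⟨h, A, T, hA, hAf, hK⟩ := hf.exists_lift
  obtain ⟨e, he, h237⟩ := exists_is237_of_margulisConstant_eq hA hK (by
    rw [hAf, margulisConstant_conj, hm, bound237_eq])
  have hlift : ∀ i, ∃ B : SL(2, ℂ), IsHalfTurn B (e i • T i) ∧
      (QuotientGroup.mk B : PSL(2, ℂ)) = QuotientGroup.mk (A i) := by
    intro i
    rcases he i with h | h
    · exact ⟨A i, by rw [h, one_smul]; exact hA i, rfl⟩
    · exact ⟨-A i, by rw [h, neg_one_smul]; exact (hA i).neg, mk_eq_mk_iff.mpr (Or.inr rfl)⟩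
  choose B hB hBA using hlift
  have h1 := h237.axesBound hB
  rw [show (fun i => (QuotientGroup.mk (B i) : PSL(2, ℂ))) = fun i => h * f i * h⁻¹ from
    (funext hBA).trans hAf] at h1
  have h2 := h1.conj h⁻¹
  convert h2 using 2 with i
  group

theorem AxesBound237Triangle.is222Kleinian {f : Fin 3 → PSL(2, ℂ)}
    (hord : ∀ i, orderOf (f i) = 2) (hf : AxesBound237Triangle f) :
    Is222Kleinian f ∧ margulisConstant f = bound237 := by
  obtain ⟨h, σ, hσ⟩ := AxesBound237Triangle.exists_conj orderOf_model hord axesBound_model hf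
  rw [funext hσ, bound237_eq]
  exact ⟨is222Kleinian_model_conj h σ, margulisConstant_model_conj h σ⟩

end HypThree

/-- Lower bound; it is attained; it is attained exactly by the groups generated by the half-turns
about the sides of a `(2,3,7)` triangle; these are all conjugate, generators included. -/
theorem mainTheorem12 :
    (∀ f : Fin 3 → PSL(2, ℂ), HypThree.Is222Kleinian f →
      HypThree.bound237 ≤ HypThree.margulisConstant f) ∧
    (0.2088 ≤ HypThree.bound237 ∧ HypThree.bound237 < 0.2089) ∧
    (∃ f : Fin 3 → PSL(2, ℂ), HypThree.Is222Kleinian f ∧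
      HypThree.margulisConstant f = HypThree.bound237) ∧
    (∀ f : Fin 3 → PSL(2, ℂ),
      (HypThree.Is222Kleinian f ∧ HypThree.margulisConstant f = HypThree.bound237) ↔
      ((∀ i, orderOf (f i) = 2) ∧ HypThree.AxesBound237Triangle f)) ∧
    (∀ f g : Fin 3 → PSL(2, ℂ),
      HypThree.Is222Kleinian f → HypThree.margulisConstant f = HypThree.bound237 →
      HypThree.Is222Kleinian g → HypThree.margulisConstant g = HypThree.bound237 →
      ∃ (h : PSL(2, ℂ)) (σ : Equiv.Perm (Fin 3)), ∀ i, g i = h * f (σ i) * h⁻¹) := by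
  open HypThree in
  exact ⟨fun f hf => hf.bound237_le, bound237_bounds,
    ⟨model, by simpa using is222Kleinian_model_conj 1 1,
      margulisConstant_model.trans bound237_eq.symm⟩,
    fun f => ⟨fun h => ⟨h.1.1, h.1.axesBound h.2⟩, fun h => h.2.is222Kleinian h.1⟩,
    fun f g hf hfm hg hgm => AxesBound237Triangle.exists_conj hf.1 hg.1 (hf.axesBound hfm)
      (hg.axesBound hgm)⟩
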